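/- Let $K$ be a field of characteristic $0$ (for example $\mathbf C$ or $\mathbf C(q)$), let $q\in K$ be nonzero and not a root of unity, and let $n\ge 2$. **The Fock space.** Let $V(z)=K^n\otimes K[z,z^{-1}]$, with basis $u_{j-an}=z^av_j$ ($1\le j\le n$, $a\in\mathbf Z$). On $V(z)\otimes V(z)$ write $(z^av_j)\otimes(z^bv_k)=(v_j\otimes v_k)\cdot\mathbf z$ with $\mathbf z=z_1^az_2^b$, and put $\mathbf z^\sigma=z_1^bz_2^a$. Define the linear operator $T$ by $$(v_j\otimes v_k\cdot\mathbf z)\,T=\begin{cases}-q\,v_k\otimes v_j\cdot\mathbf z^\sigma-(q^2-1)\,v_j\otimes v_k\cdot\dfrac{z_2\mathbf z^\sigma-z_1\mathbf z}{z_1-z_2}& (j<k),\\[2mm] -v_j\otimes v_k\cdot\mathbf z^\sigma-(q^2-1)\,v_j\otimes v_k\cdot\dfrac{z_1(\mathbf z^\sigma-\mathbf z)}{z_1-z_2}& (j=k),\\[2mm] -q\,v_k\otimes v_j\cdot\mathbf z^\sigma-(q^2-1)\,v_j\otimes v_k\cdot\dfrac{z_1(\mathbf z^\sigma-\mathbf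 z)}{z_1-z_2}& (j>k).\end{cases}$$ For $m\in\mathbf Z$ let $U_{(m)}$ be the vector space with basis the pure tensors $u_{m_1}\otimes u_{m_2}\otimes u_{m_3}\otimes\cdots$ with $m_k=m-k+1$ for all sufficiently large $k$. Let $T_i$ be $T$ acting in the factors $i,i+1$, and let $y_k$ act as multiplication by $z^{-1}$ in the $k$-th factor. The $q$-deformed Fock space is $F_{(m)}=U_{(m)}/\sum_{i\ge1}\mathrm{Ker}(T_i+1)$. **Proposition (Heisenberg commutation relations).** For $a\in\mathbf Z\setminus\{0\}$ the operator $$B_a=\sum_{k\ge1}y_k^{-a}$$ is well defined on every $F_{(m)}$: for each $w\in U_{(m)}$ only finitely many of the vectors $y_k^{-a}w$ have a nonzero class in $F_{(m)}$, and the sum of these classes depends only, and linearly, on the class of $w$ in $F_{(m)}$. For nonzero integers $a_1,a_2,a$: 1. if $a_1+a_2\ne0$, then $[B_{a_1},B_{a_2}]=0$ on every $F_{(m)}$; 2. $\gamma_a=[B_a,B_{-a}]$ is a nonzero constant: there is a nonzero scalar $\gamma_a\in K$, independent of $m$, such that $[B_a,B_{-a}]$ is multiplication by $\gamma_a$ on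 every $F_{(m)}$, and this operator is nonzero on every $F_{(m)}$. Thus the $B_a$ satisfy the Heisenberg relations $[B_a,B_b]=\delta_{a+b,0}\,\gamma_a$ for all nonzero integers $a,b$. -/

import Mathlib

noncomputable section

namespace QFock

/-! Basis of `V(z) = Kⁿ ⊗ K[z, z⁻¹]`: for `1 ≤ j ≤ n` and `a : ℤ` the vector `z ^ a v_j` is
labelled `u_l` with `l = j - a n`.  We recover `j = color n l` and `a = zdeg n l`. -/

/-- The index `j ∈ {1, …, n}` with `u_l = z ^ a v_j`. -/
def color (n : ℕ) (l : ℤ) : ℤ := (l - 1) % (n : ℤ) + 1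

/-- The exponent `a` with `u_l = z ^ a v_j`. -/
def zdeg (n : ℕ) (l : ℤ) : ℤ := -((l - 1) / (n : ℤ))

theorem color_sub_zdeg_mul (n : ℕ) (l : ℤ) : color n l - zdeg n l * n = l := by
  have h := Int.emod_add_mul_ediv (l - 1) (n : ℤ)
  unfold color zdeg
  linarith

theorem color_mem (n : ℕ) (hn : 0 < n) (l : ℤ) : 1 ≤ color n l ∧ color n l ≤ n := by
  have hn' : (0 : ℤ) < n := by exact_mod_cast hn
  have h1 := Int.emod_nonneg (l - 1) hn'.ne'
  have h2 := Int.emod_lt_of_pos (l - 1) hn'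
  unfold color
  omega

/-! Laurent polynomials in two commuting variables `z₁, z₂`; `z₁ ^ a z₂ ^ b` is `mono K a b`. -/

/-- The monomial `z₁ ^ a z₂ ^ b`. -/
def mono (K : Type*) [Field K] (a b : ℤ) : AddMonoidAlgebra K (ℤ × ℤ) :=
  AddMonoidAlgebra.single (a, b) 1

/-- The Laurent polynomial `(z₁ ^ b z₂ ^ a - z₁ ^ a z₂ ^ b) / (z₁ - z₂)`,
see `sub_mul_divDiff`. -/
def divDiff (K : Type*) [Field K] (a b : ℤ) : AddMonoidAlgebra K (ℤ × ℤ) :=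
  ∑ c ∈ Finset.Ico a b, mono K c (a + b - 1 - c) - ∑ c ∈ Finset.Ico b a, mono K c (a + b - 1 - c)

theorem mono_mul (K : Type*) [Field K] (a b c d : ℤ) :
    mono K a b * mono K c d = mono K (a + c) (b + d) := by
  simp [mono, AddMonoidAlgebra.single_mul_single]

theorem sub_mul_sum_mono (K : Type*) [Field K] (s a : ℤ) (d : ℕ) :
    (mono K 1 0 - mono K 0 1) * ∑ c ∈ Finset.Ico a (a + d), mono K c (s - 1 - c)
      = mono K (a + d) (s - (a + d)) - mono K a (s - a) := by
  induction d with
  | zero => simp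
  | succ d ih =>
    have h : Finset.Ico a (a + (d + 1 : ℕ)) = insert (a + d) (Finset.Ico a (a + d)) := by
      ext x
      simp only [Finset.mem_Ico, Finset.mem_insert]
      push_cast
      omega
    rw [h, Finset.sum_insert (by simp), mul_add, ih, sub_mul, mono_mul, mono_mul]
    have e1 : (1 : ℤ) + (a + d) = a + (d + 1 : ℕ) := by push_cast; ring
    have e2 : (0 : ℤ) + (s - 1 - (a + d)) = s - (a + (d + 1 : ℕ)) := by push_cast; ring
    have e3 : (0 : ℤ) + (a + d) = a + d := by ring
    have e4 : (1 : ℤ) + (s - 1 - (a + d)) = s - (a + d) := by ring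
    rw [e1, e2, e3, e4]
    abel

/-- `divDiff K a b` is the quotient of `z^σ - z` by `z₁ - z₂`, where `z = z₁ ^ a z₂ ^ b`. -/
theorem sub_mul_divDiff (K : Type*) [Field K] (a b : ℤ) :
    (mono K 1 0 - mono K 0 1) * divDiff K a b = mono K b a - mono K a b := by
  unfold divDiff
  rcases le_total a b with h | h
  · obtain ⟨d, rfl⟩ := Int.le.dest h
    rw [Finset.Ico_eq_empty_of_le h, Finset.sum_empty, sub_zero, sub_mul_sum_mono]
    congr 2 <;> ring
  · obtain ⟨d, rfl⟩ := Int.le.dest h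
    rw [Finset.Ico_eq_empty_of_le h, Finset.sum_empty, zero_sub, mul_neg, sub_mul_sum_mono,
      neg_sub]
    congr 2 <;> ring

/-- `(z₂ z^σ - z₁ z) / (z₁ - z₂)` for `z = z₁ ^ a z₂ ^ b`, see `sub_mul_quotLT`. -/
def quotLT (K : Type*) [Field K] (a b : ℤ) : AddMonoidAlgebra K (ℤ × ℤ) :=
  divDiff K (a + 1) b

/-- `z₁ (z^σ - z) / (z₁ - z₂)` for `z = z₁ ^ a z₂ ^ b`, see `sub_mul_quotGE`. -/
def quotGE (K : Type*) [Field K] (a b : ℤ) : AddMonoidAlgebra K (ℤ × ℤ) :=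
  mono K 1 0 * divDiff K a b

theorem sub_mul_quotLT (K : Type*) [Field K] (a b : ℤ) :
    (mono K 1 0 - mono K 0 1) * quotLT K a b
      = mono K 0 1 * mono K b a - mono K 1 0 * mono K a b := by
  rw [quotLT, sub_mul_divDiff, mono_mul, mono_mul]
  congr 2 <;> ring

theorem sub_mul_quotGE (K : Type*) [Field K] (a b : ℤ) :
    (mono K 1 0 - mono K 0 1) * quotGE K a b
      = mono K 1 0 * (mono K b a - mono K a b) := by
  rw [quotGE, mul_left_comm, sub_mul_divDiff]

/-- `(v_j ⊗ v_k) · p(z₁, z₂)` as an element of `V(z) ⊗ V(z)`, the vector space with basis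
`u_l ⊗ u_m`, `(l, m) ∈ ℤ × ℤ`. -/
def colored {K : Type*} [Field K] (n : ℕ) (j k : ℤ) (p : AddMonoidAlgebra K (ℤ × ℤ)) :
    (ℤ × ℤ) →₀ K :=
  Finsupp.mapDomain (fun e : ℤ × ℤ => (j - e.1 * n, k - e.2 * n)) p.coeff

/-- The action of the Hecke generator `T` on the basis vector
`u_l ⊗ u_m = (v_j ⊗ v_k) · z₁ ^ a z₂ ^ b` of `V(z) ⊗ V(z)`. -/
def heckePair {K : Type*} [Field K] (n : ℕ) (q : K) (l m : ℤ) : (ℤ × ℤ) →₀ K :=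
  let j := color n l
  let k := color n m
  let a := zdeg n l
  let b := zdeg n m
  if j < k then
    -q • colored n k j (mono K b a) - (q ^ 2 - 1) • colored n j k (quotLT K a b)
  else if j = k then
    -colored n j k (mono K b a) - (q ^ 2 - 1) • colored n j k (quotGE K a b)
  else
    -q • colored n k j (mono K b a) - (q ^ 2 - 1) • colored n j k (quotGE K a b)

/-! The space `U_(m)`.  Tensor factors are numbered from `0`, so the ground state
`u_m ⊗ u_{m-1} ⊗ u_{m-2} ⊗ ⋯` has the factor `u_{m - k}` in position `k`. -/

/-- Index sequences of the pure tensors `u_{s 0} ⊗ u_{s 1} ⊗ ⋯` that coincide with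
`u_m ⊗ u_{m-1} ⊗ ⋯` after finitely many factors. -/
def TensorIndex (m : ℤ) : Type :=
  {s : ℕ → ℤ // ∀ᶠ k in Filter.atTop, s k = m - k}

/-- Replace the entry in position `k`. -/
def TensorIndex.set {m : ℤ} (s : TensorIndex m) (k : ℕ) (l : ℤ) : TensorIndex m :=
  ⟨Function.update s.1 k l, by
    filter_upwards [s.2, Filter.eventually_gt_atTop k] with i hi hk
    rw [Function.update_of_ne hk.ne', hi]⟩

/-- `U_(m)`: the vector space with basis the pure tensors `u_{s 0} ⊗ u_{s 1} ⊗ ⋯`. -/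
abbrev TensorSpace (K : Type*) [Field K] (m : ℤ) : Type _ := TensorIndex m →₀ K

/-- The Hecke generator `T` acting in the tensor positions `i, i + 1` of `U_(m)`. -/
def hecke {K : Type*} [Field K] (n : ℕ) (q : K) (m : ℤ) (i : ℕ) :
    TensorSpace K m →ₗ[K] TensorSpace K m :=
  Finsupp.linearCombination K fun s : TensorIndex m =>
    Finsupp.mapDomain (fun p : ℤ × ℤ => (s.set i p.1).set (i + 1) p.2)
      (heckePair n q (s.1 i) (s.1 (i + 1)))

/-- The operator `y_k ^ c` (`c : ℤ`) on `U_(m)`.  As `y_k` is multiplication by `z⁻¹` in the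
tensor position `k`, it replaces the factor `u_l = z ^ a v_j` by
`z ^ (a - c) v_j = u_{l + c n}`. -/
def yPow (K : Type*) [Field K] (n : ℕ) (m : ℤ) (k : ℕ) (c : ℤ) :
    TensorSpace K m →ₗ[K] TensorSpace K m :=
  Finsupp.linearCombination K fun s : TensorIndex m =>
    Finsupp.single (s.set k (s.1 k + c * n)) 1

/-- The subspace `∑ᵢ Ker (Tᵢ + 1)` of `U_(m)`. -/
def wedgeRelations {K : Type*} [Field K] (n : ℕ) (q : K) (m : ℤ) :
    Submodule K (TensorSpace K m) :=
  ⨆ i : ℕ, LinearMap.ker (hecke n q m i + 1)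

/-- The `q`-deformed Fock space `F_(m) = U_(m) / ∑ᵢ Ker (Tᵢ + 1)`. -/
abbrev FockSpace {K : Type*} [Field K] (n : ℕ) (q : K) (m : ℤ) : Type _ :=
  TensorSpace K m ⧸ wedgeRelations n q m

/-- `β` is the operator `B_a = ∑ₖ yₖ ^ (-a)` on `F_(m)`: for every `w ∈ U_(m)` only finitely many
of the `yₖ ^ (-a) w` have a nonzero class in `F_(m)`, and `β` sends the class of `w` to the sum of
these classes.  There is at most one such `β`, see `IsBOperator.unique`. -/
structure IsBOperator {K : Type*} [Field K] (n : ℕ) (q : K) (m a : ℤ)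
    (β : Module.End K (FockSpace n q m)) : Prop where
  finite : ∀ w : TensorSpace K m,
    {k : ℕ | (wedgeRelations n q m).mkQ (yPow K n m k (-a) w) ≠ 0}.Finite
  apply : ∀ w : TensorSpace K m,
    β ((wedgeRelations n q m).mkQ w) = ∑ᶠ k : ℕ, (wedgeRelations n q m).mkQ (yPow K n m k (-a) w)

theorem IsBOperator.unique {K : Type*} [Field K] {n : ℕ} {q : K} {m a : ℤ}
    {β β' : Module.End K (FockSpace n q m)} (h : IsBOperator n q m a β)
    (h' : IsBOperator n q m a β') : β = β' := by
  refine LinearMap.ext fun x => ?_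
  obtain ⟨w, rfl⟩ := Submodule.mkQ_surjective _ x
  rw [h.apply, h'.apply]

end QFock

end

/-!
The wedges `u_{l₁} ∧ u_{l₂} ∧ ⋯` of all charges are treated together, in the direct sum of the
`F_(m)`. On it there are the creation operators `ψ_l = u_l ∧`, which satisfy the relations of a
`q`-wedge product, and every wedge arises from a ground state by finitely many of them.

The cross relations between the `T_i` and the multiplications by `z` show that `T_i` commutes with
`y_i ^ c + y_{i+1} ^ c`, so that `B_a` respects the relations; and a wedge with more consecutive
factors than available labels vanishes, by straightening (`WedgeRelated.wordProd_mem_span`), so that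
only finitely many terms of `B_a` contribute. On the sum of the Fock spaces `B_a` is a derivation,
`[B_a, ψ_l] = ψ_{l - a n}` (`boson_mul_creation`). Hence `[B_a, B_b]` commutes with all `ψ_l`, and
it is the constant `γ` as soon as it multiplies the ground states of arbitrarily low charge by `γ`
(`eq_smul_one_of_vacuum`).

For `a + b ≠ 0` the commutator changes the energy, and annihilates the ground states for this reason
(`bosonComm_eq_zero`).

For `[B_a, B_{-a}]`, `a > 0`, the idea is to choose vectors on which the straightening rules produce
no correction terms. Above a ground state of charge `n b` fill the labels of each colour `j` up to a
height `H j`, for `j = 0, 1, …, n - 1` from left to right (`seaWord`). The labels of one colour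
anticommute, and a label passes a filled sea of another colour with a scalar factor, since all
correction terms repeat a label of the sea (`WedgeRelated.cross_apWord`). A filled sea has the least
energy for its colours (`sum_le_sum_of_closed`), so `B_a` annihilates it, and in `B_a B_{-a}` only
the terms contribute in which a label among the upper `a` ones of a sea is raised and lowered again.
If the heights decrease by at least `a` from colour to colour, then moving the raised label to the
front, lowering it there and moving it back yields the factor `q ^ (2 a)` for each sea crossed, and
`[B_a, B_{-a}]` multiplies the vector by `a ∑_{j < n} q ^ (2 a j)` (`bosonComm_seas`). Finally, the
seas are turned into a ground state by creating further labels, which commutes with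
`[B_a, B_{-a}]` (`eigenvector_seaWord_const`, `exists_seaWord_const`).

The constant is nonzero as `q` is not a root of unity and the characteristic is `0`, and the
commutator is nonzero since no `F_(m)` vanishes (`ground_not_mem`): the `T_i` satisfy the relations
of a Hecke algebra with parameter `q² ≠ -1`, and the symmetrizers of this algebra annihilate the
kernels of the `T_i + 1`, but not the ground state.
-/

noncomputable section

namespace QFock

/-! ### The Hecke generator on pairs of labels -/

section PairRelations

variable {K : Type*} [Field K]

theorem color_of_mem {n : ℕ} {l : ℤ} (h1 : 1 ≤ l) (h2 : l ≤ n) : color n l = l := by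
  unfold color
  rw [Int.emod_eq_of_lt (by omega) (by omega)]
  ring

theorem zdeg_of_mem {n : ℕ} {l : ℤ} (h1 : 1 ≤ l) (h2 : l ≤ n) : zdeg n l = 0 := by
  unfold zdeg
  rw [Int.ediv_eq_zero_of_lt (by omega) (by omega)]
  ring

theorem color_sub_mul (n : ℕ) (l c : ℤ) : color n (l - c * n) = color n l := by
  unfold color
  rw [show l - c * n - 1 = (l - 1) + n * (-c) by ring, Int.add_mul_emod_self_left]

theorem zdeg_sub_mul {n : ℕ} (hn : 0 < n) (l c : ℤ) : zdeg n (l - c * n) = zdeg n l + c := by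
  unfold zdeg
  rw [show l - c * n - 1 = (l - 1) + n * (-c) by ring,
    Int.add_mul_ediv_left _ _ (by exact_mod_cast hn.ne')]
  ring

theorem mono_sub_ne_zero : mono K 1 0 - mono K 0 1 ≠ 0 := by
  intro h
  have := congrArg (fun p => p.coeff (1, 0)) h
  simp [mono] at this

/-- The recursion in the exponent of `z₁` which yields the cross relation. -/
theorem divDiff_add_one (a b : ℤ) :
    divDiff K (a + 1) b = mono K 0 1 * divDiff K a b - mono K a b := by
  apply mul_left_cancel₀ (mono_sub_ne_zero (K := K))
  rw [sub_mul_divDiff, mul_sub, mul_left_comm, sub_mul_divDiff, sub_mul, mul_sub]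
  simp only [mono_mul]
  simp only [zero_add, add_comm (1 : ℤ)]
  abel

theorem divDiff_add_one_add_one (a b : ℤ) :
    divDiff K (a + 1) (b + 1) = mono K 1 1 * divDiff K a b := by
  apply mul_left_cancel₀ (mono_sub_ne_zero (K := K))
  rw [sub_mul_divDiff, mul_left_comm, sub_mul_divDiff, mul_sub]
  simp only [mono_mul]
  simp only [add_comm (1 : ℤ)]

theorem colored_add (n : ℕ) (j k : ℤ) (p p' : AddMonoidAlgebra K (ℤ × ℤ)) :
    colored n j k (p + p') = colored n j k p + colored n j k p' := by
  simp [colored, Finsupp.mapDomain_add]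

theorem colored_smul (n : ℕ) (j k : ℤ) (c : K) (p : AddMonoidAlgebra K (ℤ × ℤ)) :
    colored n j k (c • p) = c • colored n j k p := by
  simp [colored, Finsupp.mapDomain_smul]

theorem colored_neg (n : ℕ) (j k : ℤ) (p : AddMonoidAlgebra K (ℤ × ℤ)) :
    colored n j k (-p) = -colored n j k p := by
  rw [← neg_one_smul K p, colored_smul, neg_one_smul]

theorem colored_sub (n : ℕ) (j k : ℤ) (p p' : AddMonoidAlgebra K (ℤ × ℤ)) :
    colored n j k (p - p') = colored n j k p - colored n j k p' := by
  rw [sub_eq_add_neg, colored_add, colored_neg, sub_eq_add_neg]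

theorem colored_sum (n : ℕ) (j k : ℤ) {ι : Type*} (s : Finset ι)
    (p : ι → AddMonoidAlgebra K (ℤ × ℤ)) :
    colored n j k (∑ i ∈ s, p i) = ∑ i ∈ s, colored n j k (p i) := by
  classical
  induction s using Finset.induction_on with
  | empty => simp [colored]
  | insert i s hi ih => rw [Finset.sum_insert hi, Finset.sum_insert hi, colored_add, ih]

theorem colored_mono (n : ℕ) (j k a b : ℤ) :
    colored n j k (mono K a b) = Finsupp.single (j - a * n, k - b * n) 1 := by
  simp [colored, mono, Finsupp.mapDomain_single]

/-- Multiplying by `z₁ ^ c z₂ ^ d` lowers the labels by `(c n, d n)`. -/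
theorem colored_mono_mul (n : ℕ) (j k c d : ℤ) (p : AddMonoidAlgebra K (ℤ × ℤ)) :
    colored n j k (mono K c d * p) =
      Finsupp.mapDomain (fun e : ℤ × ℤ => (e.1 - c * n, e.2 - d * n)) (colored n j k p) := by
  induction p using AddMonoidAlgebra.induction_linear with
  | zero => simp [colored]
  | add f g hf hg => rw [mul_add, colored_add, hf, hg, colored_add, Finsupp.mapDomain_add]
  | single e r =>
    rw [mono, AddMonoidAlgebra.single_mul_single]
    simp only [colored, AddMonoidAlgebra.coeff_single, Finsupp.mapDomain_single, one_mul]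
    congr 1
    ext <;> simp <;> ring

/-- The cross relation `T z₁ = z₂ T + (q² - 1) z₁` on a pair of labels. -/
theorem heckePair_sub_left {n : ℕ} (hn : 0 < n) (q : K) (l m : ℤ) :
    heckePair n q (l - n) m =
      Finsupp.mapDomain (fun e : ℤ × ℤ => (e.1, e.2 - n)) (heckePair n q l m)
        + (q ^ 2 - 1) • Finsupp.single (l - (n : ℤ), m) 1 := by
  have hc : color n (l - n) = color n l := by simpa using color_sub_mul n l 1
  have hz : zdeg n (l - n) = zdeg n l + 1 := by simpa using zdeg_sub_mul hn l 1
  have hs : ∀ (i j : ℤ) (p : AddMonoidAlgebra K (ℤ × ℤ)),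
      Finsupp.mapDomain (fun e : ℤ × ℤ => (e.1, e.2 - n)) (colored n i j p)
        = colored n i j (mono K 0 1 * p) := by
    intro i j p
    rw [colored_mono_mul]
    simp
  have hl : Finsupp.single (l - (n : ℤ), m) (1 : K)
      = colored n (color n l) (color n m) (mono K (zdeg n l + 1) (zdeg n m)) := by
    rw [colored_mono, add_mul, one_mul, ← sub_sub, color_sub_zdeg_mul, color_sub_zdeg_mul]
  have hsub : ∀ x y : (ℤ × ℤ) →₀ K,
      Finsupp.mapDomain (fun e : ℤ × ℤ => (e.1, e.2 - (n : ℤ))) (x - y) =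
      Finsupp.mapDomain (fun e : ℤ × ℤ => (e.1, e.2 - (n : ℤ))) x -
      Finsupp.mapDomain (fun e : ℤ × ℤ => (e.1, e.2 - (n : ℤ))) y :=
    fun x y => (Finsupp.lmapDomain K K (fun e : ℤ × ℤ => (e.1, e.2 - (n : ℤ)))).map_sub x y
  have hneg : ∀ x : (ℤ × ℤ) →₀ K,
      Finsupp.mapDomain (fun e : ℤ × ℤ => (e.1, e.2 - (n : ℤ))) (-x) =
      -Finsupp.mapDomain (fun e : ℤ × ℤ => (e.1, e.2 - (n : ℤ))) x :=
    fun x => (Finsupp.lmapDomain K K (fun e : ℤ × ℤ => (e.1, e.2 - (n : ℤ)))).map_neg x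
  have hLT : ∀ a b : ℤ, quotLT K (a + 1) b = mono K 0 1 * quotLT K a b - mono K (a + 1) b := by
    intro a b
    simp only [quotLT]
    rw [divDiff_add_one]
  have hGE : ∀ a b : ℤ, quotGE K (a + 1) b = mono K 0 1 * quotGE K a b - mono K (a + 1) b := by
    intro a b
    simp only [quotGE]
    rw [divDiff_add_one, mul_sub, mul_left_comm, mono_mul]
    simp [add_comm]
  have hm : ∀ a b : ℤ, mono K 0 1 * mono K b a = mono K b (a + 1) := by
    intro a b
    rw [mono_mul]
    simp [add_comm]
  unfold heckePair
  simp only [hc, hz]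
  rw [hl]
  split_ifs
  · rw [hsub, Finsupp.mapDomain_smul, Finsupp.mapDomain_smul, hs, hs, hm, hLT, colored_sub]
    module
  · rw [hsub, hneg, Finsupp.mapDomain_smul, hs, hs, hm, hGE, colored_sub]
    module
  · rw [hsub, Finsupp.mapDomain_smul, Finsupp.mapDomain_smul, hs, hs, hm, hGE, colored_sub]
    module

/-- `T` commutes with `z₁ z₂`, on a pair of labels. -/
theorem heckePair_sub_both {n : ℕ} (hn : 0 < n) (q : K) (l m : ℤ) :
    heckePair n q (l - n) (m - n) =
      Finsupp.mapDomain (fun e : ℤ × ℤ => (e.1 - n, e.2 - n)) (heckePair n q l m) := by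
  have hc : ∀ l, color n (l - n) = color n l := fun l => by simpa using color_sub_mul n l 1
  have hz : ∀ l, zdeg n (l - n) = zdeg n l + 1 := fun l => by simpa using zdeg_sub_mul hn l 1
  have hs : ∀ (i j : ℤ) (p : AddMonoidAlgebra K (ℤ × ℤ)),
      Finsupp.mapDomain (fun e : ℤ × ℤ => (e.1 - n, e.2 - n)) (colored n i j p)
        = colored n i j (mono K 1 1 * p) := by
    intro i j p
    rw [colored_mono_mul]
    simp
  have hsub : ∀ x y : (ℤ × ℤ) →₀ K,
      Finsupp.mapDomain (fun e : ℤ × ℤ => (e.1 - (n : ℤ), e.2 - (n : ℤ))) (x - y) =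
      Finsupp.mapDomain (fun e : ℤ × ℤ => (e.1 - (n : ℤ), e.2 - (n : ℤ))) x -
      Finsupp.mapDomain (fun e : ℤ × ℤ => (e.1 - (n : ℤ), e.2 - (n : ℤ))) y :=
    fun x y =>
      (Finsupp.lmapDomain K K (fun e : ℤ × ℤ => (e.1 - (n : ℤ), e.2 - (n : ℤ)))).map_sub x y
  have hneg : ∀ x : (ℤ × ℤ) →₀ K,
      Finsupp.mapDomain (fun e : ℤ × ℤ => (e.1 - (n : ℤ), e.2 - (n : ℤ))) (-x) =
      -Finsupp.mapDomain (fun e : ℤ × ℤ => (e.1 - (n : ℤ), e.2 - (n : ℤ))) x :=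
    fun x => (Finsupp.lmapDomain K K (fun e : ℤ × ℤ => (e.1 - (n : ℤ), e.2 - (n : ℤ)))).map_neg x
  have hLT : ∀ a b : ℤ, quotLT K (a + 1) (b + 1) = mono K 1 1 * quotLT K a b := by
    intro a b
    simp only [quotLT]
    rw [divDiff_add_one_add_one]
  have hGE : ∀ a b : ℤ, quotGE K (a + 1) (b + 1) = mono K 1 1 * quotGE K a b := by
    intro a b
    simp only [quotGE]
    rw [divDiff_add_one_add_one, mul_left_comm]
  have hm : ∀ a b : ℤ, mono K 1 1 * mono K b a = mono K (b + 1) (a + 1) := by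
    intro a b
    rw [mono_mul]
    simp [add_comm]
  unfold heckePair
  simp only [hc, hz]
  split_ifs
  · rw [hsub, Finsupp.mapDomain_smul, Finsupp.mapDomain_smul, hs, hs, hm, hLT]
  · rw [hsub, hneg, Finsupp.mapDomain_smul, hs, hs, hm, hGE]
  · rw [hsub, Finsupp.mapDomain_smul, Finsupp.mapDomain_smul, hs, hs, hm, hGE]

/-- `T` on a pair of labels of degree `0` in `z`. -/
theorem heckePair_of_mem {n : ℕ} (q : K) {l m : ℤ} (hl : 1 ≤ l) (hl' : l ≤ n)
    (hm : 1 ≤ m) (hm' : m ≤ n) :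
    heckePair n q l m = if l < m then -q • Finsupp.single (m, l) 1 +
        (q ^ 2 - 1) • Finsupp.single (l, m) 1
      else if l = m then -Finsupp.single (l, m) 1 else -q • Finsupp.single (m, l) 1 := by
  have h0 : divDiff K 0 0 = 0 := by simp [divDiff]
  have h1 : divDiff K (0 + 1) 0 = -mono K 0 0 := by rw [divDiff_add_one, h0]; simp
  unfold heckePair
  simp only [color_of_mem hl hl', color_of_mem hm hm', zdeg_of_mem hl hl', zdeg_of_mem hm hm',
    quotLT, quotGE, h0, h1, mul_zero, colored_neg, colored_mono]
  have hz : colored (K := K) n l m 0 = 0 := by simp [colored]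
  rw [hz]
  split_ifs
  · simp
    abel
  · simp
  · simp

/-- The pairs of labels `(x, y)` with the residues of `(l, m)` modulo `n`, with the same sum, and
strictly between `l` and `m`. -/
def innerPairs (n : ℕ) (l m : ℤ) : Set (ℤ × ℤ) :=
  {p | (n : ℤ) ∣ p.1 - l ∧ (n : ℤ) ∣ p.2 - m ∧ p.1 + p.2 = l + m ∧
    min l m < p.1 ∧ p.1 < max l m}

/-- The triangular form of `T` on a pair of distinct labels: besides the flipped pair and the pair
itself, only pairs strictly in between occur. The coefficient of the flipped pair depends on the
residues: it is `-q` if they differ, and otherwise `-q²` for `m < l` and `-1` for `l < m`. -/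
theorem heckePair_expand {n : ℕ} (hn : 0 < n) {q : K} (hq0 : q ≠ 0) {l m : ℤ} (hlm : l ≠ m) :
    ∃ α : K, ∃ r ∈ Finsupp.supported K K (innerPairs n l m), α ≠ 0 ∧
      (¬ (n : ℤ) ∣ l - m → α = -q) ∧
      heckePair n q l m = α • Finsupp.single (m, l) 1 +
        (if l < m then q ^ 2 - 1 else 0) • Finsupp.single (l, m) 1 + r := by
  have hn' : (0 : ℤ) < n := by exact_mod_cast hn
  have hl := color_sub_zdeg_mul n l
  have hm := color_sub_zdeg_mul n m
  obtain ⟨hj1, hj2⟩ := color_mem n hn l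
  obtain ⟨hk1, hk2⟩ := color_mem n hn m
  unfold heckePair
  simp only []
  generalize color n l = j at *
  generalize color n m = k at *
  generalize zdeg n l = a at *
  generalize zdeg n m = b at *
  subst hl hm
  -- different exponents shift the labels by at least `n`, which exceeds `|j - k|`
  have key : ∀ x y : ℤ, x < y → x * n + n ≤ y * n := fun x y h => by nlinarith
  have hS : ∀ (s : Finset ℤ) (f g : ℤ → ℤ),
      (∀ c ∈ s, (j - f c * n, k - g c * n) ∈ innerPairs n (j - a * n) (k - b * n)) →
      colored n j k (∑ c ∈ s, mono K (f c) (g c)) ∈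
        Finsupp.supported K K (innerPairs n (j - a * n) (k - b * n)) := by
    intro s f g h
    rw [colored_sum]
    refine Submodule.sum_mem _ fun c hc => ?_
    rw [colored_mono]
    exact Finsupp.single_mem_supported K 1 (h c hc)
  have hdvd : ∀ x y z : ℤ, (n : ℤ) ∣ z - x * n - (z - y * n) := fun x y z => ⟨y - x, by ring⟩
  have hin : ∀ c d : ℤ, c + d = a + b → min (j - a * n) (k - b * n) < j - c * n →
      j - c * n < max (j - a * n) (k - b * n) →
      (j - c * n, k - d * n) ∈ innerPairs n (j - a * n) (k - b * n) := by
    intro c d hcd h1 h2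
    refine ⟨hdvd _ _ _, hdvd _ _ _, ?_, h1, h2⟩
    have : d = a + b - c := by linarith
    subst this
    ring
  -- in four of the six cases an end of the interval is the pair itself or the flipped pair
  have hins : ∀ x y : ℤ, x < y → Finset.Ico x y = insert (y - 1) (Finset.Ico x (y - 1)) := by
    intro x y h
    ext z
    simp only [Finset.mem_Ico, Finset.mem_insert]
    omega
  have hGE : quotGE K a b = ∑ c ∈ Finset.Ico a b, mono K (c + 1) (a + b - 1 - c)
      - ∑ c ∈ Finset.Ico b a, mono K (c + 1) (a + b - 1 - c) := by
    simp only [quotGE, divDiff, mul_sub, Finset.mul_sum, mono_mul, zero_add, add_comm (1 : ℤ)]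
  have hLT : quotLT K a b = ∑ c ∈ Finset.Ico (a + 1) b, mono K c (a + b - c)
      - ∑ c ∈ Finset.Ico b (a + 1), mono K c (a + b - c) := by
    simp only [quotLT, divDiff]
    congr 1 <;> refine Finset.sum_congr rfl fun c _ => by congr 1; ring
  have hndvd : ¬ (n : ℤ) ∣ j - a * n - (k - b * n) → j ≠ k := by
    rintro h rfl
    exact h (hdvd _ _ _)
  rcases lt_trichotomy j k with hjk | hjk | hjk
  · refine ⟨-q, ?_⟩
    rcases lt_or_ge a b with hab | hab
    · have h1 := key a b hab
      have hlt : ¬ j - a * n < k - b * n := by linarith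
      refine ⟨-(q ^ 2 - 1) • colored n j k (∑ c ∈ Finset.Ico (a + 1) b, mono K c (a + b - c)),
        Submodule.smul_mem _ _ (hS _ _ _ fun c hc => hin _ _ (by ring) ?_ ?_),
        neg_ne_zero.2 hq0, fun _ => rfl, ?_⟩
      · have := key c b (Finset.mem_Ico.1 hc).2
        exact min_lt_of_right_lt (by linarith)
      · have := key a c (by have := (Finset.mem_Ico.1 hc).1; omega)
        exact lt_max_of_lt_left (by linarith)
      · rw [if_pos hjk, if_neg hlt, hLT,
          Finset.Ico_eq_empty_of_le (show b ≥ a + 1 by omega), Finset.sum_empty, sub_zero,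
          colored_mono]
        module
    · have h1 : b * n ≤ a * n := by nlinarith
      have hlt : j - a * n < k - b * n := by linarith
      refine ⟨(q ^ 2 - 1) • colored n j k (∑ c ∈ Finset.Ico b a, mono K c (a + b - c)),
        Submodule.smul_mem _ _ (hS _ _ _ fun c hc => hin _ _ (by ring) ?_ ?_),
        neg_ne_zero.2 hq0, fun _ => rfl, ?_⟩
      · have := key c a (Finset.mem_Ico.1 hc).2
        exact min_lt_of_left_lt (by linarith)
      · have : b * n ≤ c * n := by nlinarith [(Finset.mem_Ico.1 hc).1]
        exact lt_max_of_lt_right (by linarith)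
      · rw [if_pos hjk, if_pos hlt, hLT, hins b (a + 1) (by omega), add_sub_cancel_right,
          Finset.Ico_eq_empty_of_le (show b ≤ a + 1 by omega), Finset.sum_empty, zero_sub,
          Finset.sum_insert (by simp), colored_neg, colored_add, colored_mono, colored_mono,
          show a + b - a = b by ring]
        module
  · subst hjk
    have hab : a ≠ b := fun h => hlm (by rw [h])
    rw [if_neg (lt_irrefl _), if_pos rfl, hGE]
    rcases lt_or_gt_of_ne hab with hab | hab
    · have h1 := key a b hab
      have hlt : ¬ j - a * n < j - b * n := by linarith
      refine ⟨-q ^ 2, -(q ^ 2 - 1) •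
          colored n j j (∑ c ∈ Finset.Ico a (b - 1), mono K (c + 1) (a + b - 1 - c)),
        Submodule.smul_mem _ _ (hS _ (fun c => c + 1) _ fun c hc => hin _ _ (by ring) ?_ ?_),
        neg_ne_zero.2 (pow_ne_zero 2 hq0), fun h => absurd rfl (hndvd h), ?_⟩
      · have := key (c + 1) b (by have := (Finset.mem_Ico.1 hc).2; omega)
        exact min_lt_of_right_lt (by linarith)
      · have := key a (c + 1) (by have := (Finset.mem_Ico.1 hc).1; omega)
        exact lt_max_of_lt_left (by linarith)
      · rw [if_neg hlt, Finset.Ico_eq_empty_of_le hab.le, Finset.sum_empty, sub_zero,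
          hins a b hab, Finset.sum_insert (by simp), colored_add, colored_mono, colored_mono,
          show a + b - 1 - (b - 1) = a by ring, sub_add_cancel]
        module
    · have h1 := key b a hab
      have hlt : j - a * n < j - b * n := by linarith
      refine ⟨-1, (q ^ 2 - 1) •
          colored n j j (∑ c ∈ Finset.Ico b (a - 1), mono K (c + 1) (a + b - 1 - c)),
        Submodule.smul_mem _ _ (hS _ (fun c => c + 1) _ fun c hc => hin _ _ (by ring) ?_ ?_),
        neg_ne_zero.2 one_ne_zero, fun h => absurd rfl (hndvd h), ?_⟩
      · have := key (c + 1) a (by have := (Finset.mem_Ico.1 hc).2; omega)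
        exact min_lt_of_left_lt (by linarith)
      · have := key b (c + 1) (by have := (Finset.mem_Ico.1 hc).1; omega)
        exact lt_max_of_lt_right (by linarith)
      · rw [if_pos hlt, Finset.Ico_eq_empty_of_le hab.le, Finset.sum_empty, zero_sub,
          hins b a hab, Finset.sum_insert (by simp), colored_neg, colored_add, colored_mono,
          colored_mono, show a + b - 1 - (a - 1) = b by ring, sub_add_cancel]
        module
  · refine ⟨-q, ?_⟩
    rw [if_neg (not_lt.2 hjk.le), if_neg hjk.ne', hGE]
    rcases le_or_gt a b with hab | hab
    · have h1 : a * n ≤ b * n := by nlinarith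
      have hlt : ¬ j - a * n < k - b * n := by linarith
      refine ⟨-(q ^ 2 - 1) •
          colored n j k (∑ c ∈ Finset.Ico a b, mono K (c + 1) (a + b - 1 - c)),
        Submodule.smul_mem _ _ (hS _ (fun c => c + 1) _ fun c hc => hin _ _ (by ring) ?_ ?_),
        neg_ne_zero.2 hq0, fun _ => rfl, ?_⟩
      · have := key c b (Finset.mem_Ico.1 hc).2
        exact min_lt_of_right_lt (by linarith)
      · have := key a (c + 1) (by have := (Finset.mem_Ico.1 hc).1; omega)
        exact lt_max_of_lt_left (by linarith)
      · rw [if_neg hlt, Finset.Ico_eq_empty_of_le hab, Finset.sum_empty, sub_zero, colored_mono]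
        module
    · have h1 := key b a hab
      have hlt : j - a * n < k - b * n := by linarith
      refine ⟨(q ^ 2 - 1) •
          colored n j k (∑ c ∈ Finset.Ico b (a - 1), mono K (c + 1) (a + b - 1 - c)),
        Submodule.smul_mem _ _ (hS _ (fun c => c + 1) _ fun c hc => hin _ _ (by ring) ?_ ?_),
        neg_ne_zero.2 hq0, fun _ => rfl, ?_⟩
      · have := key (c + 1) a (by have := (Finset.mem_Ico.1 hc).2; omega)
        exact min_lt_of_left_lt (by linarith)
      · have := key b (c + 1) (by have := (Finset.mem_Ico.1 hc).1; omega)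
        exact lt_max_of_lt_right (by linarith)
      · rw [if_pos hlt, Finset.Ico_eq_empty_of_le hab.le, Finset.sum_empty, zero_sub,
          hins b a hab, Finset.sum_insert (by simp), colored_neg, colored_add, colored_mono,
          colored_mono, show a + b - 1 - (a - 1) = b by ring, sub_add_cancel]
        module

theorem heckePair_self {n : ℕ} (q : K) (l : ℤ) :
    heckePair n q l l = -Finsupp.single (l, l) 1 := by
  have h : quotGE K (zdeg n l) (zdeg n l) = 0 := by simp [quotGE, divDiff]
  unfold heckePair
  simp only [lt_irrefl, if_false, if_true, h, colored_mono, color_sub_zdeg_mul]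
  simp [colored]

end PairRelations

/-! ### Consequences of the cross relations -/

section CrossRelations

variable {K A : Type*} [Field K] [Ring A] [Algebra K A]

/-- The second cross relation follows from the first, as `T` commutes with `z₁ z₂`. -/
theorem cross_right {c : K} {T z₁ z₂ z₂' : A} (hz : z₂' * z₂ = 1) (hc : z₁ * z₂ = z₂ * z₁)
    (h : T * z₁ = z₂ * T + c • z₁) (h' : T * (z₁ * z₂) = z₁ * z₂ * T) :
    T * z₂ = z₁ * T - c • z₁ := by
  -- since `z₂` is invertible, the relation may be checked after multiplication by `z₂`
  have e : z₂ * (T * z₂) = z₂ * (z₁ * T - c • z₁) := by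
    have e1 : T * (z₁ * z₂) = z₂ * (T * z₂) + c • (z₁ * z₂) := by
      rw [← mul_assoc, h, add_mul, smul_mul_assoc, mul_assoc]
    rw [mul_sub, mul_smul_comm, ← mul_assoc z₂ z₁ T, ← hc, ← h', e1, add_sub_cancel_right]
  have e2 := congrArg (fun x => z₂' * x) e
  simpa only [← mul_assoc, hz, one_mul] using e2

/-- The quadratic expression in `T` commutes with `z₁`, by the cross relations alone. -/
theorem quadratic_comm_left {c d : K} {T z₁ z₂ : A} (h₁ : T * z₁ = z₂ * T + c • z₁)
    (h₂ : T * z₂ = z₁ * T - c • z₁) :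
    (T * T - c • T - d • 1) * z₁ = z₁ * (T * T - c • T - d • 1) := by
  simp only [sub_mul, mul_sub, mul_add, mul_assoc, smul_mul_assoc, mul_smul_comm, h₁, one_mul,
    mul_one, smul_add]
  simp only [← mul_assoc, h₂, sub_mul, smul_mul_assoc]
  abel

theorem quadratic_comm_right {c d : K} {T z₁ z₂ : A} (h₁ : T * z₁ = z₂ * T + c • z₁)
    (h₂ : T * z₂ = z₁ * T - c • z₁) :
    (T * T - c • T - d • 1) * z₂ = z₂ * (T * T - c • T - d • 1) := by
  simp only [sub_mul, mul_sub, mul_assoc, smul_mul_assoc, mul_smul_comm, h₂, one_mul,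
    mul_one, smul_sub]
  simp only [← mul_assoc, h₁, add_mul, smul_mul_assoc, smul_add]
  abel

/-- The cross relations and the quadratic relations make the defect `T S T - S T S` of the braid
relation exchange `z₁` and `z₃`. -/
theorem braid_comm_left {c d : K} {T S z₁ z₂ z₃ : A}
    (h₁ : T * z₁ = z₂ * T + c • z₁) (h₂ : T * z₂ = z₁ * T - c • z₁)
    (h₃ : T * z₃ = z₃ * T) (k₁ : S * z₁ = z₁ * S) (k₂ : S * z₂ = z₃ * S + c • z₂)
    (hT : T * T = c • T + d • 1) (hS : S * S = c • S + d • 1) :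
    (T * S * T - S * T * S) * z₁ = z₃ * (T * S * T - S * T * S) := by
  have h₁' : ∀ x, T * (z₁ * x) = z₂ * (T * x) + c • (z₁ * x) := fun x => by
    rw [← mul_assoc, h₁, add_mul, smul_mul_assoc, mul_assoc]
  have h₂' : ∀ x, T * (z₂ * x) = z₁ * (T * x) - c • (z₁ * x) := fun x => by
    rw [← mul_assoc, h₂, sub_mul, smul_mul_assoc, mul_assoc]
  have h₃' : ∀ x, T * (z₃ * x) = z₃ * (T * x) := fun x => by
    rw [← mul_assoc, h₃, mul_assoc]
  have k₁' : ∀ x, S * (z₁ * x) = z₁ * (S * x) := fun x => by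
    rw [← mul_assoc, k₁, mul_assoc]
  have k₂' : ∀ x, S * (z₂ * x) = z₃ * (S * x) + c • (z₂ * x) := fun x => by
    rw [← mul_assoc, k₂, add_mul, smul_mul_assoc, mul_assoc]
  simp only [sub_mul, mul_sub, mul_add, mul_assoc, mul_smul_comm, h₁, h₁', h₂',
    h₃', k₁, k₁', k₂', mul_one, smul_add, smul_sub, hT, hS]
  abel

theorem braid_comm_right {c d : K} {T S z₁ z₂ z₃ : A}
    (h₂ : T * z₂ = z₁ * T - c • z₁)
    (h₃ : T * z₃ = z₃ * T) (k₁ : S * z₁ = z₁ * S)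
    (k₃ : S * z₃ = z₂ * S - c • z₂)
    (hT : T * T = c • T + d • 1) (hS : S * S = c • S + d • 1) :
    (T * S * T - S * T * S) * z₃ = z₁ * (T * S * T - S * T * S) := by
  have h₂' : ∀ x, T * (z₂ * x) = z₁ * (T * x) - c • (z₁ * x) := fun x => by
    rw [← mul_assoc, h₂, sub_mul, smul_mul_assoc, mul_assoc]
  have k₁' : ∀ x, S * (z₁ * x) = z₁ * (S * x) := fun x => by
    rw [← mul_assoc, k₁, mul_assoc]
  have k₃' : ∀ x, S * (z₃ * x) = z₂ * (S * x) - c • (z₂ * x) := fun x => by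
    rw [← mul_assoc, k₃, sub_mul, smul_mul_assoc, mul_assoc]
  simp only [sub_mul, mul_sub, mul_add, mul_assoc, mul_smul_comm, h₂', h₂,
    h₃, k₁, k₁', k₃, k₃', mul_one, smul_add, smul_sub, hT, hS]
  abel

/-- The defect of the braid relation commutes with `z₂`, since it exchanges `z₁` and `z₃` and
commutes with `z₁ + z₂ + z₃`. -/
theorem braid_comm_mid {c d : K} {T S z₁ z₂ z₃ : A}
    (h₁ : T * z₁ = z₂ * T + c • z₁) (h₂ : T * z₂ = z₁ * T - c • z₁)
    (h₃ : T * z₃ = z₃ * T) (k₁ : S * z₁ = z₁ * S) (k₂ : S * z₂ = z₃ * S + c • z₂)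
    (k₃ : S * z₃ = z₂ * S - c • z₂)
    (hT : T * T = c • T + d • 1) (hS : S * S = c • S + d • 1) :
    (T * S * T - S * T * S) * z₂ = z₂ * (T * S * T - S * T * S) := by
  have eT : T * (z₁ + z₂ + z₃) = (z₁ + z₂ + z₃) * T := by
    simp only [mul_add, add_mul, h₁, h₂, h₃]; abel
  have eS : S * (z₁ + z₂ + z₃) = (z₁ + z₂ + z₃) * S := by
    simp only [mul_add, add_mul, k₁, k₂, k₃]; abel
  have e : (T * S * T - S * T * S) * (z₁ + z₂ + z₃)
      = (z₁ + z₂ + z₃) * (T * S * T - S * T * S) := by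
    have cT : Commute T (z₁ + z₂ + z₃) := eT
    have cS : Commute S (z₁ + z₂ + z₃) := eS
    exact ((cT.mul_left cS).mul_left cT).sub_left ((cS.mul_left cT).mul_left cS)
  have e1 := braid_comm_left h₁ h₂ h₃ k₁ k₂ hT hS
  have e3 := braid_comm_right h₂ h₃ k₁ k₃ hT hS
  rw [mul_add, mul_add, add_mul, add_mul, e1, e3] at e
  have := congrArg (fun x => x - z₁ * (T * S * T - S * T * S) - z₃ * (T * S * T - S * T * S)) e
  beta_reduce at this
  convert this using 1 <;> abel

/-- `T` commutes with the power sums `z₁ ^ c + z₂ ^ c`, for negative `c` as well. -/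
theorem cross_power_sum {c : K} {T : A} {z₁ z₂ : Aˣ} (hc : Commute z₁ z₂)
    (h₁ : T * z₁ = z₂ * T + c • (z₁ : A)) (h₂ : T * z₂ = z₁ * T - c • (z₁ : A)) (e : ℤ) :
    Commute T (((z₁ ^ e : Aˣ) : A) + ((z₂ ^ e : Aˣ) : A)) := by
  have hcA : Commute (z₁ : A) (z₂ : A) := by
    have := congrArg (fun u : Aˣ => (u : A)) hc
    simpa [Commute, SemiconjBy] using this
  have hS : Commute T ((z₁ : A) + z₂) := by
    change T * _ = _ * T
    rw [mul_add, add_mul, h₁, h₂]; abel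
  have hP : Commute T ((z₁ * z₂ : Aˣ) : A) := by
    change T * _ = _ * T
    rw [Units.val_mul, ← mul_assoc, h₁, add_mul, mul_assoc, h₂, mul_sub, smul_mul_assoc,
      mul_smul_comm, hcA.eq, ← mul_assoc]
    abel
  have hP' : Commute T (((z₁ * z₂)⁻¹ : Aˣ) : A) := hP.units_inv_right
  -- the power sums obey a recursion with coefficients `z₁ + z₂` and `z₁ z₂`, in both directions
  let p : ℤ → A := fun e => ((z₁ ^ e : Aˣ) : A) + ((z₂ ^ e : Aˣ) : A)
  have h1 : ∀ e, p (e + 2) = (z₁ + z₂ : A) * p (e + 1) - ((z₁ * z₂ : Aˣ) : A) * p e := by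
    intro e
    have a1 : ((z₁ ^ (e + 2) : Aˣ) : A) = z₁ * ((z₁ ^ (e + 1) : Aˣ) : A) := by
      rw [← Units.val_mul, ← zpow_one_add]; congr 2; ring
    have a2 : ((z₂ ^ (e + 2) : Aˣ) : A) = z₂ * ((z₂ ^ (e + 1) : Aˣ) : A) := by
      rw [← Units.val_mul, ← zpow_one_add]; congr 2; ring
    have b1 : ((z₁ ^ (e + 1) : Aˣ) : A) = z₁ * ((z₁ ^ e : Aˣ) : A) := by
      rw [← Units.val_mul, ← zpow_one_add]; congr 2; ring
    have b2 : ((z₂ ^ (e + 1) : Aˣ) : A) = z₂ * ((z₂ ^ e : Aˣ) : A) := by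
      rw [← Units.val_mul, ← zpow_one_add]; congr 2; ring
    simp only [p, a1, a2, mul_add, add_mul, Units.val_mul]
    rw [b1, b2]
    have := hcA.eq
    simp only [← mul_assoc, this]
    abel
  have key : ∀ e, Commute T (p e) ∧ Commute T (p (e + 1)) := by
    intro e
    induction e using Int.induction_on with
    | zero =>
      simp only [p, zpow_zero, zero_add, zpow_one, Units.val_one]
      exact ⟨(Commute.one_right T).add_right (Commute.one_right T), hS⟩
    | succ i ih =>
      refine ⟨ih.2, ?_⟩
      rw [show (i : ℤ) + 1 + 1 = i + 2 by ring, h1]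
      exact (hS.mul_right ih.2).sub_right (hP.mul_right ih.1)
    | pred i ih =>
      rw [show -(i : ℤ) - 1 + 1 = -i by ring]
      refine ⟨?_, ih.1⟩
      have := h1 (-(i : ℤ) - 1)
      rw [show -(i : ℤ) - 1 + 2 = -i + 1 by ring, show -(i : ℤ) - 1 + 1 = -i by ring] at this
      have h3 : p (-(i : ℤ) - 1) = (((z₁ * z₂)⁻¹ : Aˣ) : A) *
          ((z₁ + z₂ : A) * p (-i) - p (-i + 1)) := by
        rw [this, sub_sub_cancel, ← mul_assoc, ← Units.val_mul, inv_mul_cancel, Units.val_one,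
          one_mul]
      rw [h3]
      exact hP'.mul_right ((hS.mul_right ih.1).sub_right ih.2)
  exact (key e).1

end CrossRelations

/-! ### The affine Hecke relations on the space of tensors -/

section TensorSpace

variable {K : Type*} [Field K] {m : ℤ}

/-- The operator `y_k ^ c`, as an element of the endomorphism ring. -/
abbrev yOp (K : Type*) [Field K] (n : ℕ) (m : ℤ) (k : ℕ) (c : ℤ) :
    Module.End K (TensorSpace K m) :=
  yPow K n m k c

/-- The Hecke generator `T_i`, as an element of the endomorphism ring. -/
abbrev heckeOp {K : Type*} [Field K] (n : ℕ) (q : K) (m : ℤ) (i : ℕ) :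
    Module.End K (TensorSpace K m) :=
  hecke n q m i

theorem TensorIndex.ext {s t : TensorIndex m} (h : ∀ k, s.1 k = t.1 k) : s = t :=
  Subtype.ext (funext h)

theorem TensorIndex.set_apply (s : TensorIndex m) (k : ℕ) (l : ℤ) (j : ℕ) :
    (s.set k l).1 j = if j = k then l else s.1 j := by
  exact Function.update_apply s.1 k l j

/-- Put a pair of labels into the positions `i, i + 1`. -/
def setPair (s : TensorIndex m) (i : ℕ) (p : ℤ × ℤ) : TensorIndex m :=
  (s.set i p.1).set (i + 1) p.2

theorem setPair_apply (s : TensorIndex m) (i : ℕ) (p : ℤ × ℤ) (j : ℕ) :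
    (setPair s i p).1 j = if j = i + 1 then p.2 else if j = i then p.1 else s.1 j := by
  rw [setPair, TensorIndex.set_apply, TensorIndex.set_apply]

theorem hecke_single (n : ℕ) (q : K) (i : ℕ) (s : TensorIndex m) :
    heckeOp n q m i (Finsupp.single s 1) =
      Finsupp.mapDomain (setPair s i) (heckePair n q (s.1 i) (s.1 (i + 1))) := by
  simp [heckeOp, hecke]
  rfl

theorem yPow_single (n : ℕ) (k : ℕ) (c : ℤ) (s : TensorIndex m) (r : K) :
    yOp K n m k c (Finsupp.single s r) = Finsupp.single (s.set k (s.1 k + c * n)) r := by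
  simp [yOp, yPow]

theorem yPow_eq_lmapDomain (n : ℕ) (k : ℕ) (c : ℤ) :
    yOp K n m k c = Finsupp.lmapDomain K K (fun s : TensorIndex m => s.set k (s.1 k + c * n)) := by
  refine Finsupp.lhom_ext fun s r => ?_
  rw [yPow_single]
  simp [Finsupp.lmapDomain_apply, Finsupp.mapDomain_single]

theorem yPow_mul_self (n : ℕ) (k : ℕ) (c d : ℤ) :
    yOp K n m k c * yOp K n m k d = yOp K n m k (c + d) := by
  refine Finsupp.lhom_ext fun s r => ?_
  rw [Module.End.mul_apply, yPow_single, yPow_single, yPow_single]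
  congr 1
  refine TensorIndex.ext fun j => ?_
  simp only [TensorIndex.set_apply, if_true]
  split_ifs
  · ring
  · rfl

theorem yPow_zero (n : ℕ) (k : ℕ) : yOp K n m k 0 = 1 := by
  refine Finsupp.lhom_ext fun s r => ?_
  rw [yPow_single, Module.End.one_apply]
  congr 1
  refine TensorIndex.ext fun j => ?_
  simp only [TensorIndex.set_apply]
  split_ifs with h <;> simp [h]

theorem yPow_comm (n : ℕ) (k l : ℕ) (c d : ℤ) :
    Commute (yOp K n m k c) (yOp K n m l d) := by
  rcases eq_or_ne k l with rfl | h
  · change _ * _ = _ * _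
    rw [yPow_mul_self, yPow_mul_self, add_comm]
  · refine Finsupp.lhom_ext fun s r => ?_
    rw [Module.End.mul_apply, Module.End.mul_apply, yPow_single, yPow_single, yPow_single,
      yPow_single]
    congr 1
    refine TensorIndex.ext fun j => ?_
    simp only [TensorIndex.set_apply, if_neg h, if_neg h.symm]
    split_ifs <;> simp_all

/-- The invertible operator `z_k = y_k⁻¹`. -/
def zUnit (K : Type*) [Field K] (n : ℕ) (m : ℤ) (k : ℕ) : (Module.End K (TensorSpace K m))ˣ where
  val := yOp K n m k (-1)
  inv := yOp K n m k 1
  val_inv := by rw [yPow_mul_self, neg_add_cancel, yPow_zero]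
  inv_val := by rw [yPow_mul_self, add_neg_cancel, yPow_zero]

theorem zUnit_zpow (n : ℕ) (k : ℕ) (c : ℤ) :
    ((zUnit K n m k ^ c : (Module.End K (TensorSpace K m))ˣ) : Module.End K (TensorSpace K m))
      = yOp K n m k (-c) := by
  induction c using Int.induction_on with
  | zero => simp [yPow_zero]
  | succ i ih =>
    rw [zpow_add_one, Units.val_mul, ih, neg_add, ← yPow_mul_self]
    rfl
  | pred i ih =>
    rw [zpow_sub_one, Units.val_mul, ih]
    change _ * yOp K n m k 1 = _
    rw [yPow_mul_self]
    congr 1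
    ring

theorem mapDomain_setPair_shift (n : ℕ) (c d : ℤ) (s : TensorIndex m) (i : ℕ)
    (g : (ℤ × ℤ) →₀ K) :
    (yOp K n m i c * yOp K n m (i + 1) d) (Finsupp.mapDomain (setPair s i) g) =
      Finsupp.mapDomain (setPair s i)
        (Finsupp.mapDomain (fun e : ℤ × ℤ => (e.1 + c * n, e.2 + d * n)) g) := by
  rw [Module.End.mul_apply, yPow_eq_lmapDomain, yPow_eq_lmapDomain]
  simp only [Finsupp.lmapDomain_apply, ← Finsupp.mapDomain_comp]
  congr 1
  funext p
  refine TensorIndex.ext fun j => ?_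
  simp only [Function.comp, TensorIndex.set_apply, setPair_apply]
  by_cases h1 : j = i + 1
  · simp [h1]
  · by_cases h2 : j = i <;> simp [h1, h2]

theorem setPair_congr {s t : TensorIndex m} {i : ℕ} (h : ∀ j, j ≠ i → j ≠ i + 1 → s.1 j = t.1 j) :
    setPair s i = setPair t i := by
  funext p
  refine TensorIndex.ext fun j => ?_
  simp only [setPair_apply]
  split_ifs with h1 h2
  · rfl
  · rfl
  · exact h j h2 h1

theorem setPair_self (s : TensorIndex m) (i : ℕ) : setPair s i (s.1 i, s.1 (i + 1)) = s := by
  refine TensorIndex.ext fun j => ?_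
  simp only [setPair_apply]
  split_ifs with h1 h2 <;> simp_all

theorem end_ext {X Y : Module.End K (TensorSpace K m)}
    (h : ∀ s : TensorIndex m, X (Finsupp.single s 1) = Y (Finsupp.single s 1)) : X = Y := by
  refine Finsupp.lhom_ext fun s r => ?_
  have hs : (Finsupp.single s r : TensorSpace K m) = r • Finsupp.single s 1 := by simp
  rw [hs, map_smul, map_smul, h]

variable {n : ℕ} {q : K}

/-- The cross relation `T_i z_i = z_{i+1} T_i + (q² - 1) z_i`. -/
theorem hecke_mul_zUnit_left (hn : 0 < n) (i : ℕ) :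
    heckeOp n q m i * zUnit K n m i =
      zUnit K n m (i + 1) * heckeOp n q m i + (q ^ 2 - 1) • (zUnit K n m i).1 := by
  refine end_ext fun s => ?_
  have e := mapDomain_setPair_shift (K := K) n 0 (-1) s i (heckePair n q (s.1 i) (s.1 (i + 1)))
  rw [yPow_zero, one_mul] at e
  have ex : Finsupp.single (s.set i (s.1 i + -1 * (n : ℤ))) (1 : K) =
      Finsupp.mapDomain (setPair s i) (Finsupp.single (s.1 i - (n : ℤ), s.1 (i + 1)) 1) := by
    rw [Finsupp.mapDomain_single]
    congr 1
    refine TensorIndex.ext fun j => ?_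
    simp only [setPair_apply, TensorIndex.set_apply]
    by_cases h1 : j = i + 1
    · simp [h1]
    · by_cases h2 : j = i
      · simp [h2]
        ring
      · simp [h1, h2]
  simp only [Module.End.mul_apply, LinearMap.add_apply, LinearMap.smul_apply, zUnit]
  rw [yPow_single, hecke_single, hecke_single, e, ex, ← Finsupp.mapDomain_smul,
    ← Finsupp.mapDomain_add]
  simp only [TensorIndex.set_apply, if_true, Nat.succ_ne_self, if_false]
  rw [setPair_congr (t := s) (fun j h _ => by simp [TensorIndex.set_apply, h]),
    show s.1 i + -1 * (n : ℤ) = s.1 i - n by ring, heckePair_sub_left hn]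
  congr 3
  funext p
  ext <;> simp [sub_eq_add_neg]

theorem hecke_mul_zUnit_both (hn : 0 < n) (i : ℕ) :
    heckeOp n q m i * (zUnit K n m i * zUnit K n m (i + 1)) =
      zUnit K n m i * zUnit K n m (i + 1) * heckeOp n q m i := by
  refine end_ext fun s => ?_
  have e := mapDomain_setPair_shift (K := K) n (-1) (-1) s i (heckePair n q (s.1 i) (s.1 (i + 1)))
  simp only [Module.End.mul_apply, zUnit] at e ⊢
  rw [yPow_single, yPow_single, hecke_single, hecke_single, e]
  simp only [TensorIndex.set_apply, if_true, Nat.succ_ne_self, if_false,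
    (Nat.succ_ne_self i).symm]
  rw [setPair_congr (t := s) (fun j h h' => by simp [TensorIndex.set_apply, h, h']),
    show s.1 i + -1 * (n : ℤ) = s.1 i - n by ring,
    show s.1 (i + 1) + -1 * (n : ℤ) = s.1 (i + 1) - n by ring, heckePair_sub_both hn]
  congr 2
  funext p
  ext <;> simp [sub_eq_add_neg]

theorem zUnit_comm (k l : ℕ) : Commute (zUnit K n m k) (zUnit K n m l) :=
  Units.ext (yPow_comm n k l (-1) (-1))

/-- The cross relation `T_i z_{i+1} = z_i T_i - (q² - 1) z_i`. -/
theorem hecke_mul_zUnit_right (hn : 0 < n) (i : ℕ) :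
    heckeOp n q m i * zUnit K n m (i + 1) =
      zUnit K n m i * heckeOp n q m i - (q ^ 2 - 1) • (zUnit K n m i).1 :=
  cross_right (K := K) (A := Module.End K (TensorSpace K m)) (zUnit K n m (i + 1)).inv_val
    (yPow_comm n i (i + 1) (-1) (-1)).eq
    (hecke_mul_zUnit_left hn i) (hecke_mul_zUnit_both hn i)

theorem hecke_comm_yPow (i k : ℕ) (h1 : k ≠ i) (h2 : k ≠ i + 1) (c : ℤ) :
    Commute (heckeOp n q m i) (yOp K n m k c) := by
  refine end_ext fun s => ?_
  simp only [Module.End.mul_apply]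
  rw [yPow_single, hecke_single, hecke_single, yPow_eq_lmapDomain, Finsupp.lmapDomain_apply,
    ← Finsupp.mapDomain_comp]
  simp only [TensorIndex.set_apply, if_neg h1.symm, if_neg h2.symm]
  congr 1
  funext p
  refine TensorIndex.ext fun j => ?_
  simp only [Function.comp, setPair_apply, TensorIndex.set_apply, if_neg h1, if_neg h2]
  split_ifs <;> simp_all

/-- `T_i` commutes with `y_i ^ c + y_{i+1} ^ c`. -/
theorem hecke_comm_yPow_add (hn : 0 < n) (i : ℕ) (c : ℤ) :
    Commute (heckeOp n q m i) (yOp K n m i c + yOp K n m (i + 1) c) := by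
  have := cross_power_sum (K := K) (A := Module.End K (TensorSpace K m)) (zUnit_comm i (i + 1))
    (hecke_mul_zUnit_left (q := q) hn i)
    (hecke_mul_zUnit_right (q := q) (m := m) hn i) (-c)
  simpa only [zUnit_zpow, neg_neg] using this

/-- Commutation with `z_k` extends to all powers of `z_k`. -/
theorem semiconj_yPow {X : Module.End K (TensorSpace K m)} {k l : ℕ}
    (h : X * zUnit K n m k = zUnit K n m l * X) (c : ℤ) :
    X * yOp K n m k c = yOp K n m l c * X := by
  have h' : SemiconjBy X (zUnit K n m k : Module.End K (TensorSpace K m)) (zUnit K n m l) := h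
  have := h'.units_zpow_right (-c)
  rw [SemiconjBy, zUnit_zpow, zUnit_zpow, neg_neg] at this
  exact this

/-- An operator which commutes, up to a permutation `k ↦ σ k` of the factors, with the operators
`z_k` vanishes on a pure tensor as soon as it vanishes on its translates of degree `0`. -/
theorem apply_single_eq_zero {X : Module.End K (TensorSpace K m)} (σ : ℕ → ℕ) (S : Finset ℕ)
    (hX : ∀ k ∈ S, X * zUnit K n m k = zUnit K n m (σ k) * X) (s : TensorIndex m)
    (h0 : ∀ t : TensorIndex m, (∀ k ∈ S, t.1 k = color n (s.1 k)) →
      (∀ k ∉ S, t.1 k = s.1 k) → X (Finsupp.single t 1) = 0) :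
    X (Finsupp.single s 1) = 0 := by
  classical
  induction S using Finset.induction_on generalizing s with
  | empty => exact h0 s (by simp) (by simp)
  | insert k S hk ih =>
    have e : (Finsupp.single s 1 : TensorSpace K m) = yOp K n m k (-zdeg n (s.1 k))
        (Finsupp.single (s.set k (color n (s.1 k))) 1) := by
      rw [yPow_single]
      congr 1
      refine TensorIndex.ext fun j => ?_
      simp only [TensorIndex.set_apply, if_true]
      split_ifs with h
      · rw [h, neg_mul, ← sub_eq_add_neg, color_sub_zdeg_mul]
      · rfl
    have e2 := congrArg (fun f => f (Finsupp.single (s.set k (color n (s.1 k))) (1 : K)))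
      (semiconj_yPow (hX k (Finset.mem_insert_self k S)) (-zdeg n (s.1 k)))
    simp only [Module.End.mul_apply] at e2
    rw [e, e2, ih (fun j hj => hX j (Finset.mem_insert_of_mem hj)), map_zero]
    intro t ht ht'
    refine h0 t (fun j hj => ?_) (fun j hj => ?_)
    · rcases Finset.mem_insert.1 hj with rfl | hj
      · rw [ht' j hk, TensorIndex.set_apply, if_pos rfl]
      · rw [ht j hj, TensorIndex.set_apply, if_neg (fun h : j = k => hk (h ▸ hj))]
    · rw [ht' j (fun h => hj (Finset.mem_insert_of_mem h)), TensorIndex.set_apply,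
        if_neg (fun h : j = k => hj (h ▸ Finset.mem_insert_self k S))]

/-- `T_i` on a pure tensor whose factors in the positions `i, i + 1` have degree `0` in `z`. -/
theorem hecke_single_of_mem (i : ℕ) (s : TensorIndex m) {x y : ℤ} (hx : s.1 i = x)
    (hy : s.1 (i + 1) = y) (h1 : 1 ≤ x ∧ x ≤ n) (h2 : 1 ≤ y ∧ y ≤ n) :
    heckeOp n q m i (Finsupp.single s 1) =
      if x < y then -q • Finsupp.single (setPair s i (y, x)) 1 + (q ^ 2 - 1) • Finsupp.single s 1
      else if x = y then -Finsupp.single s 1 else -q • Finsupp.single (setPair s i (y, x)) 1 := by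
  have hs := setPair_self s i
  subst hx hy
  rw [hecke_single, heckePair_of_mem q h1.1 h1.2 h2.1 h2.2]
  have hneg : ∀ x : (ℤ × ℤ) →₀ K, Finsupp.mapDomain (setPair s i) (-x) =
      -Finsupp.mapDomain (setPair s i) x :=
    fun x => (Finsupp.lmapDomain K K (setPair s i)).map_neg x
  split_ifs
  · rw [Finsupp.mapDomain_add, Finsupp.mapDomain_smul, Finsupp.mapDomain_smul,
      Finsupp.mapDomain_single, Finsupp.mapDomain_single, hs]
  · rw [hneg, Finsupp.mapDomain_single, hs]
  · rw [Finsupp.mapDomain_smul, Finsupp.mapDomain_single]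

theorem setPair_setPair (s : TensorIndex m) (i : ℕ) (p p' : ℤ × ℤ) :
    setPair (setPair s i p) i p' = setPair s i p' := by
  rw [setPair_congr (t := s) fun j h h' => by simp only [setPair_apply, if_neg h, if_neg h']]

/-- The quadratic relation `(T_i + 1) (T_i - q²) = 0`. Its left-hand side commutes with `z_i` and
`z_{i+1}`, so that it suffices to check factors of degree `0` in `z`. -/
theorem hecke_mul_self (hn : 0 < n) (i : ℕ) :
    heckeOp n q m i * heckeOp n q m i
      = (q ^ 2 - 1) • heckeOp n q m i + q ^ 2 • (1 : Module.End K (TensorSpace K m)) := by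
  have hl := hecke_mul_zUnit_left (q := q) (m := m) hn i
  have hr := hecke_mul_zUnit_right (q := q) (m := m) hn i
  suffices h : heckeOp n q m i * heckeOp n q m i - (q ^ 2 - 1) • heckeOp n q m i
      - q ^ 2 • (1 : Module.End K (TensorSpace K m)) = 0 from
    (sub_eq_iff_eq_add' (G := Module.End K (TensorSpace K m))).1
      ((sub_eq_zero (G := Module.End K (TensorSpace K m))).1 h)
  refine end_ext fun s => ?_
  refine apply_single_eq_zero (n := n) (fun k => k) {i, i + 1} ?_ s ?_
  · intro k hk
    rcases Finset.mem_insert.1 hk with rfl | hk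
    · exact quadratic_comm_left (K := K) (A := Module.End K (TensorSpace K m)) hl hr
    · rw [Finset.mem_singleton.1 hk]
      exact quadratic_comm_right (K := K) (A := Module.End K (TensorSpace K m)) hl hr
  · intro t ht _
    have h1 := color_mem n hn (s.1 i)
    have h2 := color_mem n hn (s.1 (i + 1))
    have e1 := ht i (by simp)
    have e2 := ht (i + 1) (by simp)
    simp only [LinearMap.sub_apply, LinearMap.smul_apply, Module.End.mul_apply,
      Module.End.one_apply]
    rw [hecke_single_of_mem i t e1 e2 h1 h2]
    generalize color n (s.1 i) = x at *
    generalize color n (s.1 (i + 1)) = y at *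
    have e3 := hecke_single_of_mem (q := q) (n := n) i (setPair t i (y, x)) (x := y) (y := x)
      (by simp [setPair_apply]) (by simp [setPair_apply]) h2 h1
    have e4 := hecke_single_of_mem (q := q) i t e1 e2 h1 h2
    have hself : setPair (setPair t i (y, x)) i (x, y) = t := by
      rw [setPair_setPair, ← e1, ← e2, setPair_self]
    rw [hself] at e3
    rcases lt_trichotomy x y with h | h | h
    · rw [if_neg (not_lt.2 h.le), if_neg h.ne'] at e3
      rw [if_pos h] at e4
      rw [if_pos h, map_add, map_smul, map_smul, e3, e4]
      module
    · rw [if_neg h.not_lt, if_pos h] at e4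
      rw [if_neg h.not_lt, if_pos h, map_neg, e4]
      module
    · rw [if_pos h] at e3
      rw [if_neg (not_lt.2 h.le), if_neg h.ne', map_smul, e3]
      module

/-- Generators acting in disjoint pairs of positions commute. -/
theorem hecke_comm (i j : ℕ) (h : i + 1 < j) : Commute (heckeOp n q m i) (heckeOp n q m j) := by
  refine end_ext fun s => ?_
  have key : ∀ (i j : ℕ), (i + 1 < j ∨ j + 1 < i) → ∀ (s : TensorIndex m) (g : (ℤ × ℤ) →₀ K),
      heckeOp n q m i (Finsupp.mapDomain (setPair s j) g) =
        g.sum fun p c => (heckePair n q (s.1 i) (s.1 (i + 1))).sum fun p' c' =>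
          Finsupp.single (setPair (setPair s j p) i p') (c * c') := by
    intro i j h s g
    induction g using Finsupp.induction_linear with
    | zero => simp
    | add f g hf hg =>
      rw [Finsupp.mapDomain_add, map_add, hf, hg, Finsupp.sum_add_index']
      · simp
      · intro p b₁ b₂
        simp only [add_mul, Finsupp.single_add]
        exact Finsupp.sum_add
    | single p c =>
      have hs : (Finsupp.single (setPair s j p) c : TensorSpace K m) =
          c • Finsupp.single (setPair s j p) 1 := by simp
      rw [Finsupp.mapDomain_single, hs, map_smul, hecke_single, Finsupp.sum_single_index (by simp),
        setPair_apply, setPair_apply, if_neg (by omega), if_neg (by omega), if_neg (by omega),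
        if_neg (by omega), Finsupp.mapDomain, Finsupp.smul_sum]
      simp
  simp only [Module.End.mul_apply]
  rw [hecke_single, hecke_single, key i j (Or.inl h), key j i (Or.inr h), Finsupp.sum_comm]
  refine Finsupp.sum_congr fun p _ => Finsupp.sum_congr fun p' _ => ?_
  rw [mul_comm]
  congr 1
  refine TensorIndex.ext fun k => ?_
  simp only [setPair_apply]
  split_ifs <;> first | rfl | omega

/-- The braid relation. The difference of its sides exchanges `z_i` and `z_{i+2}` and commutes with
`z_{i+1}`, so that it suffices to check factors of degree `0` in `z`. -/
theorem hecke_braid (hn : 0 < n) (i : ℕ) :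
    heckeOp n q m i * heckeOp n q m (i + 1) * heckeOp n q m i =
      heckeOp n q m (i + 1) * heckeOp n q m i * heckeOp n q m (i + 1) := by
  rw [← sub_eq_zero]
  have h₁ := hecke_mul_zUnit_left (q := q) (m := m) hn i
  have h₂ := hecke_mul_zUnit_right (q := q) (m := m) hn i
  have h₃ : heckeOp n q m i * zUnit K n m (i + 2) = zUnit K n m (i + 2) * heckeOp n q m i :=
    (hecke_comm_yPow i (i + 2) (by omega) (by omega) (-1)).eq
  have k₁ : heckeOp n q m (i + 1) * zUnit K n m i = zUnit K n m i * heckeOp n q m (i + 1) :=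
    (hecke_comm_yPow (i + 1) i (by omega) (by omega) (-1)).eq
  have k₂ := hecke_mul_zUnit_left (q := q) (m := m) hn (i + 1)
  have k₃ := hecke_mul_zUnit_right (q := q) (m := m) hn (i + 1)
  have hT := hecke_mul_self (q := q) (m := m) hn i
  have hS := hecke_mul_self (q := q) (m := m) hn (i + 1)
  refine end_ext fun s => ?_
  refine apply_single_eq_zero (n := n)
    (fun k => if k = i then i + 2 else if k = i + 2 then i else k) {i, i + 1, i + 2} ?_ s ?_
  · intro k hk
    simp only [Finset.mem_insert, Finset.mem_singleton] at hk
    rcases hk with rfl | rfl | rfl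
    · rw [if_pos rfl]
      exact braid_comm_left (K := K) (A := Module.End K (TensorSpace K m)) h₁ h₂ h₃ k₁ k₂ hT hS
    · rw [if_neg (by omega), if_neg (by omega)]
      exact braid_comm_mid (K := K) (A := Module.End K (TensorSpace K m)) h₁ h₂ h₃ k₁ k₂ k₃ hT hS
    · rw [if_neg (by omega), if_pos rfl]
      exact braid_comm_right (K := K) (A := Module.End K (TensorSpace K m)) h₂ h₃ k₁ k₃ hT hS
  · intro t ht _
    have b1 := color_mem n hn (s.1 i)
    have b2 := color_mem n hn (s.1 (i + 1))
    have b3 := color_mem n hn (s.1 (i + 2))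
    have e1 := ht i (by simp)
    have e2 := ht (i + 1) (by simp)
    have e3 := ht (i + 2) (by simp)
    generalize color n (s.1 i) = x at *
    generalize color n (s.1 (i + 1)) = y at *
    generalize color n (s.1 (i + 2)) = z at *
    -- `w a b c` has the labels `a, b, c` in the positions `i, i + 1, i + 2`
    let w : ℤ → ℤ → ℤ → TensorIndex m := fun a b c => (setPair t i (a, b)).set (i + 2) c
    have wt : t = w x y z := by
      refine TensorIndex.ext fun j => ?_
      simp only [w, TensorIndex.set_apply, setPair_apply]
      split_ifs <;> simp_all
    have r1 : ∀ a b c : ℤ, (1 ≤ a ∧ a ≤ n) → (1 ≤ b ∧ b ≤ n) →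
        heckeOp n q m i (Finsupp.single (w a b c) 1) =
          if a < b then -q • Finsupp.single (w b a c) 1 + (q ^ 2 - 1) • Finsupp.single (w a b c) 1
          else if a = b then -Finsupp.single (w a b c) 1
          else -q • Finsupp.single (w b a c) 1 := by
      intro a b c ha hb
      have hw : setPair (w a b c) i (b, a) = w b a c := by
        refine TensorIndex.ext fun j => ?_
        simp only [w, TensorIndex.set_apply, setPair_apply]
        split_ifs <;> first | rfl | omega
      rw [hecke_single_of_mem i (w a b c) (x := a) (y := b) (by simp [w, TensorIndex.set_apply,
        setPair_apply]) (by simp [w, TensorIndex.set_apply, setPair_apply]) ha hb, hw]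
    have r2 : ∀ a b c : ℤ, (1 ≤ b ∧ b ≤ n) → (1 ≤ c ∧ c ≤ n) →
        heckeOp n q m (i + 1) (Finsupp.single (w a b c) 1) =
          if b < c then -q • Finsupp.single (w a c b) 1 + (q ^ 2 - 1) • Finsupp.single (w a b c) 1
          else if b = c then -Finsupp.single (w a b c) 1
          else -q • Finsupp.single (w a c b) 1 := by
      intro a b c hb hc
      have hw : setPair (w a b c) (i + 1) (c, b) = w a c b := by
        refine TensorIndex.ext fun j => ?_
        simp only [w, TensorIndex.set_apply, setPair_apply]
        split_ifs <;> rfl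
      rw [hecke_single_of_mem (i + 1) (w a b c) (x := b) (y := c) 
        (by simp [w, TensorIndex.set_apply, setPair_apply])
        (by simp [w, TensorIndex.set_apply]) hb hc, hw]
    rw [wt, LinearMap.sub_apply]
    simp only [Module.End.mul_apply]
    clear_value w
    clear h₁ h₂ h₃ k₁ k₂ k₃ hT hS ht e1 e2 e3 wt
    -- the thirteen relative orders of three labels in `1, …, n`
    rcases lt_trichotomy x y with h | h | h <;> rcases lt_trichotomy y z with h' | h' | h' <;>
      rcases lt_trichotomy x z with h'' | h'' | h'' <;> try omega
    all_goals
      try subst h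
      try subst h'
      try subst h''
      try have n1 := not_lt_of_gt h
      try have n2 := not_lt_of_gt h'
      try have n3 := not_lt_of_gt h''
      try have m1 := ne_of_gt h
      try have m2 := ne_of_gt h'
      try have m3 := ne_of_gt h''
      simp only [and_self, map_add, map_smul, map_neg, lt_irrefl, if_true, if_false, *]
      try module

end TensorSpace

/-! ### The symmetrizer of the Hecke algebra -/

section Symmetrizer

/-- The sum `1 + T_{k-1} + T_{k-1} T_{k-2} + ⋯ + T_{k-1} ⋯ T_0` over the minimal coset
representatives. -/
def cosetSum {A : Type*} [Ring A] (T : ℕ → A) : ℕ → A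
  | 0 => 1
  | k + 1 => 1 + T k * cosetSum T k

/-- The sum of all `T_w`, where `w` runs over the permutations of the positions `0, …, N`. -/
def symmetrizer {A : Type*} [Ring A] (T : ℕ → A) : ℕ → A
  | 0 => 1
  | N + 1 => symmetrizer T N * cosetSum T (N + 1)

variable {K A : Type*} [Field K] [Ring A] [Algebra K A] {T : ℕ → A} {d : K}

theorem comm_cosetSum (hC : ∀ i j, i + 1 < j → Commute (T i) (T j)) {k N : ℕ} (h : k < N) :
    Commute (cosetSum T k) (T N) := by
  induction k with
  | zero => exact Commute.one_left _
  | succ k ih =>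
    exact (Commute.one_left _).add_left ((hC k N h).mul_left (ih (by omega)))

/-- If `L` absorbs `T_0, …, T_{N-2}`, then `L` times the coset sum also absorbs `T_{N-1}`: this is
the passage from the symmetrizer of `N` positions to that of `N + 1` positions. -/
theorem mul_cosetSum_mul (hQ : ∀ i, T i * T i = (d - 1) • T i + d • 1)
    (hB : ∀ i, T i * T (i + 1) * T i = T (i + 1) * T i * T (i + 1))
    (hC : ∀ i j, i + 1 < j → Commute (T i) (T j)) (N : ℕ) (L : A)
    (hL : ∀ j, j + 1 < N → L * T j = d • L) (i : ℕ) (hi : i < N) :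
    L * cosetSum T N * T i = d • (L * cosetSum T N) := by
  induction N generalizing L with
  | zero => omega
  | succ N ih =>
    rcases Nat.lt_succ_iff_lt_or_eq.1 hi with hi' | rfl
    · have h1 := ih (L * T N) (fun j hj => by
        rw [mul_assoc, ← (hC j N hj).eq, ← mul_assoc, hL j (by omega), smul_mul_assoc]) hi'
      rw [cosetSum, mul_add, mul_one, add_mul, hL i (by omega), ← mul_assoc, h1, smul_add]
    · cases i with
      | zero =>
        simp only [cosetSum, mul_one, mul_add, add_mul, mul_assoc, hQ]
        simp only [mul_smul_comm, mul_one]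
        module
      | succ i =>
        -- here the braid relation turns the right factor `T_{i+1}` into the left factor `T_i`
        have hcomm := (comm_cosetSum hC (Nat.lt_succ_self i)).eq
        have h1 : L * (T (i + 1) * (T i * cosetSum T i)) * T (i + 1)
            = d • (L * (T (i + 1) * (T i * cosetSum T i))) := by
          calc L * (T (i + 1) * (T i * cosetSum T i)) * T (i + 1)
              = L * (T (i + 1) * T i * T (i + 1)) * cosetSum T i := by
                simp only [mul_assoc, hcomm]
            _ = (L * T i) * (T (i + 1) * (T i * cosetSum T i)) := by
                rw [← hB]; simp only [mul_assoc]
            _ = _ := by rw [hL i (by omega), smul_mul_assoc]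
        have h2 : L * cosetSum T (i + 2) = L + L * T (i + 1) +
            L * (T (i + 1) * (T i * cosetSum T i)) := by
          simp only [cosetSum, mul_add, mul_one, add_assoc]
        rw [h2, add_mul, add_mul, h1, mul_assoc L, hQ]
        simp only [mul_add, mul_smul_comm, mul_one]
        module

/-- The symmetrizer absorbs each `T_i`. -/
theorem symmetrizer_mul (hQ : ∀ i, T i * T i = (d - 1) • T i + d • 1)
    (hB : ∀ i, T i * T (i + 1) * T i = T (i + 1) * T i * T (i + 1))
    (hC : ∀ i j, i + 1 < j → Commute (T i) (T j)) (N i : ℕ) (hi : i < N) :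
    symmetrizer T N * T i = d • symmetrizer T N := by
  induction N generalizing i with
  | zero => omega
  | succ N ih =>
    exact mul_cosetSum_mul hQ hB hC (N + 1) _ (fun j hj => ih j (by omega)) i hi

end Symmetrizer

/-! ### The ground states do not vanish -/

section Vacuum

variable {K : Type*} [Field K] {m : ℤ} {n : ℕ} {q : K}

/-- All entries of `T` applied to a pair lie between the labels of the pair. -/
theorem heckePair_mem_supported (hn : 0 < n) (hq0 : q ≠ 0) (l l' : ℤ) :
    heckePair n q l l' ∈ Finsupp.supported K K
      {p : ℤ × ℤ | (min l l' ≤ p.1 ∧ p.1 ≤ max l l') ∧ min l l' ≤ p.2 ∧ p.2 ≤ max l l'} := by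
  rcases eq_or_ne l l' with rfl | h
  · rw [heckePair_self]
    exact Submodule.neg_mem _ (Finsupp.single_mem_supported K 1 (by simp))
  · obtain ⟨α, r, hr, -, -, e⟩ := heckePair_expand hn hq0 h
    rw [e]
    refine Submodule.add_mem _ (Submodule.add_mem _
      (Submodule.smul_mem _ _ (Finsupp.single_mem_supported K 1 (by simp)))
      (Submodule.smul_mem _ _ (Finsupp.single_mem_supported K 1 (by simp)))) ?_
    refine Finsupp.supported_mono ?_ hr
    rintro ⟨x, y⟩ ⟨-, -, h3, h4, h5⟩
    simp only [Set.mem_ofPred_eq] at *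
    omega

theorem mapDomain_mem_supported {ι κ : Type*} {f : ι → κ} {P : Set ι} {Q : Set κ}
    (h : ∀ i ∈ P, f i ∈ Q) {g : ι →₀ K} (hg : g ∈ Finsupp.supported K K P) :
    Finsupp.mapDomain f g ∈ Finsupp.supported K K Q := by
  classical
  rw [Finsupp.mem_supported] at *
  intro k hk
  obtain ⟨i, hi, rfl⟩ := Finset.mem_image.1 (Finsupp.mapDomain_support hk)
  exact h i (hg hi)

/-- A set of pure tensors which is closed under replacing the pair in the positions `i, i + 1` by
pairs with entries in between spans a subspace which `T_i` maps into itself. -/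
theorem hecke_mem_supported (hn : 0 < n) (hq0 : q ≠ 0) (i : ℕ) {P Q : Set (TensorIndex m)}
    (h : ∀ s ∈ P, ∀ x y, min (s.1 i) (s.1 (i + 1)) ≤ x → x ≤ max (s.1 i) (s.1 (i + 1)) →
      min (s.1 i) (s.1 (i + 1)) ≤ y → y ≤ max (s.1 i) (s.1 (i + 1)) → setPair s i (x, y) ∈ Q)
    {w : TensorSpace K m} (hw : w ∈ Finsupp.supported K K P) :
    heckeOp n q m i w ∈ Finsupp.supported K K Q := by
  have e : w = ∑ s ∈ w.support, w s • Finsupp.single s 1 := by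
    conv_lhs => rw [← Finsupp.sum_single w]
    simp [Finsupp.sum]
  rw [e, map_sum]
  refine Submodule.sum_mem _ fun s hs => ?_
  rw [map_smul, hecke_single]
  refine Submodule.smul_mem _ _ (mapDomain_mem_supported (fun p hp => ?_)
    (heckePair_mem_supported hn hq0 _ _))
  exact h s (hw hs) p.1 p.2 hp.1.1 hp.1.2 hp.2.1 hp.2.2

/-- The coset sum moves the largest factor from position `0` to position `k`; all its other terms
have a smaller factor in position `k`. -/
theorem cosetSum_single (hn : 0 < n) (hq0 : q ≠ 0) (k : ℕ) (s : TensorIndex m)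
    (hs : ∀ j, 1 ≤ j → j ≤ k → s.1 j < s.1 0) :
    ∃ α : K, ∃ c : TensorIndex m, ∃ y ∈ Finsupp.supported K K
        {t : TensorIndex m | t.1 k < s.1 0 ∧ ∀ l, k < l → t.1 l = s.1 l},
      α ≠ 0 ∧ (∀ j, j < k → c.1 j = s.1 (j + 1)) ∧ c.1 k = s.1 0 ∧ (∀ l, k < l → c.1 l = s.1 l) ∧
      cosetSum (heckeOp n q m) k (Finsupp.single s 1) = α • Finsupp.single c 1 + y := by
  induction k with
  | zero =>
    exact ⟨1, s, 0, Submodule.zero_mem _, one_ne_zero, by simp, rfl, fun _ _ => rfl,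
      by simp [cosetSum]⟩
  | succ k ih =>
    obtain ⟨α, c, y, hy, hα, h1, h2, h3, e⟩ := ih fun j hj hj' => hs j hj (by omega)
    have hk := hs (k + 1) (by omega) le_rfl
    have hck := h3 (k + 1) (by omega)
    have hlt : c.1 (k + 1) < c.1 k := by rw [hck, h2]; exact hk
    obtain ⟨α', r, hr, hα', -, e'⟩ := heckePair_expand hn hq0 hlt.ne'
    rw [if_neg (not_lt.2 hlt.le), zero_smul, add_zero] at e'
    refine ⟨α * α', setPair c k (c.1 (k + 1), c.1 k), Finsupp.single s 1 +
      (α • Finsupp.mapDomain (setPair c k) r + heckeOp n q m k y), ?_, mul_ne_zero hα hα', ?_, ?_,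
      ?_, ?_⟩
    · refine Submodule.add_mem _ (Finsupp.single_mem_supported K 1 ⟨hk, fun _ _ => rfl⟩)
        (Submodule.add_mem _ (Submodule.smul_mem _ _ (mapDomain_mem_supported ?_ hr)) ?_)
      · rintro ⟨a, b⟩ ⟨-, -, p3, p4, p5⟩
        simp only at p3 p4 p5
        refine ⟨?_, fun l hl => ?_⟩
        · rw [setPair_apply, if_pos rfl]
          omega
        · rw [setPair_apply, if_neg (by omega), if_neg (by omega), h3 l (by omega)]
      · refine hecke_mem_supported hn hq0 k ?_ hy
        rintro t ⟨t1, t2⟩ a b - - - hb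
        have t3 := t2 (k + 1) (by omega)
        refine ⟨?_, fun l hl => ?_⟩
        · rw [setPair_apply, if_pos rfl]
          refine lt_of_le_of_lt hb (max_lt t1 ?_)
          rw [t3]
          exact hk
        · rw [setPair_apply, if_neg (by omega), if_neg (by omega), t2 l (by omega)]
    · intro j hj
      rw [setPair_apply, if_neg (by omega)]
      split_ifs with h
      · rw [h]; exact hck
      · exact h1 j (by omega)
    · rw [setPair_apply, if_pos rfl, h2]
    · intro l hl
      rw [setPair_apply, if_neg (by omega), if_neg (by omega), h3 l (by omega)]
    · rw [cosetSum, LinearMap.add_apply, Module.End.one_apply, Module.End.mul_apply, e, map_add,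
        map_smul, hecke_single, e', Finsupp.mapDomain_add, Finsupp.mapDomain_smul,
        Finsupp.mapDomain_single]
      module

/-- The symmetrizer of the positions `0, …, N` does not affect the position `k > N`. -/
theorem symmetrizer_mem_supported (hn : 0 < n) (hq0 : q ≠ 0) (N k : ℕ) (hk : N < k) (b : ℤ)
    {w : TensorSpace K m} (hw : w ∈ Finsupp.supported K K {t : TensorIndex m | t.1 k < b}) :
    symmetrizer (heckeOp n q m) N w ∈ Finsupp.supported K K {t : TensorIndex m | t.1 k < b} := by
  have hT : ∀ i, i + 1 < k → ∀ w ∈ Finsupp.supported K K {t : TensorIndex m | t.1 k < b},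
      heckeOp n q m i w ∈ Finsupp.supported K K {t : TensorIndex m | t.1 k < b} := by
    intro i hi w hw
    refine hecke_mem_supported hn hq0 i ?_ hw
    intro s hs x y _ _ _ _
    change (setPair s i (x, y)).1 k < b
    rw [setPair_apply, if_neg (by omega), if_neg (by omega)]
    exact hs
  have hC : ∀ j, j < k → ∀ w ∈ Finsupp.supported K K {t : TensorIndex m | t.1 k < b},
      cosetSum (heckeOp n q m) j w ∈ Finsupp.supported K K {t : TensorIndex m | t.1 k < b} := by
    intro j
    induction j with
    | zero => exact fun _ w hw => hw
    | succ j ih =>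
      exact fun hj w hw => Submodule.add_mem _ hw (hT j hj _ (ih (by omega) w hw))
  induction N generalizing w with
  | zero => exact hw
  | succ N ih => exact ih (by omega) (hC (N + 1) hk w hw)

/-- The symmetrizer does not annihilate a pure tensor with decreasing labels: the coefficient of the
reversed tensor is nonzero. -/
theorem symmetrizer_single_ne_zero (hn : 0 < n) (hq0 : q ≠ 0) (N : ℕ) (s : TensorIndex m)
    (hs : ∀ i j, i < j → j ≤ N → s.1 j < s.1 i) :
    ∃ t : TensorIndex m, (∀ l, N < l → t.1 l = s.1 l) ∧
      symmetrizer (heckeOp n q m) N (Finsupp.single s 1) t ≠ 0 := by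
  induction N generalizing s with
  | zero => exact ⟨s, fun _ _ => rfl, by simp [symmetrizer]⟩
  | succ N ih =>
    -- only the term `c` of the coset sum has the largest label in position `N + 1`
    obtain ⟨α, c, y, hy, hα, h1, h2, h3, e⟩ :=
      cosetSum_single (m := m) hn hq0 (N + 1) s fun j hj hj' => hs 0 j (by omega) hj'
    obtain ⟨t, ht, ht'⟩ := ih c fun i j hij hj => by
      rw [h1 i (by omega), h1 j (by omega)]
      exact hs _ _ (by omega) (by omega)
    refine ⟨t, fun l hl => ?_, ?_⟩
    · rw [ht l (by omega), h3 l hl]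
    · have hy' := symmetrizer_mem_supported hn hq0 N (N + 1) (Nat.lt_succ_self N) (s.1 0)
        (Finsupp.supported_mono (fun t ht => ht.1) hy)
      have hyt : symmetrizer (heckeOp n q m) N y t = 0 := by
        by_contra hne
        have h5 : t.1 (N + 1) < s.1 0 := hy' (Finsupp.mem_support_iff.2 hne)
        rw [ht (N + 1) (by omega), h2] at h5
        exact lt_irrefl _ h5
      rw [symmetrizer, Module.End.mul_apply, e, map_add, map_smul, Finsupp.add_apply,
        Finsupp.smul_apply, hyt, add_zero]
      exact smul_ne_zero hα ht'

/-- The index of the ground state `u_m ⊗ u_{m-1} ⊗ ⋯`. -/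
def ground (m : ℤ) : TensorIndex m := ⟨fun k => m - k, Filter.Eventually.of_forall fun _ => rfl⟩

/-- The ground state has a nonzero class: the symmetrizers annihilate the kernels of the `T_i + 1`,
as `T_i` acts on the right by `q² ≠ -1`, but they do not annihilate the ground state. -/
theorem ground_not_mem (hn : 0 < n) (hq0 : q ≠ 0) (hq : 1 + q ^ 2 ≠ 0) :
    (Finsupp.single (ground m) 1 : TensorSpace K m) ∉ wedgeRelations n q m := by
  intro h
  rw [wedgeRelations, Submodule.mem_iSup_iff_exists_finset] at h
  obtain ⟨F, hF⟩ := h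
  -- finitely many kernels are annihilated by one symmetrizer
  let N := F.sup id + 1
  have hle : (⨆ i ∈ F, LinearMap.ker (hecke n q m i + 1)) ≤
      LinearMap.ker (symmetrizer (heckeOp n q m) N) := by
    refine iSup₂_le fun i hi w hw => ?_
    have hiN : i < N := Nat.lt_succ_of_le (Finset.le_sup (f := id) hi)
    have hTw : heckeOp n q m i w = -w := eq_neg_of_add_eq_zero_left hw
    have e := congrArg (fun f => f w)
      (symmetrizer_mul (K := K) (A := Module.End K (TensorSpace K m)) (T := heckeOp n q m)
        (d := q ^ 2) (hecke_mul_self hn) (hecke_braid hn) hecke_comm N i hiN)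
    simp only [Module.End.mul_apply, LinearMap.smul_apply, hTw, map_neg] at e
    have e2 : (1 + q ^ 2) • symmetrizer (heckeOp n q m) N w = 0 := by
      rw [add_smul, ← e, one_smul, add_neg_cancel]
    exact (smul_eq_zero.1 e2).resolve_left hq
  obtain ⟨t, -, ht⟩ := symmetrizer_single_ne_zero (q := q) hn hq0 N (ground m)
    fun i j hij _ => by
      change m - (j : ℤ) < m - (i : ℤ)
      have : (i : ℤ) < j := by exact_mod_cast hij
      linarith
  have h0 : symmetrizer (heckeOp n q m) N (Finsupp.single (ground m) 1) = 0 := hle hF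
  rw [h0] at ht
  exact ht rfl

end Vacuum

/-! ### Straightening of products -/

section Straightening

variable {K A : Type*} [Field K] [Ring A] [Algebra K A]

/-- The elements `ψ l` of an algebra satisfy the relations of the factors `u_l` of a `q`-wedge
product: the image of `T - q²`, which by the quadratic relation lies in `Ker (T + 1)`, vanishes. -/
def WedgeRelated (n : ℕ) (q : K) (ψ : ℤ → A) : Prop :=
  ∀ l m : ℤ, ((heckePair n q l m).sum fun p c => c • (ψ p.1 * ψ p.2)) = q ^ 2 • (ψ l * ψ m)

/-- The product `ψ l₁ ψ l₂ ⋯` along the word `l₁, l₂, …`. -/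
def wordProd (ψ : ℤ → A) (W : List ℤ) : A := (W.map ψ).prod

theorem wordProd_nil (ψ : ℤ → A) : wordProd ψ [] = 1 := rfl

theorem wordProd_cons (ψ : ℤ → A) (l : ℤ) (W : List ℤ) :
    wordProd ψ (l :: W) = ψ l * wordProd ψ W := by
  simp [wordProd]

theorem wordProd_append (ψ : ℤ → A) (W W' : List ℤ) :
    wordProd ψ (W ++ W') = wordProd ψ W * wordProd ψ W' := by
  simp [wordProd]

variable {n : ℕ} {q : K} {ψ : ℤ → A}

theorem WedgeRelated.mul_self (h : WedgeRelated n q ψ) (hq : 1 + q ^ 2 ≠ 0) (l : ℤ) :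
    ψ l * ψ l = 0 := by
  have e := h l l
  rw [heckePair_self, ← Finsupp.single_neg, Finsupp.sum_single_index (by simp)] at e
  have e2 : (1 + q ^ 2) • (ψ l * ψ l) = 0 := by
    rw [add_smul, ← e]
    simp
  exact (smul_eq_zero.1 e2).resolve_left hq

/-- The relation of a pair of distinct labels, with the inner pairs collected in one sum. -/
theorem WedgeRelated.expand (h : WedgeRelated n q ψ) (hn : 0 < n) (hq0 : q ≠ 0) {l m : ℤ}
    (hlm : l ≠ m) :
    ∃ α : K, ∃ r ∈ Finsupp.supported K K (innerPairs n l m), α ≠ 0 ∧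
      (¬ (n : ℤ) ∣ l - m → α = -q) ∧
      α • (ψ m * ψ l) = (if l < m then 1 else q ^ 2) • (ψ l * ψ m)
        - r.sum fun p c => c • (ψ p.1 * ψ p.2) := by
  obtain ⟨α, r, hr, hα, hα', e⟩ := heckePair_expand hn hq0 hlm
  refine ⟨α, r, hr, hα, hα', ?_⟩
  have e1 := h l m
  have hadd : ∀ f g : (ℤ × ℤ) →₀ K, ((f + g).sum fun p c => c • (ψ p.1 * ψ p.2)) =
      (f.sum fun p c => c • (ψ p.1 * ψ p.2)) + g.sum fun p c => c • (ψ p.1 * ψ p.2) :=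
    fun f g => Finsupp.sum_add_index' (by simp) (fun _ _ _ => add_smul _ _ _)
  rw [e, hadd, hadd, Finsupp.smul_single, Finsupp.smul_single,
    Finsupp.sum_single_index (by simp), Finsupp.sum_single_index (by simp)] at e1
  simp only [smul_eq_mul, mul_one] at e1
  rw [eq_sub_iff_add_eq]
  split_ifs at e1 ⊢
  · rw [add_right_comm, ← eq_sub_iff_add_eq, ← sub_smul] at e1
    rw [e1]
    congr 1
    ring
  · rw [zero_smul, add_zero] at e1
    exact e1

/-- The pairs that occur when `ψ l ψ m`, `l < m`, is rewritten with decreasing labels. -/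
def straightPairs (n : ℕ) (l m : ℤ) : Set (ℤ × ℤ) :=
  {p | p.2 < p.1 ∧ p.1 + p.2 = l + m ∧ l ≤ p.2 ∧ p.1 ≤ m ∧
    (((n : ℤ) ∣ p.1 - l ∧ (n : ℤ) ∣ p.2 - m) ∨ ((n : ℤ) ∣ p.1 - m ∧ (n : ℤ) ∣ p.2 - l))}

/-- The straightening of two factors, by induction on the distance of the labels: the inner pairs
are closer to each other. -/
theorem WedgeRelated.mul_mem_span (h : WedgeRelated n q ψ) (hn : 0 < n) (hq0 : q ≠ 0)
    (hq : 1 + q ^ 2 ≠ 0) {l m : ℤ} (hlm : l < m) :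
    ψ l * ψ m ∈ Submodule.span K ((fun p : ℤ × ℤ => ψ p.1 * ψ p.2) '' straightPairs n l m) := by
  induction hd : (m - l).toNat using Nat.strong_induction_on generalizing l m with
  | _ d ih =>
  obtain ⟨α, r, hr, hα, -, e⟩ := h.expand hn hq0 hlm.ne'
  -- the relation is that of the decreasing pair `(m, l)`, solved for the flipped product
  have e1 : ψ l * ψ m = α⁻¹ • (α • (ψ l * ψ m)) := by rw [smul_smul, inv_mul_cancel₀ hα, one_smul]
  rw [e1, e]
  refine Submodule.smul_mem _ _ (Submodule.sub_mem _ (Submodule.smul_mem _ _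
    (Submodule.subset_span ⟨(m, l), ⟨hlm, add_comm _ _, le_rfl, le_rfl, Or.inr (by simp)⟩, rfl⟩))
    (Submodule.sum_mem _ fun p hp => Submodule.smul_mem _ _ ?_))
  obtain ⟨h1, h2, h3, h4, h5⟩ := hr hp
  rw [min_eq_right hlm.le] at h4
  rw [max_eq_left hlm.le] at h5
  rcases lt_trichotomy p.1 p.2 with hxy | hxy | hxy
  · refine Submodule.span_mono (Set.image_mono ?_) (ih _ (by omega) hxy rfl)
    rintro ⟨x, y⟩ ⟨k1, k2, k3, k4, k5⟩
    simp only at k1 k2 k3 k4 k5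
    refine ⟨k1, by simp only; omega, by simp only; omega, by simp only; omega, ?_⟩
    rcases k5 with ⟨k5, k6⟩ | ⟨k5, k6⟩
    · refine Or.inr ⟨?_, ?_⟩
      · simpa using dvd_add k5 h1
      · simpa using dvd_add k6 h2
    · refine Or.inl ⟨?_, ?_⟩
      · simpa using dvd_add k5 h2
      · simpa using dvd_add k6 h1
  · rw [hxy, h.mul_self hq]
    exact Submodule.zero_mem _
  · exact Submodule.subset_span ⟨p, ⟨hxy, by omega, by omega, h5.le, Or.inr ⟨h1, h2⟩⟩, rfl⟩

/-- The word `W'` has the length, the sum and the residues modulo `n` (with multiplicity) of `W`,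
and its letters obey the same bounds. -/
structure SameType (n : ℕ) (W W' : List ℤ) : Prop where
  length : W'.length = W.length
  sum : W'.sum = W.sum
  residues : (W'.map (Int.cast : ℤ → ZMod n)).Perm (W.map Int.cast)
  le : ∀ H, (∀ x ∈ W, x ≤ H) → ∀ x ∈ W', x ≤ H
  ge : ∀ L, (∀ x ∈ W, L ≤ x) → ∀ x ∈ W', L ≤ x

theorem SameType.refl (W : List ℤ) : SameType n W W :=
  ⟨rfl, rfl, List.Perm.refl _, fun _ h => h, fun _ h => h⟩

theorem SameType.trans {W W' W'' : List ℤ} (h : SameType n W W') (h' : SameType n W' W'') :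
    SameType n W W'' :=
  ⟨h'.length.trans h.length, h'.sum.trans h.sum, h'.residues.trans h.residues,
    fun H hH => h'.le H (h.le H hH), fun H hH => h'.ge H (h.ge H hH)⟩

theorem SameType.of_straightPairs {l m x y : ℤ} (h : (x, y) ∈ straightPairs n l m)
    (P S : List ℤ) : SameType n (P ++ l :: m :: S) (P ++ x :: y :: S) := by
  obtain ⟨h1, h2, h3, h4, h5⟩ := h
  simp only at h1 h2 h3 h4 h5
  refine ⟨by simp, by simp; omega, ?_, fun H hH z hz => ?_, fun L hL z hz => ?_⟩
  · rw [List.map_append, List.map_append]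
    refine List.Perm.append_left _ ?_
    simp only [List.map_cons]
    have hc : ∀ u v : ℤ, (n : ℤ) ∣ u - v → (u : ZMod n) = v := fun u v huv => by
      rw [← sub_eq_zero, ← Int.cast_sub, ZMod.intCast_zmod_eq_zero_iff_dvd]
      exact huv
    rcases h5 with ⟨h5, h6⟩ | ⟨h5, h6⟩
    · rw [hc _ _ h5, hc _ _ h6]
    · rw [hc _ _ h5, hc _ _ h6]
      exact List.Perm.swap _ _ _
  · have hl := hH l (by simp)
    have hm := hH m (by simp)
    simp only [List.mem_append, List.mem_cons] at hz
    rcases hz with hz | rfl | rfl | hz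
    · exact hH z (by simp [hz])
    · omega
    · omega
    · exact hH z (by simp [hz])
  · have hl := hL l (by simp)
    have hm := hL m (by simp)
    simp only [List.mem_append, List.mem_cons] at hz
    rcases hz with hz | rfl | rfl | hz
    · exact hL z (by simp [hz])
    · omega
    · omega
    · exact hL z (by simp [hz])

/-- A word is strictly decreasing or has two consecutive letters in weakly increasing order. -/
theorem exists_ascent (W : List ℤ) :
    W.Pairwise (· > ·) ∨ ∃ P l m S, W = P ++ l :: m :: S ∧ l ≤ m := by
  rw [← List.isChain_iff_pairwise]
  induction W with
  | nil => exact Or.inl List.IsChain.nil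
  | cons x W ih =>
    rcases ih with h | ⟨P, l, m, S, rfl, hlm⟩
    · cases W with
      | nil => exact Or.inl (List.IsChain.singleton x)
      | cons y W =>
        rcases lt_or_ge y x with hxy | hxy
        · exact Or.inl (List.IsChain.cons_cons hxy h)
        · exact Or.inr ⟨[], x, y, W, rfl, hxy⟩
    · exact Or.inr ⟨x :: P, l, m, S, rfl, hlm⟩

/-- The sum of all partial sums of a word. It grows when an ascent is straightened. -/
def partialSums : List ℤ → ℤ
  | [] => 0
  | x :: W => (W.length + 1) * x + partialSums W

theorem partialSums_lt {l m x y : ℤ} (h : l + m = x + y) (hlx : l < x) (P S : List ℤ) :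
    partialSums (P ++ l :: m :: S) < partialSums (P ++ x :: y :: S) := by
  induction P with
  | nil =>
    simp only [List.nil_append, partialSums, List.length_cons]
    push_cast
    have : y = l + m - x := by omega
    subst this
    nlinarith
  | cons z P ih =>
    simp only [List.cons_append, partialSums, List.length_append, List.length_cons]
    simpa using ih

theorem partialSums_le (W : List ℤ) (H : ℤ) (hH : ∀ x ∈ W, x ≤ H) :
    partialSums W ≤ partialSums (List.replicate W.length H) := by
  induction W with
  | nil => simp [partialSums]
  | cons x W ih =>
    simp only [List.length_cons, List.replicate_succ, partialSums, List.length_replicate]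
    have h1 := hH x (by simp)
    have h2 := ih fun y hy => hH y (by simp [hy])
    have h3 : ((W.length : ℤ) + 1) * x ≤ (W.length + 1) * H :=
      mul_le_mul_of_nonneg_left h1 (by positivity)
    linarith

theorem exists_upper_bound (W : List ℤ) : ∃ H, ∀ x ∈ W, x ≤ H := by
  induction W with
  | nil => exact ⟨0, by simp⟩
  | cons y W ih =>
    obtain ⟨H, hH⟩ := ih
    refine ⟨max y H, fun x hx => ?_⟩
    rcases List.mem_cons.1 hx with rfl | hx
    · exact le_max_left _ _
    · exact le_max_of_le_right (hH x hx)

/-- Straightening: every product of the `ψ l` is a combination of products along strictly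
decreasing words of the same type. -/
theorem WedgeRelated.wordProd_mem_span (h : WedgeRelated n q ψ) (hn : 0 < n) (hq0 : q ≠ 0)
    (hq : 1 + q ^ 2 ≠ 0) (W : List ℤ) :
    wordProd ψ W ∈ Submodule.span K
      (wordProd ψ '' {W' : List ℤ | SameType n W W' ∧ W'.Pairwise (· > ·)}) := by
  obtain ⟨H, hH⟩ := exists_upper_bound W
  -- straightening increases the sum of the partial sums, which is bounded as the letters are
  induction hd : (partialSums (List.replicate W.length H) - partialSums W).toNat
    using Nat.strong_induction_on generalizing W with
  | _ d ih =>
  rcases exists_ascent W with hW | ⟨P, l, m, S, rfl, hlm⟩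
  · exact Submodule.subset_span ⟨W, ⟨SameType.refl W, hW⟩, rfl⟩
  have hprod : ∀ x y, wordProd ψ (P ++ x :: y :: S) =
      wordProd ψ P * (ψ x * ψ y) * wordProd ψ S := by
    intro x y
    simp only [wordProd_append, wordProd_cons, mul_assoc]
  rcases hlm.eq_or_lt with rfl | hlm
  · rw [hprod, h.mul_self hq]
    simp
  have hmem : ∀ p ∈ straightPairs n l m, wordProd ψ P * (ψ p.1 * ψ p.2) * wordProd ψ S ∈
      Submodule.span K (wordProd ψ ''
        {W' : List ℤ | SameType n (P ++ l :: m :: S) W' ∧ W'.Pairwise (· > ·)}) := by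
    rintro ⟨x, y⟩ hp
    have hst := SameType.of_straightPairs hp P S
    have hH' := hst.le H hH
    obtain ⟨h1, h2, h3, h4, -⟩ := hp
    simp only at h1 h2 h3 h4
    have hlt := partialSums_lt (l := l) (m := m) (x := x) (y := y) h2.symm (by omega) P S
    have hle := partialSums_le _ H hH'
    rw [hst.length] at hle
    rw [← hprod]
    refine Submodule.span_mono (Set.image_mono ?_) (ih _ ?_ (P ++ x :: y :: S) hH' rfl)
    · exact fun W' hW' => ⟨hst.trans hW'.1, hW'.2⟩
    · rw [hst.length]
      omega
  have hmap := Submodule.mem_map_of_mem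
    (f := (LinearMap.mulRight K (wordProd ψ S)).comp (LinearMap.mulLeft K (wordProd ψ P)))
    (h.mul_mem_span hn hq0 hq hlm)
  rw [hprod]
  rw [Submodule.map_span, ← Set.image_comp] at hmap
  refine Submodule.span_le.2 ?_ hmap
  rintro _ ⟨p, hp, rfl⟩
  exact hmem p hp

/-- The pigeonhole principle for strictly decreasing words. The maximum with `0` covers `H < L`,
where the word is empty. -/
theorem length_le_of_pairwise {W : List ℤ} (hW : W.Pairwise (· > ·)) {L H : ℤ}
    (h : ∀ x ∈ W, L ≤ x ∧ x ≤ H) : (W.length : ℤ) ≤ max (H - L + 1) 0 := by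
  have hnd : W.Nodup := hW.imp fun h => ne_of_gt h
  have h1 : W.toFinset.card ≤ (Finset.Icc L H).card :=
    Finset.card_le_card fun x hx => Finset.mem_Icc.2 (h x (List.mem_toFinset.1 hx))
  rw [List.toFinset_card_of_nodup hnd, Int.card_Icc] at h1
  omega

/-- A product of more factors than there are labels between its bounds vanishes. -/
theorem WedgeRelated.wordProd_eq_zero (h : WedgeRelated n q ψ) (hn : 0 < n) (hq0 : q ≠ 0)
    (hq : 1 + q ^ 2 ≠ 0) {W : List ℤ} {L H : ℤ} (hW : ∀ x ∈ W, L ≤ x ∧ x ≤ H)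
    (hlen : max (H - L + 1) 0 < W.length) : wordProd ψ W = 0 := by
  have hs := h.wordProd_mem_span hn hq0 hq W
  have he : {W' : List ℤ | SameType n W W' ∧ W'.Pairwise (· > ·)} = ∅ := by
    refine Set.eq_empty_of_forall_notMem ?_
    rintro W' ⟨h1, h2⟩
    have := length_le_of_pairwise h2 fun x hx =>
      ⟨h1.ge L (fun x hx => (hW x hx).1) x hx, h1.le H (fun x hx => (hW x hx).2) x hx⟩
    rw [h1.length] at this
    omega
  rwa [he, Set.image_empty, Submodule.span_empty, Submodule.mem_bot] at hs

end Straightening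

/-! ### The sum of all Fock spaces and its creation operators -/

section Creation

variable {K : Type*} [Field K] {m : ℤ}

/-- Prepend the factor `u_l` to a pure tensor. -/
def TensorIndex.cons (l : ℤ) (s : TensorIndex m) : TensorIndex (m + 1) :=
  ⟨fun k => k.casesOn l s.1, by
    obtain ⟨N, hN⟩ := Filter.eventually_atTop.1 s.2
    refine Filter.eventually_atTop.2 ⟨N + 1, fun k hk => ?_⟩
    obtain ⟨k, rfl⟩ : ∃ j, k = j + 1 := ⟨k - 1, by omega⟩
    change s.1 k = _
    rw [hN k (by omega)]
    push_cast
    ring⟩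

theorem TensorIndex.cons_succ (l : ℤ) (s : TensorIndex m) (k : ℕ) :
    (s.cons l).1 (k + 1) = s.1 k := rfl

/-- Remove the first `N` factors of a pure tensor. -/
def TensorIndex.drop (s : TensorIndex m) (N : ℕ) : TensorIndex (m - N) :=
  ⟨fun k => s.1 (k + N), by
    obtain ⟨N', hN⟩ := Filter.eventually_atTop.1 s.2
    refine Filter.eventually_atTop.2 ⟨N', fun k hk => ?_⟩
    change s.1 (k + N) = _
    rw [hN (k + N) (by omega)]
    push_cast
    ring⟩

theorem TensorIndex.drop_apply (s : TensorIndex m) (N k : ℕ) : (s.drop N).1 k = s.1 (k + N) := rfl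

theorem cons_setPair (l : ℤ) (s : TensorIndex m) (i : ℕ) (p : ℤ × ℤ) :
    (setPair s i p).cons l = setPair (s.cons l) (i + 1) p := by
  refine TensorIndex.ext fun k => ?_
  rw [setPair_apply]
  cases k with
  | zero => rw [if_neg (by omega), if_neg (by omega)]; rfl
  | succ k =>
    rw [TensorIndex.cons_succ, setPair_apply, TensorIndex.cons_succ]
    simp only [Nat.succ_inj]

theorem setPair_cons_cons (l l' : ℤ) (s : TensorIndex m) (p : ℤ × ℤ) :
    setPair ((s.cons l').cons l) 0 p = (s.cons p.2).cons p.1 := by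
  refine TensorIndex.ext fun k => ?_
  rw [setPair_apply]
  match k with
  | 0 => rfl
  | 1 => rfl
  | k + 2 => rw [if_neg (by omega), if_neg (by omega)]; rfl

variable (n : ℕ) (q : K)

/-- Left multiplication by `u_l` on tensors. -/
def consMap (m : ℤ) (l : ℤ) : TensorSpace K m →ₗ[K] TensorSpace K (m + 1) :=
  Finsupp.lmapDomain K K (TensorIndex.cons l)

theorem consMap_single (l : ℤ) (s : TensorIndex m) (r : K) :
    consMap m l (Finsupp.single s r) = Finsupp.single (s.cons l) r := by
  simp [consMap, Finsupp.mapDomain_single]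

theorem hecke_consMap (i : ℕ) (l : ℤ) (w : TensorSpace K m) :
    hecke n q (m + 1) (i + 1) (consMap m l w) = consMap m l (hecke n q m i w) := by
  have : (hecke n q (m + 1) (i + 1)) ∘ₗ consMap m l = consMap m l ∘ₗ hecke n q m i := by
    refine Finsupp.lhom_ext' fun s => LinearMap.ext_ring ?_
    simp only [LinearMap.comp_apply, Finsupp.lsingle_apply]
    rw [consMap_single]
    have e1 := hecke_single n q (i + 1) (s.cons l)
    have e2 := hecke_single n q i s
    simp only [heckeOp] at e1 e2
    rw [e1, e2, consMap, Finsupp.lmapDomain_apply, ← Finsupp.mapDomain_comp,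
      TensorIndex.cons_succ, TensorIndex.cons_succ]
    congr 1
    funext p
    exact (cons_setPair l s i p).symm
  exact LinearMap.congr_fun this w

theorem wedgeRelations_le_comap (l : ℤ) :
    wedgeRelations n q m ≤ (wedgeRelations n q (m + 1)).comap (consMap m l) := by
  refine iSup_le fun i w hw => ?_
  refine Submodule.mem_iSup_of_mem (i + 1) ?_
  have hw' : hecke n q m i w + w = 0 := hw
  change hecke n q (m + 1) (i + 1) (consMap m l w) + consMap m l w = 0
  rw [hecke_consMap, ← map_add, hw', map_zero]

/-- The operator `F_(m) → F_(m+1)` of left multiplication by `u_l`. -/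
def wedgeLeft (m l : ℤ) : FockSpace n q m →ₗ[K] FockSpace n q (m + 1) :=
  Submodule.mapQ _ _ (consMap m l) (wedgeRelations_le_comap n q l)

/-- The direct sum of the Fock spaces of all charges. -/
def TotalFock : Type _ := DirectSum ℤ fun m => FockSpace n q m

instance : AddCommGroup (TotalFock n q) :=
  (Module.addCommMonoidToAddCommGroup K : AddCommGroup (DirectSum ℤ fun m => FockSpace n q m))

instance : Module K (TotalFock n q) :=
  inferInstanceAs (Module K (DirectSum ℤ fun m => FockSpace n q m))

/-- The inclusion of the Fock space of charge `m`. -/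
def totalIncl (m : ℤ) : FockSpace n q m →ₗ[K] TotalFock n q :=
  DirectSum.lof K ℤ (fun m => FockSpace n q m) m

/-- The linear map on the direct sum with given components. -/
def totalLift {V : Type*} [AddCommGroup V] [Module K V] (f : ∀ m, FockSpace n q m →ₗ[K] V) :
    TotalFock n q →ₗ[K] V :=
  DirectSum.toModule K ℤ V f

theorem totalLift_incl {V : Type*} [AddCommGroup V] [Module K V]
    (f : ∀ m, FockSpace n q m →ₗ[K] V) (m : ℤ) (x : FockSpace n q m) :
    totalLift n q f (totalIncl n q m x) = f m x :=
  DirectSum.toModule_lof K m x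

theorem totalIncl_injective (m : ℤ) : Function.Injective (totalIncl n q m) :=
  DirectSum.of_injective (β := fun m => FockSpace n q m) m

theorem total_ext {V : Type*} [AddCommGroup V] [Module K V] {X Y : TotalFock n q →ₗ[K] V}
    (h : ∀ m, X ∘ₗ totalIncl n q m = Y ∘ₗ totalIncl n q m) : X = Y :=
  DirectSum.linearMap_ext K h

/-- The operator `u_l ∧` on the direct sum of all Fock spaces. -/
def creation (l : ℤ) : Module.End K (TotalFock n q) :=
  totalLift n q fun m => totalIncl n q (m + 1) ∘ₗ wedgeLeft n q m l

/-- The class of a tensor in the direct sum of all Fock spaces. -/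
def classMap (m : ℤ) : TensorSpace K m →ₗ[K] TotalFock n q :=
  totalIncl n q m ∘ₗ (wedgeRelations n q m).mkQ

/-- The wedge `u_{s 0} ∧ u_{s 1} ∧ ⋯`. -/
def wedge (s : TensorIndex m) : TotalFock n q := classMap n q m (Finsupp.single s 1)

/-- The ground state of charge `m`. -/
def vacuum (m : ℤ) : TotalFock n q := wedge n q (ground m)

theorem creation_incl (l : ℤ) (x : FockSpace n q m) :
    creation n q l (totalIncl n q m x) =
      totalIncl n q (m + 1) (wedgeLeft n q m l x) := by
  rw [creation, totalLift_incl, LinearMap.comp_apply]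

theorem creation_classMap (l : ℤ) (w : TensorSpace K m) :
    creation n q l (classMap n q m w) = classMap n q (m + 1) (consMap m l w) := by
  simp only [classMap, LinearMap.comp_apply, creation_incl, wedgeLeft, Submodule.mkQ_apply,
    Submodule.mapQ_apply]

theorem creation_wedge (l : ℤ) (s : TensorIndex m) :
    creation n q l (wedge n q s) = wedge n q (s.cons l) := by
  rw [wedge, creation_classMap, consMap_single, wedge]

theorem creation_vacuum (m : ℤ) : creation n q (m + 1) (vacuum n q m) = vacuum n q (m + 1) := by
  rw [vacuum, creation_wedge, vacuum]
  congr 1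
  refine TensorIndex.ext fun k => ?_
  cases k with
  | zero => change m + 1 = m + 1 - ((0 : ℕ) : ℤ); simp
  | succ k =>
    change m - (k : ℤ) = m + 1 - ((k + 1 : ℕ) : ℤ)
    push_cast
    ring

theorem classMap_eq_zero_iff (w : TensorSpace K m) :
    classMap n q m w = 0 ↔ w ∈ wedgeRelations n q m := by
  rw [classMap, LinearMap.comp_apply, Submodule.mkQ_apply, ← Submodule.Quotient.mk_eq_zero]
  constructor
  · intro h
    exact totalIncl_injective n q m (h.trans (map_zero _).symm)
  · intro h
    rw [h, map_zero]

theorem total_end_ext {V : Type*} [AddCommGroup V] [Module K V]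
    {X Y : TotalFock n q →ₗ[K] V}
    (h : ∀ (m : ℤ) (s : TensorIndex m), X (wedge n q s) = Y (wedge n q s)) : X = Y := by
  refine total_ext n q fun m => ?_
  refine Submodule.linearMap_qext _ ?_
  refine Finsupp.lhom_ext' fun s => LinearMap.ext_ring ?_
  exact h m s

variable {n q}

/-- The creation operators satisfy the relations of the factors of a wedge: for a tensor `v` the
vector `(T_0 - q²) v` lies in `Ker (T_0 + 1)`. -/
theorem creation_wedgeRelated (hn : 0 < n) : WedgeRelated n q (creation n q) := by
  intro l l'
  refine total_end_ext n q fun m s => ?_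
  have hs : ∀ p : ℤ × ℤ, (creation n q p.1 * creation n q p.2) (wedge n q s) =
      classMap n q (m + 1 + 1) (Finsupp.single ((s.cons p.2).cons p.1) 1) := fun p => by
    rw [Module.End.mul_apply, creation_wedge, creation_wedge, wedge]
  have e0 : heckeOp n q (m + 1 + 1) 0 (Finsupp.single ((s.cons l').cons l) 1) =
      (heckePair n q l l').sum fun p c => c • Finsupp.single ((s.cons p.2).cons p.1) 1 := by
    rw [hecke_single, Finsupp.mapDomain]
    refine Finsupp.sum_congr fun p _ => ?_
    rw [setPair_cons_cons, Finsupp.smul_single, smul_eq_mul, mul_one]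
  have e1 : (heckePair n q l l').sum (fun p c => c • (creation n q p.1 * creation n q p.2))
      (wedge n q s) = classMap n q (m + 1 + 1)
        (heckeOp n q (m + 1 + 1) 0 (Finsupp.single ((s.cons l').cons l) 1)) := by
    rw [e0, Finsupp.sum, LinearMap.sum_apply, Finsupp.sum, map_sum]
    refine Finset.sum_congr rfl fun p _ => ?_
    rw [LinearMap.smul_apply, hs, map_smul]
  rw [e1, LinearMap.smul_apply, hs (l, l'), ← sub_eq_zero, ← map_smul, ← map_sub,
    classMap_eq_zero_iff]
  refine Submodule.mem_iSup_of_mem 0 ?_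
  rw [LinearMap.mem_ker]
  have e2 := congrArg (fun f => f (Finsupp.single ((s.cons l').cons l) (1 : K)))
    (hecke_mul_self (q := q) (m := m + 1 + 1) hn 0)
  simp only [Module.End.mul_apply, LinearMap.add_apply, LinearMap.smul_apply,
    Module.End.one_apply] at e2
  rw [LinearMap.add_apply, Module.End.one_apply, map_sub, map_smul]
  change heckeOp n q (m + 1 + 1) 0 _ - _ + _ = 0
  rw [e2]
  module

/-- Split off the first `N` factors of a wedge. -/
theorem wedge_eq_wordProd_drop (s : TensorIndex m) (N : ℕ) :
    wedge n q s = wordProd (creation n q) ((List.range N).map s.1) (wedge n q (s.drop N)) := by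
  have hcons : ∀ (m m' : ℤ) (s : TensorIndex m) (s' : TensorIndex m'), m = m' + 1 →
      (∀ k, s'.1 k = s.1 (k + 1)) → wedge n q s = creation n q (s.1 0) (wedge n q s') := by
    rintro m m' s s' rfl h
    rw [creation_wedge]
    congr 1
    refine TensorIndex.ext fun k => ?_
    cases k with
    | zero => rfl
    | succ k => exact (h k).symm
  induction N with
  | zero =>
    have h0 : ∀ (m m' : ℤ) (s : TensorIndex m) (s' : TensorIndex m'), m = m' →
        (∀ k, s'.1 k = s.1 k) → wedge n q s = wedge n q s' := by
      rintro m m' s s' rfl h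
      congr 1
      exact TensorIndex.ext fun k => (h k).symm
    exact h0 _ _ s (s.drop 0) (by simp) fun k => rfl
  | succ N ih =>
    rw [ih, List.range_succ, List.map_append, wordProd_append, Module.End.mul_apply,
      List.map_singleton, wordProd_cons, wordProd_nil, mul_one]
    congr 1
    rw [hcons (m - N) (m - (N + 1 : ℕ)) (s.drop N) (s.drop (N + 1)) (by push_cast; ring)
      fun k => congrArg s.1 (by omega : k + (N + 1) = k + 1 + N)]
    rw [TensorIndex.drop_apply, zero_add]

/-- A wedge vanishes as soon as a product of consecutive factors vanishes. -/
theorem wedge_eq_zero (s : TensorIndex m) (p N : ℕ)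
    (h : wordProd (creation n q) ((List.range N).map fun k => s.1 (p + k)) = 0) :
    wedge n q s = 0 := by
  rw [wedge_eq_wordProd_drop s (p + N), List.range_add, List.map_append, wordProd_append,
    List.map_map, Module.End.mul_apply]
  have e : ((List.range N).map (s.1 ∘ fun x => p + x)) = (List.range N).map fun k => s.1 (p + k) :=
    rfl
  rw [e, h, LinearMap.zero_apply, map_zero]

/-- Every wedge is obtained from a ground state by finitely many creation operators. -/
theorem exists_eq_wordProd_vacuum (s : TensorIndex m) (N : ℕ)
    (h : ∀ k, N ≤ k → s.1 k = m - k) :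
    wedge n q s = wordProd (creation n q) ((List.range N).map s.1) (vacuum n q (m - N)) := by
  rw [wedge_eq_wordProd_drop s N, vacuum]
  congr 2
  refine TensorIndex.ext fun k => ?_
  rw [TensorIndex.drop_apply, h _ (by omega)]
  change m - ((k + N : ℕ) : ℤ) = m - (N : ℤ) - (k : ℤ)
  push_cast
  ring

end Creation

/-! ### The operators `B_a` -/

section BosonOperators

variable {K : Type*} [Field K] {m : ℤ} {n : ℕ} {q : K}

/-- Shifting a label deep inside the ground state yields a product of `|a| n + 1` consecutive
factors with at most `|a| n` different labels, hence zero. -/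
theorem wedge_set_eq_zero (hn : 0 < n) (hq0 : q ≠ 0) (hq : 1 + q ^ 2 ≠ 0) {a : ℤ} (ha : a ≠ 0)
    (s : TensorIndex m) (N : ℕ) (hN : ∀ k, N ≤ k → s.1 k = m - k) (k : ℕ)
    (hk : N ≤ k) (hk' : a < 0 → N + (a * n).natAbs ≤ k) :
    wedge n q (s.set k (s.1 k - a * n)) = 0 := by
  have hn' : (0 : ℤ) < n := by exact_mod_cast hn
  have hset : ∀ j, N ≤ j → (s.set k (s.1 k - a * n)).1 j =
      if j = k then m - k - a * n else m - j := by
    intro j hj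
    rw [TensorIndex.set_apply, hN k hk, hN j hj]
  rcases lt_or_gt_of_ne ha with ha | ha
  · have hneg : a * n < 0 := mul_neg_of_neg_of_pos ha hn'
    have hk' := hk' ha
    generalize a * n = e at *
    obtain ⟨d, rfl⟩ : ∃ d : ℕ, e = -d := ⟨e.natAbs, by omega⟩
    rw [Int.natAbs_neg, Int.natAbs_natCast] at hk'
    -- for `a < 0` the label in position `k` moves to that of position `k - d`, `d = |a| n`
    refine wedge_eq_zero _ (k - d) (d + 1) ((creation_wedgeRelated hn).wordProd_eq_zero hn hq0 hq
      (L := m - (k - d : ℕ) - d + 1) (H := m - (k - d : ℕ)) ?_ ?_)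
    · intro x hx
      obtain ⟨i, hi, rfl⟩ := List.mem_map.1 hx
      rw [List.mem_range] at hi
      rw [hset _ (by omega)]
      split_ifs <;> omega
    · simp only [List.length_map, List.length_range]
      push_cast
      omega
  · have hpos : 0 < a * n := mul_pos ha hn'
    clear hk'
    generalize a * n = e at *
    obtain ⟨d, rfl⟩ : ∃ d : ℕ, e = d := ⟨e.natAbs, by omega⟩
    -- for `a > 0` the label in position `k` moves to that of position `k + d`, `d = a n`
    refine wedge_eq_zero _ k (d + 1) ((creation_wedgeRelated hn).wordProd_eq_zero hn hq0 hq
      (L := m - k - d) (H := m - k - 1) ?_ ?_)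
    · intro x hx
      obtain ⟨i, hi, rfl⟩ := List.mem_map.1 hx
      rw [List.mem_range] at hi
      rw [hset _ (by omega)]
      split_ifs <;> omega
    · simp only [List.length_map, List.length_range]
      push_cast
      omega

theorem mkQ_eq_zero_iff (w : TensorSpace K m) :
    (wedgeRelations n q m).mkQ w = 0 ↔ classMap n q m w = 0 := by
  rw [classMap_eq_zero_iff, Submodule.mkQ_apply, Submodule.Quotient.mk_eq_zero]

theorem classMap_yPow_single (s : TensorIndex m) (k : ℕ) (a : ℤ) :
    classMap n q m (yPow K n m k (-a) (Finsupp.single s 1)) =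
      wedge n q (s.set k (s.1 k - a * n)) := by
  have e := yPow_single (K := K) n k (-a) s 1
  simp only [yOp] at e
  rw [e, wedge, neg_mul, ← sub_eq_add_neg]

theorem finite_yPow (hn : 0 < n) (hq0 : q ≠ 0) (hq : 1 + q ^ 2 ≠ 0) {a : ℤ} (ha : a ≠ 0)
    (w : TensorSpace K m) :
    {k : ℕ | (wedgeRelations n q m).mkQ (yPow K n m k (-a) w) ≠ 0}.Finite := by
  induction w using Finsupp.induction_linear with
  | zero => simp
  | add f g hf hg =>
    refine (hf.union hg).subset fun k hk => ?_
    by_contra hne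
    rw [Set.mem_union, not_or] at hne
    refine hk ?_
    rw [map_add, map_add, not_not.1 hne.1, not_not.1 hne.2, add_zero]
  | single s c =>
    obtain ⟨N, hN⟩ := Filter.eventually_atTop.1 s.2
    refine (Set.finite_lt_nat (N + (a * n).natAbs)).subset fun k hk => ?_
    by_contra hlt
    refine hk ?_
    have hs : (Finsupp.single s c : TensorSpace K m) = c • Finsupp.single s 1 := by simp
    have hlt' : ¬ k < N + (a * n).natAbs := hlt
    rw [hs, map_smul, map_smul, (mkQ_eq_zero_iff _).2, smul_zero]
    rw [classMap_yPow_single]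
    exact wedge_set_eq_zero hn hq0 hq ha s N hN k (by omega) fun _ => by omega

/-- `B_a` on tensors, before passing to the quotient. -/
def preB (n : ℕ) (q : K) (m a : ℤ) : TensorSpace K m →ₗ[K] FockSpace n q m :=
  Finsupp.linearCombination K fun s =>
    ∑ᶠ k : ℕ, (wedgeRelations n q m).mkQ (yPow K n m k (-a) (Finsupp.single s 1))

theorem preB_apply (hn : 0 < n) (hq0 : q ≠ 0) (hq : 1 + q ^ 2 ≠ 0) {a : ℤ} (ha : a ≠ 0)
    (w : TensorSpace K m) :
    preB n q m a w = ∑ᶠ k : ℕ, (wedgeRelations n q m).mkQ (yPow K n m k (-a) w) := by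
  induction w using Finsupp.induction_linear with
  | zero => simp
  | add f g hf hg =>
    simp only [map_add, hf, hg]
    exact (finsum_add_distrib (finite_yPow hn hq0 hq ha f) (finite_yPow hn hq0 hq ha g)).symm
  | single s c =>
    have hs : (Finsupp.single s c : TensorSpace K m) = c • Finsupp.single s 1 := by simp
    rw [hs]
    simp only [map_smul]
    rw [← smul_finsum, preB, Finsupp.linearCombination_single, one_smul]

/-- `B_a` is well defined on the quotient: a finite sum of the `y_k ^ (-a)` which includes the
positions `i` and `i + 1` commutes with `T_i` and hence preserves `Ker (T_i + 1)`. -/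
theorem wedgeRelations_le_ker_preB (hn : 0 < n) (hq0 : q ≠ 0) (hq : 1 + q ^ 2 ≠ 0) {a : ℤ}
    (ha : a ≠ 0) : wedgeRelations n q m ≤ LinearMap.ker (preB n q m a) := by
  refine iSup_le fun i w hw => ?_
  rw [LinearMap.mem_ker, preB_apply hn hq0 hq ha]
  obtain ⟨F, hF⟩ := (finite_yPow hn hq0 hq ha w).exists_finset_coe
  let N := F.sup id + (i + 2)
  have hsub : Function.support (fun k => (wedgeRelations n q m).mkQ (yPow K n m k (-a) w)) ⊆
      (Finset.range N : Set ℕ) := by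
    intro k hk
    have hkF : k ∈ (F : Set ℕ) := by rw [hF]; exact hk
    have := Finset.le_sup (f := id) (Finset.mem_coe.1 hkF)
    simp only [id] at this
    simp only [Finset.coe_range, Set.mem_Iio, N]
    omega
  rw [finsum_eq_sum_of_support_subset _ hsub, ← map_sum, Submodule.mkQ_apply,
    Submodule.Quotient.mk_eq_zero]
  refine Submodule.mem_iSup_of_mem i ?_
  have hcomm : Commute (heckeOp n q m i) (∑ k ∈ Finset.range N, yOp K n m k (-a)) := by
    have hi : i ∈ Finset.range N := Finset.mem_range.2 (by omega)
    have hi' : i + 1 ∈ (Finset.range N).erase i :=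
      Finset.mem_erase.2 ⟨by omega, Finset.mem_range.2 (by omega)⟩
    rw [← Finset.add_sum_erase _ _ hi, ← Finset.add_sum_erase _ _ hi', ← add_assoc]
    refine (hecke_comm_yPow_add hn i (-a)).add_right (Commute.sum_right _ _ _ fun k hk => ?_)
    rw [Finset.mem_erase, Finset.mem_erase] at hk
    exact hecke_comm_yPow i k hk.2.1 hk.1 (-a)
  have e := congrArg (fun f => f w) hcomm.eq
  simp only [Module.End.mul_apply, LinearMap.sum_apply] at e
  have hw' : hecke n q m i w = -w := eq_neg_of_add_eq_zero_left hw
  change heckeOp n q m i (∑ k ∈ Finset.range N, yOp K n m k (-a) w) +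
    ∑ k ∈ Finset.range N, yOp K n m k (-a) w = 0
  rw [e]
  simp only [heckeOp, hw', map_neg, Finset.sum_neg_distrib, neg_add_cancel]

theorem exists_isBOperator (hn : 0 < n) (hq0 : q ≠ 0) (hq : 1 + q ^ 2 ≠ 0) {a : ℤ} (ha : a ≠ 0)
    (m : ℤ) : ∃ β : Module.End K (FockSpace n q m), IsBOperator n q m a β :=
  ⟨(wedgeRelations n q m).liftQ (preB n q m a) (wedgeRelations_le_ker_preB hn hq0 hq ha),
    finite_yPow hn hq0 hq ha, fun w => by
      rw [Submodule.mkQ_apply, Submodule.liftQ_apply, preB_apply hn hq0 hq ha]⟩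

open Classical in
/-- The operator `B_a` on `F_(m)` (`0` if it does not exist). -/
def bOp (n : ℕ) (q : K) (m a : ℤ) : Module.End K (FockSpace n q m) :=
  if h : ∃ β, IsBOperator n q m a β then h.choose else 0

theorem bOp_spec (hn : 0 < n) (hq0 : q ≠ 0) (hq : 1 + q ^ 2 ≠ 0) {a : ℤ} (ha : a ≠ 0) (m : ℤ) :
    IsBOperator n q m a (bOp n q m a) := by
  rw [bOp, dif_pos (exists_isBOperator hn hq0 hq ha m)]
  exact (exists_isBOperator hn hq0 hq ha m).choose_spec

/-- The operator `B_a` on the direct sum of all Fock spaces. -/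
def boson (n : ℕ) (q : K) (a : ℤ) : Module.End K (TotalFock n q) :=
  totalLift n q fun m => totalIncl n q m ∘ₗ bOp n q m a

theorem boson_incl (a : ℤ) (x : FockSpace n q m) :
    boson n q a (totalIncl n q m x) =
      totalIncl n q m (bOp n q m a x) := by
  rw [boson, totalLift_incl, LinearMap.comp_apply]

/-- The action of `B_a` on a wedge as a finite sum. Among the factors of the ground state part, only
the first `|a| n` ones contribute for `a < 0`, and none for `a > 0`. -/
theorem boson_wedge (hn : 0 < n) (hq0 : q ≠ 0) (hq : 1 + q ^ 2 ≠ 0) {a : ℤ} (ha : a ≠ 0)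
    (s : TensorIndex m) (N N' : ℕ) (hN : ∀ k, N ≤ k → s.1 k = m - k)
    (hN' : N + (if a < 0 then (a * n).natAbs else 0) ≤ N') :
    boson n q a (wedge n q s) =
      ∑ k ∈ Finset.range N', wedge n q (s.set k (s.1 k - a * n)) := by
  have h1 : boson n q a (wedge n q s) = totalIncl n q m
      (bOp n q m a ((wedgeRelations n q m).mkQ (Finsupp.single s 1))) := by
    rw [wedge, classMap, LinearMap.comp_apply, boson_incl]
  rw [h1, (bOp_spec hn hq0 hq ha m).apply,
    finsum_eq_sum_of_support_subset (s := Finset.range N') _ ?_, map_sum]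
  · refine Finset.sum_congr rfl fun k _ => ?_
    rw [← classMap_yPow_single]
    rfl
  · intro k hk
    by_contra hlt
    refine hk ?_
    simp only [Finset.coe_range, Set.mem_Iio, not_lt] at hlt
    rw [mkQ_eq_zero_iff, classMap_yPow_single]
    refine wedge_set_eq_zero hn hq0 hq ha s N hN k (by omega) fun ha => ?_
    rw [if_pos ha] at hN'
    omega

/-- `B_a` is a derivation with respect to the creation operators. -/
theorem boson_mul_creation (hn : 0 < n) (hq0 : q ≠ 0) (hq : 1 + q ^ 2 ≠ 0) {a : ℤ} (ha : a ≠ 0)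
    (l : ℤ) : boson n q a * creation n q l =
      creation n q l * boson n q a + creation n q (l - a * n) := by
  refine total_end_ext n q fun m s => ?_
  obtain ⟨N, hN⟩ := Filter.eventually_atTop.1 s.2
  let M := N + (if a < 0 then (a * n).natAbs else 0)
  rw [Module.End.mul_apply, LinearMap.add_apply, Module.End.mul_apply, creation_wedge,
    boson_wedge hn hq0 hq ha (s.cons l) (N + 1) (M + 1) ?_ (by omega),
    boson_wedge hn hq0 hq ha s N M hN le_rfl, Finset.sum_range_succ', map_sum, creation_wedge]
  · congr 1
    · refine Finset.sum_congr rfl fun k _ => ?_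
      rw [creation_wedge]
      congr 1
      refine TensorIndex.ext fun j => ?_
      cases j with
      | zero => rw [TensorIndex.set_apply, if_neg (by omega)]; rfl
      | succ j =>
        rw [TensorIndex.set_apply, TensorIndex.cons_succ, TensorIndex.cons_succ,
          TensorIndex.cons_succ, TensorIndex.set_apply]
        simp only [Nat.succ_inj]
    · congr 1
      refine TensorIndex.ext fun j => ?_
      cases j with
      | zero => rw [TensorIndex.set_apply, if_pos rfl]; rfl
      | succ j => rw [TensorIndex.set_apply, if_neg (by omega)]; rfl
  · intro k hk
    obtain ⟨k, rfl⟩ : ∃ j, k = j + 1 := ⟨k - 1, by omega⟩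
    rw [TensorIndex.cons_succ, hN k (by omega)]
    push_cast
    ring

/-- `B_a`, `a > 0`, annihilates the ground states. -/
theorem boson_vacuum (hn : 0 < n) (hq0 : q ≠ 0) (hq : 1 + q ^ 2 ≠ 0) {a : ℤ} (ha : 0 < a) (m : ℤ) :
    boson n q a (vacuum n q m) = 0 := by
  rw [vacuum, boson_wedge hn hq0 hq ha.ne' (ground m) 0 0 (fun _ _ => rfl)
    (by rw [if_neg (by omega)]), Finset.sum_range_zero]

end BosonOperators

/-! ### Energy, and the commutators of nonzero degree -/

section Energy

variable {K : Type*} [Field K] {n : ℕ} {q : K}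

/-- The commutator `[B_a, B_b]` on the direct sum of all Fock spaces. -/
def bosonComm (n : ℕ) (q : K) (a b : ℤ) : Module.End K (TotalFock n q) :=
  boson n q a * boson n q b - boson n q b * boson n q a

/-- `[B_a, B_b]` commutes with the creation operators, as the shifts of the labels commute. -/
theorem bosonComm_commute (hn : 0 < n) (hq0 : q ≠ 0) (hq : 1 + q ^ 2 ≠ 0) {a b : ℤ} (ha : a ≠ 0)
    (hb : b ≠ 0) (l : ℤ) : Commute (bosonComm n q a b) (creation n q l) := by
  have hA := boson_mul_creation hn hq0 hq ha
  have hB := boson_mul_creation hn hq0 hq hb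
  have key : ∀ a b, (∀ l, boson n q a * creation n q l =
      creation n q l * boson n q a + creation n q (l - a * n)) →
      (∀ l, boson n q b * creation n q l =
      creation n q l * boson n q b + creation n q (l - b * n)) →
      boson n q a * boson n q b * creation n q l = creation n q l * (boson n q a * boson n q b) +
        creation n q (l - a * n) * boson n q b + creation n q (l - b * n) * boson n q a +
        creation n q (l - b * n - a * n) := by
    intro a b hA hB
    rw [mul_assoc, hB, mul_add, ← mul_assoc, hA, hA, add_mul]
    simp only [mul_assoc, add_assoc]
  change _ * _ = _ * _
  rw [bosonComm, sub_mul, mul_sub, key a b hA hB, key b a hB hA,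
    show l - b * n - a * n = l - a * n - b * n by ring]
  abel

theorem bosonComm_wordProd (hn : 0 < n) (hq0 : q ≠ 0) (hq : 1 + q ^ 2 ≠ 0) {a b : ℤ} (ha : a ≠ 0)
    (hb : b ≠ 0) (W : List ℤ) (v : TotalFock n q) :
    bosonComm n q a b (wordProd (creation n q) W v) =
      wordProd (creation n q) W (bosonComm n q a b v) := by
  induction W with
  | nil => rfl
  | cons l W ih =>
    rw [wordProd_cons, Module.End.mul_apply, Module.End.mul_apply, ← ih]
    exact congrArg (fun f => f (wordProd (creation n q) W v))
      (bosonComm_commute hn hq0 hq ha hb l).eq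

/-- The word `m + N, m + N - 1, …, m + 1`. -/
def fullWord (m : ℤ) (N : ℕ) : List ℤ := (List.range N).map fun i => m + N - (i : ℕ)

theorem mem_fullWord {m : ℤ} {N : ℕ} {x : ℤ} : x ∈ fullWord m N ↔ m < x ∧ x ≤ m + N := by
  simp only [fullWord, List.mem_map, List.mem_range]
  constructor
  · rintro ⟨i, hi, rfl⟩
    omega
  · rintro ⟨h1, h2⟩
    exact ⟨(m + N - x).toNat, by omega, by omega⟩

theorem length_fullWord (m : ℤ) (N : ℕ) : (fullWord m N).length = N := by
  simp [fullWord]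

theorem fullWord_nodup (m : ℤ) (N : ℕ) : (fullWord m N).Nodup :=
  List.nodup_range.map fun i j h => by
    have h' : m + N - (i : ℤ) = m + N - (j : ℤ) := h
    omega

theorem fullWord_succ (m : ℤ) (N : ℕ) : fullWord m (N + 1) = (m + N + 1) :: fullWord m N := by
  simp only [fullWord, List.range_succ_eq_map, List.map_cons, List.map_map]
  congr 1
  · push_cast
    ring
  · refine List.map_congr_left fun i _ => ?_
    simp only [Function.comp]
    push_cast
    ring

theorem two_mul_sum_fullWord (m : ℤ) (N : ℕ) :
    2 * (fullWord m N).sum = (m + N) * (m + N + 1) - m * (m + 1) := by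
  induction N with
  | zero => simp [fullWord]
  | succ N ih =>
    rw [fullWord_succ, List.sum_cons, mul_add, ih]
    push_cast
    ring

theorem wordProd_fullWord_vacuum (m : ℤ) (N : ℕ) :
    wordProd (creation n q) (fullWord m N) (vacuum n q m) = vacuum n q (m + N) := by
  induction N with
  | zero => simp [fullWord, wordProd_nil]
  | succ N ih =>
    rw [fullWord_succ, wordProd_cons, Module.End.mul_apply, ih, creation_vacuum]
    congr 1
    push_cast
    ring

/-- The span of the wedges of charge `m` and energy `d`. For a word `W` in front of the ground
state of charge `m'` the energy is the sum of `W` minus the sum of the labels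
`m, m - 1, …, m' + 1`; both sums are doubled to write the latter as a polynomial. -/
def energySpace (n : ℕ) (q : K) (m d : ℤ) : Submodule K (TotalFock n q) :=
  Submodule.span K {v | ∃ (W : List ℤ) (m' : ℤ), m' + W.length = m ∧
    2 * W.sum + m' * (m' + 1) = m * (m + 1) + 2 * d ∧
    v = wordProd (creation n q) W (vacuum n q m')}

theorem creation_mem_energySpace {m d : ℤ} (l : ℤ) {v : TotalFock n q}
    (hv : v ∈ energySpace n q m d) {d' : ℤ} (hd' : d' = d + l - (m + 1)) :
    creation n q l v ∈ energySpace n q (m + 1) d' := by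
  have h := Submodule.mem_map_of_mem (f := creation n q l) hv
  rw [energySpace, Submodule.map_span] at h
  refine Submodule.span_mono ?_ h
  rintro _ ⟨_, ⟨W, m', h1, h2, rfl⟩, rfl⟩
  refine ⟨l :: W, m', ?_, ?_, ?_⟩
  · simp only [List.length_cons]
    push_cast
    omega
  · simp only [List.sum_cons]
    subst hd'
    linear_combination h2
  · rw [wordProd_cons, Module.End.mul_apply]

theorem wedge_mem_energySpace {m : ℤ} (s : TensorIndex m) (N : ℕ) (h : ∀ k, N ≤ k → s.1 k = m - k) :
    wedge n q s ∈ energySpace n q m (∑ k ∈ Finset.range N, (s.1 k - (m - k))) := by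
  rw [exists_eq_wordProd_vacuum s N h]
  refine Submodule.subset_span ⟨_, m - N, by simp, ?_, rfl⟩
  have h1 : ((List.range N).map s.1).sum = ∑ k ∈ Finset.range N, s.1 k := by
    rw [Finset.sum_eq_multiset_sum]
    simp [Multiset.range]
  have h2 : 2 * ∑ k ∈ Finset.range N, (m - (k : ℤ)) = m * (m + 1) - (m - N) * (m - N + 1) := by
    clear h1 h
    induction N with
    | zero => simp
    | succ N ih =>
      rw [Finset.sum_range_succ, mul_add, ih]
      push_cast
      ring
  rw [h1, Finset.sum_sub_distrib, mul_sub]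
  linear_combination h2

theorem boson_vacuum_mem_energySpace (hn : 0 < n) (hq0 : q ≠ 0) (hq : 1 + q ^ 2 ≠ 0) {a : ℤ}
    (ha : a ≠ 0) (m : ℤ) : boson n q a (vacuum n q m) ∈ energySpace n q m (-(a * n)) := by
  rw [vacuum, boson_wedge hn hq0 hq ha (ground m) 0 _ (fun _ _ => rfl) le_rfl]
  refine Submodule.sum_mem _ fun k hk => ?_
  have h := wedge_mem_energySpace (n := n) (q := q)
    ((ground m).set k ((ground m).1 k - a * n)) (k + 1) fun j hj => by
      rw [TensorIndex.set_apply, if_neg (by omega)]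
      rfl
  convert h using 2
  rw [Finset.sum_range_succ, Finset.sum_eq_zero, TensorIndex.set_apply, if_pos rfl]
  · change _ = 0 + (m - (k : ℤ) - a * n - (m - (k : ℤ)))
    ring
  · intro j hj
    rw [TensorIndex.set_apply, if_neg (by have := Finset.mem_range.1 hj; omega)]
    exact sub_self _

/-- `B_a` lowers the energy by `a n`. -/
theorem boson_mem_energySpace (hn : 0 < n) (hq0 : q ≠ 0) (hq : 1 + q ^ 2 ≠ 0) {a : ℤ}
    (ha : a ≠ 0) {m d : ℤ} {v : TotalFock n q} (hv : v ∈ energySpace n q m d) :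
    boson n q a v ∈ energySpace n q m (d - a * n) := by
  have h := Submodule.mem_map_of_mem (f := boson n q a) hv
  rw [energySpace, Submodule.map_span] at h
  refine Submodule.span_le.2 ?_ h
  rintro _ ⟨_, ⟨W, m', h1, h2, rfl⟩, rfl⟩
  clear h hv v
  induction W generalizing m d with
  | nil =>
    simp only [List.length_nil, List.sum_nil] at h1 h2
    obtain rfl : m' = m := by simpa using h1
    obtain rfl : d = 0 := by linarith
    rw [zero_sub]
    exact boson_vacuum_mem_energySpace hn hq0 hq ha m'
  | cons l W ih =>
    simp only [List.length_cons, List.sum_cons] at h1 h2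
    push_cast at h1
    obtain ⟨m₁, rfl⟩ : ∃ m₁, m = m₁ + 1 := ⟨m - 1, by ring⟩
    have e := congrArg (fun f => f (wordProd (creation n q) W (vacuum n q m')))
      (boson_mul_creation hn hq0 hq ha l)
    simp only [Module.End.mul_apply, LinearMap.add_apply] at e
    rw [wordProd_cons, Module.End.mul_apply, e]
    have hE : 2 * W.sum + m' * (m' + 1) = m₁ * (m₁ + 1) + 2 * (d - l + (m₁ + 1)) := by
      linear_combination h2
    refine Submodule.add_mem _ ?_ ?_
    · refine creation_mem_energySpace l (ih (m := m₁) (d := d - l + (m₁ + 1)) (by omega) hE) ?_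
      ring
    · refine creation_mem_energySpace (d := d - l + (m₁ + 1)) _
        (Submodule.subset_span ⟨W, m', by omega, hE, rfl⟩) ?_
      ring

/-- A strictly decreasing word with letters above `m` has at least the sum of `m + 1, m + 2, …`. -/
theorem le_sum_of_pairwise {W : List ℤ} (hW : W.Pairwise (· > ·)) {m : ℤ} (h : ∀ x ∈ W, m < x) :
    (m + W.length) * (m + W.length + 1) - m * (m + 1) ≤ 2 * W.sum := by
  induction W with
  | nil => simp
  | cons x W ih =>
    have h1 := ih (List.pairwise_cons.1 hW).2 fun y hy => h y (by simp [hy])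
    have h2 := length_le_of_pairwise hW (L := m + 1) (H := x) fun y hy => ⟨h y hy, by
      rcases List.mem_cons.1 hy with rfl | hy
      · exact le_rfl
      · exact ((List.pairwise_cons.1 hW).1 y hy).le⟩
    have h3 := h x (by simp)
    simp only [List.length_cons, List.sum_cons] at h2 ⊢
    push_cast at h2 ⊢
    have h4 : m + (W.length + 1) ≤ x := by omega
    nlinarith

/-- A strictly decreasing word with letters up to `M` has at most the sum of `M, M - 1, …`. -/
theorem sum_le_of_pairwise {W : List ℤ} (hW : W.Pairwise (· > ·)) {M : ℤ} (h : ∀ x ∈ W, x ≤ M) :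
    2 * W.sum ≤ M * (M + 1) - (M - W.length) * (M - W.length + 1) := by
  induction W generalizing M with
  | nil => simp
  | cons x W ih =>
    have hx := h x (by simp)
    have h1 := ih (List.pairwise_cons.1 hW).2 (M := M - 1) fun y hy => by
      have := (List.pairwise_cons.1 hW).1 y hy
      omega
    simp only [List.length_cons, List.sum_cons]
    push_cast
    nlinarith

/-- The wedge of a word and a ground state is a combination of wedges of strictly decreasing words
and ground states whose labels lie below these words. -/
theorem wordProd_vacuum_mem_span (hn : 0 < n) (hq0 : q ≠ 0) (hq : 1 + q ^ 2 ≠ 0) (W : List ℤ)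
    (m : ℤ) : ∃ R : ℕ, wordProd (creation n q) W (vacuum n q m) ∈ Submodule.span K
      ((fun W' => wordProd (creation n q) W' (vacuum n q (m - R))) ''
        {W' | SameType n (W ++ fullWord (m - R) R) W' ∧ W'.Pairwise (· > ·) ∧
          ∀ x ∈ W', m - R < x}) := by
  obtain ⟨L, hL⟩ := exists_upper_bound (W.map (- ·))
  let R := (m + L + 1).toNat
  have hbd : ∀ x ∈ W ++ fullWord (m - R) R, m - R + 1 ≤ x := by
    intro x hx
    rcases List.mem_append.1 hx with hx | hx
    · have := hL (-x) (List.mem_map_of_mem hx)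
      omega
    · have := (mem_fullWord.1 hx).1
      omega
  refine ⟨R, ?_⟩
  have e : wordProd (creation n q) W (vacuum n q m) =
      wordProd (creation n q) (W ++ fullWord (m - R) R) (vacuum n q (m - R)) := by
    rw [wordProd_append, Module.End.mul_apply, wordProd_fullWord_vacuum, sub_add_cancel]
  have h := Submodule.mem_map_of_mem
    (f := (LinearMap.applyₗ (vacuum n q (m - R)) :
      Module.End K (TotalFock n q) →ₗ[K] TotalFock n q))
    ((creation_wedgeRelated (q := q) hn).wordProd_mem_span hn hq0 hq (W ++ fullWord (m - R) R))
  rw [Submodule.map_span, ← Set.image_comp] at h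
  rw [e]
  refine Submodule.span_mono ?_ h
  rintro _ ⟨W', ⟨h1, h2⟩, rfl⟩
  refine ⟨W', ⟨h1, h2, fun x hx => ?_⟩, rfl⟩
  have := h1.ge _ hbd x hx
  omega

theorem energySpace_le_span (hn : 0 < n) (hq0 : q ≠ 0) (hq : 1 + q ^ 2 ≠ 0) (m d : ℤ) :
    energySpace n q m d ≤ Submodule.span K {v | ∃ (W : List ℤ) (m' : ℤ), m' + W.length = m ∧
      2 * W.sum + m' * (m' + 1) = m * (m + 1) + 2 * d ∧ W.Pairwise (· > ·) ∧ (∀ x ∈ W, m' < x) ∧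
      v = wordProd (creation n q) W (vacuum n q m')} := by
  refine Submodule.span_le.2 ?_
  rintro _ ⟨W, m', h1, h2, rfl⟩
  obtain ⟨R, hR⟩ := wordProd_vacuum_mem_span (q := q) hn hq0 hq W m'
  refine Submodule.span_mono ?_ hR
  rintro _ ⟨W', ⟨h3, h4, h5⟩, rfl⟩
  refine ⟨W', m' - R, ?_, ?_, h4, h5, rfl⟩
  · rw [h3.length, List.length_append, length_fullWord]
    push_cast
    omega
  · rw [h3.sum, List.sum_append, mul_add, two_mul_sum_fullWord]
    linear_combination h2

/-- There are no vectors of negative energy. -/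
theorem energySpace_eq_bot (hn : 0 < n) (hq0 : q ≠ 0) (hq : 1 + q ^ 2 ≠ 0) {m d : ℤ} (hd : d < 0) :
    energySpace n q m d = ⊥ := by
  rw [eq_bot_iff]
  refine (energySpace_le_span hn hq0 hq m d).trans (Submodule.span_le.2 ?_)
  rintro _ ⟨W, m', h1, h2, h3, h4, rfl⟩
  have := le_sum_of_pairwise h3 h4
  rw [h1] at this
  omega

/-- Vectors of positive energy `d` are combinations of wedges which start with one of the labels
`m + 1, …, m + d`. -/
theorem energySpace_le_span_creation (hn : 0 < n) (hq0 : q ≠ 0) (hq : 1 + q ^ 2 ≠ 0) {m d : ℤ}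
    (hd : 0 < d) :
    energySpace n q m d ≤ Submodule.span K {v | ∃ (x : ℤ) (v' : TotalFock n q),
      m < x ∧ x ≤ m + d ∧ v = creation n q x v'} := by
  refine (energySpace_le_span hn hq0 hq m d).trans (Submodule.span_mono ?_)
  rintro _ ⟨W, m', h1, h2, h3, h4, rfl⟩
  cases W with
  | nil =>
    simp only [List.length_nil, List.sum_nil] at h1 h2
    obtain rfl : m' = m := by simpa using h1
    omega
  | cons x W =>
    refine ⟨x, wordProd (creation n q) W (vacuum n q m'), ?_, ?_, by
      rw [wordProd_cons, Module.End.mul_apply]⟩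
    -- if the first label is at most `m`, then all are, and the energy is not positive
    · by_contra hx
      have h5 := sum_le_of_pairwise h3 (M := m) fun y hy => by
        rcases List.mem_cons.1 hy with rfl | hy
        · omega
        · have := (List.pairwise_cons.1 h3).1 y hy
          omega
      have h6 : m - (x :: W).length = m' := by omega
      rw [h6] at h5
      linarith
    -- the other labels contribute at least the energy of a ground state
    · have h5 := le_sum_of_pairwise (List.pairwise_cons.1 h3).2 (m := m') fun y hy =>
        h4 y (by simp [hy])
      simp only [List.length_cons, List.sum_cons] at h1 h2
      push_cast at h1
      have h6 : m' + W.length = m - 1 := by omega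
      rw [h6] at h5
      linarith

/-- An endomorphism which commutes with the creation operators is determined by its values on
the ground states of charge below an arbitrary bound. -/
theorem eq_smul_one_of_vacuum {C : Module.End K (TotalFock n q)} {γ : K}
    (hC : ∀ l, Commute C (creation n q l))
    (hv : ∀ m₀ : ℤ, ∃ m, m ≤ m₀ ∧ C (vacuum n q m) = γ • vacuum n q m) : C = γ • 1 := by
  have hW : ∀ (W : List ℤ) (v : TotalFock n q), C v = γ • v →
      C (wordProd (creation n q) W v) = γ • wordProd (creation n q) W v := by
    intro W v hv
    induction W with
    | nil => exact hv
    | cons l W ih =>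
      have e := congrArg (fun f => f (wordProd (creation n q) W v)) (hC l).eq
      simp only [Module.End.mul_apply] at e
      rw [wordProd_cons, Module.End.mul_apply, e, ih, map_smul]
  refine total_end_ext n q fun m s => ?_
  obtain ⟨N, hN⟩ := Filter.eventually_atTop.1 s.2
  obtain ⟨m', hm', h⟩ := hv (m - N)
  obtain ⟨R, hR⟩ : ∃ R : ℕ, m - N = m' + R := ⟨(m - N - m').toNat, by omega⟩
  rw [exists_eq_wordProd_vacuum s N hN, hR, ← wordProd_fullWord_vacuum, LinearMap.smul_apply,
    Module.End.one_apply]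
  exact hW _ _ (hW _ _ h)

/-- The commutator commutes with the creation operators and changes the energy of a ground state by
`d ≠ 0`. For `d < 0` it annihilates the ground states, as there are no negative energies. For
`d > 0` the ground state of charge `m` is obtained from that of charge `m - d` by creating the
labels `m - d + 1, …, m`, and a vector of energy `d` over the latter ground state is a combination of
wedges which start with one of these labels; a product of all of them with a repetition vanishes. -/
theorem bosonComm_eq_zero (hn : 0 < n) (hq0 : q ≠ 0) (hq : 1 + q ^ 2 ≠ 0) {a b : ℤ} (ha : a ≠ 0)
    (hb : b ≠ 0) (hab : a + b ≠ 0) : bosonComm n q a b = 0 := by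
  have hmem : ∀ m, bosonComm n q a b (vacuum n q m) ∈ energySpace n q m (-((a + b) * n)) := by
    intro m
    have h0 : vacuum n q m ∈ energySpace n q m 0 :=
      Submodule.subset_span ⟨[], m, by simp, by simp, rfl⟩
    have h1 := boson_mem_energySpace hn hq0 hq ha (boson_mem_energySpace hn hq0 hq hb h0)
    have h2 := boson_mem_energySpace hn hq0 hq hb (boson_mem_energySpace hn hq0 hq ha h0)
    rw [show (0 : ℤ) - b * n - a * n = -((a + b) * n) by ring] at h1
    rw [show (0 : ℤ) - a * n - b * n = -((a + b) * n) by ring] at h2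
    exact Submodule.sub_mem _ h1 h2
  have hd : -((a + b) * n) ≠ 0 := neg_ne_zero.2 (mul_ne_zero hab (by exact_mod_cast hn.ne'))
  generalize -((a + b) * n) = d at hmem hd
  have hvac : ∀ m, bosonComm n q a b (vacuum n q m) = 0 := by
    intro m
    rcases lt_or_gt_of_ne hd with hd | hd
    · have := hmem m
      rwa [energySpace_eq_bot hn hq0 hq hd, Submodule.mem_bot] at this
    · obtain ⟨D, rfl⟩ : ∃ D : ℕ, d = D := ⟨d.toNat, by omega⟩
      rw [show m = m - D + D by ring, ← wordProd_fullWord_vacuum,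
        bosonComm_wordProd hn hq0 hq ha hb]
      refine (Submodule.span_le (p := LinearMap.ker
        (wordProd (creation n q) (fullWord (m - D) D)))).2 ?_
        (energySpace_le_span_creation hn hq0 hq hd (hmem (m - D)))
      rintro _ ⟨x, v, h1, h2, rfl⟩
      have h0 : wordProd (creation n q) (fullWord (m - D) D ++ [x]) = 0 := by
        refine (creation_wedgeRelated hn).wordProd_eq_zero hn hq0 hq (L := m - D + 1) (H := m)
          (fun y hy => ?_) ?_
        · rcases List.mem_append.1 hy with hy | hy
          · have := mem_fullWord.1 hy
            omega
          · rw [List.mem_singleton.1 hy]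
            omega
        · rw [List.length_append, length_fullWord, List.length_singleton]
          push_cast
          omega
      rw [wordProd_append, wordProd_cons, wordProd_nil, mul_one] at h0
      have := congrArg (fun f => f v) h0
      rwa [Module.End.mul_apply] at this
  have := eq_smul_one_of_vacuum (C := bosonComm n q a b) (γ := 0)
    (bosonComm_commute hn hq0 hq ha hb) fun m₀ => ⟨m₀, le_rfl, by rw [hvac, zero_smul]⟩
  rw [this, zero_smul]

end Energy

/-! ### Moving a label past a sea of one colour -/

section Crossing

/-- The word `x + (H - 1) n, …, x + n, x` with letters in arithmetic progression, called a sea of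
height `H`. -/
def apWord (n : ℕ) (x : ℤ) : ℕ → List ℤ
  | 0 => []
  | H + 1 => (x + H * n) :: apWord n x H

theorem mem_apWord {n : ℕ} {x y : ℤ} {H : ℕ} :
    y ∈ apWord n x H ↔ ∃ i : ℕ, i < H ∧ y = x + i * n := by
  induction H with
  | zero => simp [apWord]
  | succ H ih =>
    rw [apWord, List.mem_cons, ih]
    constructor
    · rintro (rfl | ⟨i, hi, rfl⟩)
      · exact ⟨H, by omega, rfl⟩
      · exact ⟨i, by omega, rfl⟩
    · rintro ⟨i, hi, rfl⟩
      rcases Nat.lt_succ_iff_lt_or_eq.1 hi with hi | rfl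
      · exact Or.inr ⟨i, hi, rfl⟩
      · exact Or.inl rfl

theorem length_apWord (n : ℕ) (x : ℤ) (H : ℕ) : (apWord n x H).length = H := by
  induction H with
  | zero => rfl
  | succ H ih => rw [apWord, List.length_cons, ih]

theorem apWord_succ_right (n : ℕ) (x : ℤ) (H : ℕ) :
    apWord n x (H + 1) = apWord n (x + n) H ++ [x] := by
  induction H with
  | zero => simp [apWord]
  | succ H ih =>
    rw [apWord, ih, apWord, List.cons_append]
    congr 1
    push_cast
    ring

theorem apWord_add (n : ℕ) (x : ℤ) (k H : ℕ) :
    apWord n x (k + H) = apWord n (x + k * n) H ++ apWord n x k := by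
  induction H with
  | zero => simp [apWord]
  | succ H ih =>
    rw [← add_assoc, apWord, ih, apWord, List.cons_append]
    congr 1
    push_cast
    ring

theorem dvd_of_mem_apWord {n : ℕ} {x y : ℤ} {H : ℕ} (h : y ∈ apWord n x H) : (n : ℤ) ∣ y - x := by
  obtain ⟨i, -, rfl⟩ := mem_apWord.1 h
  exact ⟨i, by ring⟩

variable {K A : Type*} [Field K] [Ring A] [Algebra K A] {n : ℕ} {q : K} {ψ : ℤ → A}

/-- Elements with labels of the same residue modulo `n` anticommute. -/
def SameColorAnti (n : ℕ) (ψ : ℤ → A) : Prop :=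
  ∀ l m : ℤ, (n : ℤ) ∣ l - m → ψ l * ψ m = -(ψ m * ψ l)

/-- Moving `ψ x` past a word of the same residue gives a sign. -/
theorem SameColorAnti.wordProd_mul (h : SameColorAnti n ψ) {x : ℤ} {W : List ℤ}
    (hW : ∀ y ∈ W, (n : ℤ) ∣ y - x) :
    wordProd ψ W * ψ x = (-1) ^ W.length * (ψ x * wordProd ψ W) := by
  induction W with
  | nil => simp [wordProd_nil]
  | cons y W ih =>
    have h1 := ih fun z hz => hW z (by simp [hz])
    have h2 := h y x (hW y (by simp))
    rw [wordProd_cons, mul_assoc, h1, List.length_cons, pow_succ]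
    have hc : Commute (ψ y) ((-1 : A) ^ W.length) :=
      ((Commute.neg_one_right (ψ y)).pow_right _)
    rw [← mul_assoc, hc.eq, mul_assoc, ← mul_assoc (ψ y), h2]
    simp only [mul_assoc, mul_neg, neg_mul, one_mul]

theorem SameColorAnti.mul_wordProd_eq_zero (h : SameColorAnti n ψ) (hsq : ∀ l, ψ l * ψ l = 0)
    {x : ℤ} {W : List ℤ} (hx : x ∈ W) (hW : ∀ y ∈ W, (n : ℤ) ∣ x - y) :
    ψ x * wordProd ψ W = 0 := by
  induction W with
  | nil => simp at hx
  | cons y W ih =>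
    rw [wordProd_cons, ← mul_assoc]
    rcases List.mem_cons.1 hx with rfl | hx
    · rw [hsq, zero_mul]
    · rw [h x y (hW y (by simp)), neg_mul, mul_assoc,
        ih hx fun z hz => hW z (by simp [hz]), mul_zero, neg_zero]

/-- One crossing: if all inner labels between `l` and `d` annihilate `Q`, then moving `ψ l` past
`ψ d` in front of `Q` produces only a scalar. -/
theorem WedgeRelated.cross_step (h : WedgeRelated n q ψ) (hn : 0 < n) (hq0 : q ≠ 0) {l d : ℤ}
    (hld : ¬ (n : ℤ) ∣ l - d) {f : K} {Q : A} (hQ : Q * ψ l = f • (ψ l * Q))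
    (hkill : ∀ y, (n : ℤ) ∣ y - d → min l d < y → y < max l d → ψ y * Q = 0) :
    ψ d * Q * ψ l = (f * (if l < d then -q⁻¹ else -q)) • (ψ l * (ψ d * Q)) := by
  have hne : l ≠ d := fun e => hld (by rw [e, sub_self]; exact dvd_zero _)
  obtain ⟨α, r, hr, -, hα, e⟩ := h.expand hn hq0 hne
  rw [hα hld] at e
  have hrQ : (r.sum fun p c => c • (ψ p.1 * ψ p.2)) * Q = 0 := by
    rw [Finsupp.sum, Finset.sum_mul]
    refine Finset.sum_eq_zero fun p hp => ?_
    obtain ⟨-, h2, h3, h4, h5⟩ := hr hp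
    rw [smul_mul_assoc, mul_assoc, hkill p.2 h2 (by omega) (by omega), mul_zero, smul_zero]
  have e2 := congrArg (fun z => (-q)⁻¹ • (z * Q)) e
  simp only [sub_mul, hrQ, sub_zero, smul_mul_assoc] at e2
  rw [smul_smul, inv_mul_cancel₀ (neg_ne_zero.2 hq0), one_smul, smul_smul] at e2
  rw [mul_assoc, hQ, mul_smul_comm, ← mul_assoc, e2, smul_smul, mul_assoc]
  congr 2
  split_ifs
  · rw [mul_one, inv_neg]
  · field_simp

/-- Moving `ψ l` to the left past a sea of equally coloured factors without gaps around `l`, of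
which `t` have a smaller and `u` a larger label. The larger ones are crossed
first, then the smaller ones, both in the order of their distance from `l`, so that the inner labels
of each crossing occur among the factors already crossed; this order is available since the factors
of a sea anticommute. -/
theorem WedgeRelated.cross_apWord (h : WedgeRelated n q ψ) (hn : 0 < n) (hq0 : q ≠ 0)
    (ha : SameColorAnti n ψ) (hsq : ∀ l, ψ l * ψ l = 0) (t u : ℕ) (x l : ℤ)
    (h1 : x + (t - 1) * n < l) (h2 : l < x + t * n) :
    wordProd ψ (apWord n x (t + u)) * ψ l =
      ((-q) ^ t * (-q⁻¹) ^ u) • (ψ l * wordProd ψ (apWord n x (t + u))) := by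
  have hn' : (0 : ℤ) < n := by exact_mod_cast hn
  have hdvd : ∀ i : ℤ, (n : ℤ) ∣ l - (x + i * n) → False := by
    rintro i ⟨c, hc⟩
    have e : l = x + (i + c) * n := by linear_combination hc
    rw [e] at h1 h2
    have h3 := lt_of_mul_lt_mul_right (show ((t : ℤ) - 1) * n < (i + c) * n by linarith) hn'.le
    have h4 := lt_of_mul_lt_mul_right (show (i + c) * n < (t : ℤ) * n by linarith) hn'.le
    omega
  have hmem : ∀ (x y : ℤ) (k : ℕ), (n : ℤ) ∣ y - x → x - n < y → y < x + k * n →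
      y ∈ apWord n x k := by
    rintro x y k ⟨c, hc⟩ h3 h4
    have e : y = x + c * n := by linear_combination hc
    subst e
    have h5 := lt_of_mul_lt_mul_right (show (-1 : ℤ) * n < c * n by linarith) hn'.le
    have h6 := lt_of_mul_lt_mul_right (show c * n < (k : ℤ) * n by linarith) hn'.le
    exact mem_apWord.2 ⟨c.toNat, by omega, by rw [Int.toNat_of_nonneg (by omega)]⟩
  have hkill : ∀ (x y : ℤ) (k : ℕ), (n : ℤ) ∣ y - x → x - n < y → y < x + k * n →
      ψ y * wordProd ψ (apWord n x k) = 0 := by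
    intro x y k h3 h4 h5
    refine ha.mul_wordProd_eq_zero hsq (hmem x y k h3 h4 h5) fun z hz => ?_
    have := dvd_sub h3 (dvd_of_mem_apWord hz)
    simpa using this
  induction t generalizing x with
  | zero =>
    simp only [Nat.cast_zero, zero_mul, add_zero, zero_sub, zero_add, pow_zero, one_mul] at *
    induction u with
    | zero => simp [apWord, wordProd_nil]
    | succ u ih =>
      have hlt : l < x + u * n := by
        have : (0 : ℤ) ≤ u * n := by positivity
        linarith
      have hs := h.cross_step hn hq0 (l := l) (d := x + u * n) (hdvd u) ih fun y h3 h4 h5 => by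
        rw [min_eq_left hlt.le] at h4
        rw [max_eq_right hlt.le] at h5
        refine hkill x y u ?_ (by linarith) h5
        have h6 : (n : ℤ) ∣ u * n := Dvd.intro_left _ rfl
        have := dvd_add h3 h6
        rwa [show y - (x + u * n) + u * n = y - x by ring] at this
      rw [if_pos hlt] at hs
      rw [apWord, wordProd_cons, hs, pow_succ]
  | succ t ih =>
    push_cast at h1 h2
    have h1' : x + n + (t - 1) * n < l := by linear_combination h1
    have h2' : l < x + n + t * n := by linear_combination h2
    have ih' := ih (x + n) h1' h2' fun i => by
      rw [show x + n + i * n = x + (i + 1) * n by ring]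
      exact hdvd (i + 1)
    have hlt : x < l := by
      have : (0 : ℤ) ≤ t * n := by positivity
      linarith
    have hs := h.cross_step hn hq0 (l := l) (d := x)
      (by simpa using hdvd 0) ih' fun y h3 h4 h5 => by
        rw [min_eq_right hlt.le] at h4
        rw [max_eq_left hlt.le] at h5
        refine hkill (x + n) y (t + u) ?_ (by linarith) ?_
        · have := dvd_sub h3 (dvd_refl (n : ℤ))
          rwa [show y - x - n = y - (x + n) by ring] at this
        · have : (0 : ℤ) ≤ u * n := by positivity
          push_cast
          linarith
    rw [if_neg (not_lt.2 hlt.le)] at hs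
    rw [show t + 1 + u = t + u + 1 by ring, apWord_succ_right, wordProd_append, wordProd_cons,
      wordProd_nil, mul_one, ha.wordProd_mul (x := x) (W := apWord n (x + n) (t + u))]
    · have hc : ∀ (k : ℕ) (z w : A), z * ((-1) ^ k * w) = (-1) ^ k * (z * w) := fun k z w => by
        rw [← mul_assoc, ((Commute.neg_one_right z).pow_right k).eq, mul_assoc]
      rw [mul_assoc, hs, mul_smul_comm, hc, pow_succ]
      congr 1
      ring
    · intro y hy
      have := dvd_add (dvd_of_mem_apWord hy) (dvd_refl (n : ℤ))
      rwa [show y - (x + n) + n = y - x by ring] at this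

end Crossing

/-! ### The least energy for a given colour content -/

section Sector

variable {K : Type*} [Field K] {n : ℕ} {q : K}

/-- Among the finite sets of integers above `M` with given numbers of elements in the residue
classes modulo `n`, a set that is closed under subtracting `n` has the least sum. -/
theorem sum_le_sum_of_closed (hn : 0 < n) {X Y : Finset ℤ} {M : ℤ} (hX : ∀ x ∈ X, M < x)
    (hY : ∀ y ∈ Y, M < y - n → y - n ∈ Y)
    (hcard : ∀ r : ZMod n, (X.filter fun x : ℤ => (x : ZMod n) = r).card =
      (Y.filter fun x : ℤ => (x : ZMod n) = r).card) :
    ∑ y ∈ Y, y ≤ ∑ x ∈ X, x := by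
  have : NeZero n := ⟨hn.ne'⟩
  have hn' : (0 : ℤ) < n := by exact_mod_cast hn
  rw [← Finset.sum_fiberwise X (fun x : ℤ => (x : ZMod n)) fun x => x,
    ← Finset.sum_fiberwise Y (fun x : ℤ => (x : ZMod n)) fun x => x]
  refine Finset.sum_le_sum fun r _ => ?_
  have hdown : ∀ (k : ℕ) (y : ℤ), y ∈ Y → M < y - k * n → y - k * n ∈ Y := by
    intro k
    induction k with
    | zero => intro y hy _; simpa using hy
    | succ k ih =>
      intro y hy h
      push_cast at h ⊢
      have h1 := ih y hy (by linarith)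
      have h2 := hY _ h1 (by linarith)
      rwa [show y - (k + 1) * n = y - k * n - n by ring]
  have hc := hcard r
  set X' := X.filter fun x : ℤ => (x : ZMod n) = r
  set Y' := Y.filter fun x : ℤ => (x : ZMod n) = r
  -- in each residue class `Y` is an initial segment, so that elements outside of `Y` are larger
  have hXY : ∀ x ∈ X' \ Y', ∀ y ∈ Y', y ≤ x := by
    intro x hx y hy
    rw [Finset.mem_sdiff, Finset.mem_filter] at hx
    by_contra hlt
    refine hx.2 (Finset.mem_filter.2 ⟨?_, hx.1.2⟩)
    have hr : ((y - x : ℤ) : ZMod n) = 0 := by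
      rw [Int.cast_sub, hx.1.2, (Finset.mem_filter.1 hy).2, sub_self]
    obtain ⟨c, hc⟩ := (ZMod.intCast_zmod_eq_zero_iff_dvd _ n).1 hr
    have hcpos : 0 < c := by
      by_contra hneg
      have : (n : ℤ) * c ≤ 0 := mul_nonpos_of_nonneg_of_nonpos hn'.le (by omega)
      omega
    have e : x = y - c.toNat * n := by
      rw [Int.toNat_of_nonneg hcpos.le]
      linear_combination -hc
    rw [e]
    refine hdown _ _ (Finset.mem_filter.1 hy).1 ?_
    rw [← e]
    exact hX x hx.1.1
  rw [← Finset.sum_inter_add_sum_sdiff X' Y', ← Finset.sum_inter_add_sum_sdiff Y' X',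
    Finset.inter_comm Y' X']
  refine add_le_add le_rfl ?_
  have hcd : (X' \ Y').card = (Y' \ X').card := by
    have h1 := Finset.card_sdiff_add_card_inter X' Y'
    have h2 := Finset.card_sdiff_add_card_inter Y' X'
    rw [Finset.inter_comm Y' X'] at h2
    omega
  rcases (Y' \ X').eq_empty_or_nonempty with he | hne
  · rw [he, Finset.card_empty, Finset.card_eq_zero] at hcd
    rw [he, hcd]
  · obtain ⟨t, ht, htmax⟩ := (Y' \ X').exists_max_image id hne
    calc ∑ y ∈ Y' \ X', y ≤ (Y' \ X').card • t :=
          Finset.sum_le_card_nsmul _ _ _ fun y hy => htmax y hy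
      _ = (X' \ Y').card • t := by rw [hcd]
      _ ≤ ∑ x ∈ X' \ Y', x := Finset.card_nsmul_le_sum _ _ _ fun x hx =>
          hXY x hx t (Finset.mem_sdiff.1 ht).1

theorem card_filter_residue {W : List ℤ} (hW : W.Nodup) (r : ZMod n) :
    (W.toFinset.filter fun x : ℤ => (x : ZMod n) = r).card =
      (W.map (Int.cast : ℤ → ZMod n)).count r := by
  have e : (W.toFinset.filter fun x : ℤ => (x : ZMod n) = r) =
      (W.filter ((· == r) ∘ (Int.cast : ℤ → ZMod n))).toFinset := by
    ext x
    simp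
  rw [e, List.count, List.countP_map, List.countP_eq_length_filter,
    List.toFinset_card_of_nodup (hW.filter _)]

/-- In the sector of a given colour content the energy is bounded below: a wedge with an energy
below that of a filled sea `Y` of the same colours vanishes. -/
theorem wordProd_vacuum_eq_zero (hn : 0 < n) (hq0 : q ≠ 0) (hq : 1 + q ^ 2 ≠ 0) {m : ℤ}
    {W Y : List ℤ} (hY : Y.Nodup) (hYm : ∀ y ∈ Y, m < y) (hYn : ∀ y ∈ Y, m < y - n → y - n ∈ Y)
    (hres : (W.map (Int.cast : ℤ → ZMod n)).Perm (Y.map Int.cast)) (hsum : W.sum < Y.sum) :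
    wordProd (creation n q) W (vacuum n q m) = 0 := by
  obtain ⟨R, hR⟩ := wordProd_vacuum_mem_span (q := q) hn hq0 hq W m
  have hn' : (0 : ℤ) < n := by exact_mod_cast hn
  -- compare with `Y`, extended by the labels of the ground state down to `m - R + 1`
  have he : {W' | SameType n (W ++ fullWord (m - R) R) W' ∧ W'.Pairwise (· > ·) ∧
      ∀ x ∈ W', m - R < x} = ∅ := by
    refine Set.eq_empty_of_forall_notMem ?_
    rintro W' ⟨h1, h2, h3⟩
    have hnd : W'.Nodup := h2.imp fun h => ne_of_gt h
    have hndY : (Y ++ fullWord (m - R) R).Nodup := by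
      refine List.Nodup.append hY (fullWord_nodup _ _) fun y hy hy' => ?_
      have h4 := hYm y hy
      have h5 := (mem_fullWord.1 hy').2
      omega
    have hle := sum_le_sum_of_closed hn (X := W'.toFinset)
      (Y := (Y ++ fullWord (m - R) R).toFinset) (M := m - R)
      (fun x hx => h3 x (List.mem_toFinset.1 hx)) ?_ ?_
    · have hsW : ∑ x ∈ W'.toFinset, x = W'.sum := by
        rw [List.sum_toFinset _ hnd, List.map_id'']
        exact fun _ => rfl
      have hsY : ∑ x ∈ (Y ++ fullWord (m - R) R).toFinset, x = (Y ++ fullWord (m - R) R).sum := by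
        rw [List.sum_toFinset _ hndY, List.map_id'']
        exact fun _ => rfl
      rw [hsW, hsY, h1.sum, List.sum_append, List.sum_append] at hle
      omega
    · intro y hy hlt
      rw [List.mem_toFinset, List.mem_append] at hy ⊢
      rcases hy with hy | hy
      · rcases lt_or_ge m (y - n) with h4 | h4
        · exact Or.inl (hYn y hy h4)
        · exact Or.inr (mem_fullWord.2 ⟨hlt, by omega⟩)
      · have := (mem_fullWord.1 hy).2
        exact Or.inr (mem_fullWord.2 ⟨hlt, by omega⟩)
    · intro r
      rw [card_filter_residue hnd, card_filter_residue hndY]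
      refine List.Perm.count_eq (h1.residues.trans ?_) r
      rw [List.map_append, List.map_append]
      exact hres.append_right _
  rwa [he, Set.image_empty, Submodule.span_empty, Submodule.mem_bot] at hR

/-- `B_a`, `a > 0`, annihilates a wedge if lowering the energy leads below that of the filled sea
of the same colours. -/
theorem boson_wordProd_vacuum_eq_zero (hn : 0 < n) (hq0 : q ≠ 0) (hq : 1 + q ^ 2 ≠ 0) {a : ℤ}
    (ha : 0 < a) {m : ℤ} {W Y : List ℤ} (hY : Y.Nodup) (hYm : ∀ y ∈ Y, m < y)
    (hYn : ∀ y ∈ Y, m < y - n → y - n ∈ Y)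
    (hres : (W.map (Int.cast : ℤ → ZMod n)).Perm (Y.map Int.cast))
    (hsum : W.sum - a * n < Y.sum) :
    boson n q a (wordProd (creation n q) W (vacuum n q m)) = 0 := by
  -- `P` is the part of the word that `B_a` has already passed
  have key : ∀ (S P : List ℤ), ((P ++ S).map (Int.cast : ℤ → ZMod n)).Perm (Y.map Int.cast) →
      (P ++ S).sum - a * n < Y.sum → wordProd (creation n q) P
        (boson n q a (wordProd (creation n q) S (vacuum n q m))) = 0 := by
    intro S
    induction S with
    | nil =>
      intro P _ _
      rw [wordProd_nil, Module.End.one_apply, boson_vacuum hn hq0 hq ha, map_zero]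
    | cons l S ih =>
      intro P h1 h2
      have e := congrArg (fun f => f (wordProd (creation n q) S (vacuum n q m)))
        (boson_mul_creation hn hq0 hq ha.ne' l)
      simp only [Module.End.mul_apply, LinearMap.add_apply] at e
      have e1 := ih (P ++ [l]) (by simpa using h1) (by simpa using h2)
      rw [wordProd_append, wordProd_cons, wordProd_nil, mul_one, Module.End.mul_apply] at e1
      have e2 := wordProd_vacuum_eq_zero (q := q) hn hq0 hq (W := P ++ (l - a * n) :: S) hY hYm hYn
        (by
          refine List.Perm.trans (List.Perm.of_eq ?_) h1
          simp) (by
          simp only [List.sum_append, List.sum_cons] at h2 ⊢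
          linarith)
      rw [wordProd_append, wordProd_cons, Module.End.mul_apply, Module.End.mul_apply] at e2
      rw [wordProd_cons, Module.End.mul_apply, e, map_add, e1, e2, add_zero]
  exact key W [] hres hsum

end Sector

/-! ### Words of filled seas -/

section Seas

variable {n : ℕ}

theorem nodup_apWord (hn : 0 < n) (x : ℤ) (H : ℕ) : (apWord n x H).Nodup := by
  have hn' : (0 : ℤ) < n := by exact_mod_cast hn
  induction H with
  | zero => exact List.nodup_nil
  | succ H ih =>
    refine List.nodup_cons.2 ⟨fun h => ?_, ih⟩
    obtain ⟨i, hi, e⟩ := mem_apWord.1 h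
    have h1 : (H : ℤ) * n = i * n := by linarith
    have h2 := mul_right_cancel₀ hn'.ne' h1
    omega

theorem map_cast_apWord (x : ℤ) (H : ℕ) :
    (apWord n x H).map (Int.cast : ℤ → ZMod n) = List.replicate H (x : ZMod n) := by
  induction H with
  | zero => rfl
  | succ H ih => rw [apWord, List.map_cons, ih, List.replicate_succ]; simp

theorem sum_apWord_add (x : ℤ) (H : ℕ) :
    (apWord n (x + n) H).sum = (apWord n x H).sum + H * n := by
  induction H with
  | zero => simp [apWord]
  | succ H ih =>
    rw [apWord, apWord, List.sum_cons, List.sum_cons, ih]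
    push_cast
    ring

/-- The seas of the colours `j ∈ L`: the sea of colour `j` consists of the first `H j` labels
`n b + j + 1, n b + j + 1 + n, …` above `n b` of this colour. -/
def seaWord (n : ℕ) (b : ℤ) (H : ℕ → ℕ) (L : List ℕ) : List ℤ :=
  L.flatMap fun j : ℕ => apWord n (n * b + j + 1) (H j)

theorem seaWord_nil (b : ℤ) (H : ℕ → ℕ) : seaWord n b H [] = [] := rfl

theorem seaWord_cons (b : ℤ) (H : ℕ → ℕ) (j : ℕ) (L : List ℕ) :
    seaWord n b H (j :: L) = apWord n (n * b + j + 1) (H j) ++ seaWord n b H L := rfl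

theorem seaWord_append (b : ℤ) (H : ℕ → ℕ) (L L' : List ℕ) :
    seaWord n b H (L ++ L') = seaWord n b H L ++ seaWord n b H L' :=
  List.flatMap_append

theorem seaWord_congr (b : ℤ) {H H' : ℕ → ℕ} {L : List ℕ} (h : ∀ k ∈ L, H k = H' k) :
    seaWord n b H L = seaWord n b H' L := by
  induction L with
  | nil => rfl
  | cons j L ih =>
    rw [seaWord_cons, seaWord_cons, h j (by simp), ih fun k hk => h k (by simp [hk])]

theorem mem_seaWord {b : ℤ} {H : ℕ → ℕ} {L : List ℕ} {y : ℤ} :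
    y ∈ seaWord n b H L ↔ ∃ j ∈ L, ∃ i : ℕ, i < H j ∧ y = n * b + j + 1 + i * n := by
  simp only [seaWord, List.mem_flatMap, mem_apWord]

theorem nodup_seaWord (hn : 0 < n) (b : ℤ) (H : ℕ → ℕ) {L : List ℕ} (hL : L.Nodup)
    (hLn : ∀ k ∈ L, k < n) : (seaWord n b H L).Nodup := by
  refine List.nodup_flatMap.2 ⟨fun j _ => nodup_apWord hn _ _, ?_⟩
  refine List.Pairwise.imp_of_mem ?_ hL
  intro j k hj hk hjk y hy hy'
  have h1 := dvd_sub (dvd_of_mem_apWord hy') (dvd_of_mem_apWord hy)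
  rw [show y - (n * b + k + 1) - (y - (n * b + j + 1)) = (j : ℤ) - k by ring] at h1
  have hj' := hLn j hj
  have hk' := hLn k hk
  have h2 := Int.eq_zero_of_abs_lt_dvd h1 (by rw [abs_lt]; omega)
  omega

theorem lt_of_mem_seaWord {b : ℤ} {H : ℕ → ℕ} {L : List ℕ} {y : ℤ} (hy : y ∈ seaWord n b H L) :
    n * b < y := by
  obtain ⟨j, -, i, -, rfl⟩ := mem_seaWord.1 hy
  have : (0 : ℤ) ≤ i * n := by positivity
  omega

theorem sub_mem_seaWord {b : ℤ} {H : ℕ → ℕ} {L : List ℕ} (hLn : ∀ k ∈ L, k < n) {y : ℤ}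
    (hy : y ∈ seaWord n b H L) (h : n * b < y - n) : y - n ∈ seaWord n b H L := by
  obtain ⟨j, hj, i, hi, rfl⟩ := mem_seaWord.1 hy
  refine mem_seaWord.2 ⟨j, hj, i - 1, by omega, ?_⟩
  rcases i with _ | i
  · have := hLn j hj
    simp only [Nat.cast_zero, zero_mul] at h
    omega
  · push_cast
    ring

end Seas

/-! ### Moving a label past several seas -/

section CrossSeas

variable {K A : Type*} [Field K] [Ring A] [Algebra K A] {n : ℕ} {q : K} {ψ : ℤ → A}

/-- The factor for moving a label to the left past a sea of another colour and of height `H`, if `t`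
labels of the sea are smaller. -/
def crossFactor (q : K) (t H : ℕ) : K := (-q) ^ t * (-q⁻¹) ^ (H - t)

theorem crossFactor_ne_zero (hq0 : q ≠ 0) (t H : ℕ) : crossFactor q t H ≠ 0 :=
  mul_ne_zero (pow_ne_zero _ (neg_ne_zero.2 hq0))
    (pow_ne_zero _ (neg_ne_zero.2 (inv_ne_zero hq0)))

/-- Raising the label by `a` levels within the sea multiplies the factor by `q ^ (2 a)`. This is the
source of the powers of `q` in `[B_a, B_{-a}]`. -/
theorem crossFactor_add (hq0 : q ≠ 0) {t a H : ℕ} (h : t + a ≤ H) :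
    crossFactor q (t + a) H = q ^ (2 * a) * crossFactor q t H := by
  obtain ⟨u, rfl⟩ := Nat.exists_eq_add_of_le h
  rw [crossFactor, crossFactor, show t + a + u - (t + a) = u by omega,
    show t + a + u - t = a + u by omega, pow_add, pow_add, pow_mul]
  have e : (-q) ^ a = (q ^ 2) ^ a * (-q⁻¹) ^ a := by
    rw [← mul_pow]
    congr 1
    field_simp
  rw [e]
  ring

/-- Moving the label of colour `j` and level `i` to the left past the seas of other colours, which
must not end below this level. At level `i` there are `i + 1` smaller labels of a colour `k < j` and
`i` smaller labels of a colour `k > j`. -/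
theorem WedgeRelated.cross_seaWord (h : WedgeRelated n q ψ) (hn : 0 < n) (hq0 : q ≠ 0)
    (ha : SameColorAnti n ψ) (hsq : ∀ l, ψ l * ψ l = 0) (b : ℤ) {H : ℕ → ℕ} {L : List ℕ}
    {j i : ℕ} (hL : ∀ k ∈ L, k < n) (hj : j < n) (hjL : j ∉ L)
    (ht : ∀ k ∈ L, (if k < j then i + 1 else i) ≤ H k) :
    wordProd ψ (seaWord n b H L) * ψ (n * b + j + 1 + i * n) =
      (L.map fun k => crossFactor q (if k < j then i + 1 else i) (H k)).prod •
        (ψ (n * b + j + 1 + i * n) * wordProd ψ (seaWord n b H L)) := by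
  induction L with
  | nil => simp [seaWord_nil, wordProd_nil]
  | cons k L ih =>
    have ih' := ih (fun k hk => hL k (by simp [hk])) (fun hj => hjL (by simp [hj]))
      fun k hk => ht k (by simp [hk])
    have hk := hL k (by simp)
    have hkj : j ≠ k := fun e => hjL (by simp [e])
    have htk := ht k (by simp)
    have hs := h.cross_apWord hn hq0 ha hsq (if k < j then i + 1 else i)
      (H k - if k < j then i + 1 else i) (n * b + k + 1) (n * b + j + 1 + i * n)
      (by
        split_ifs with hlt
        · push_cast
          linarith [show (k : ℤ) < j by exact_mod_cast hlt]
        · linarith [show (k : ℤ) < n by exact_mod_cast hk, show (0 : ℤ) ≤ j by positivity])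
      (by
        split_ifs with hlt
        · push_cast
          linarith [show (j : ℤ) < n by exact_mod_cast hj, show (0 : ℤ) ≤ k by positivity]
        · linarith [show (j : ℤ) < k by omega])
    rw [Nat.add_sub_cancel' htk] at hs
    change _ = crossFactor q _ _ • _ at hs
    rw [seaWord_cons, wordProd_append, mul_assoc, ih', mul_smul_comm, ← mul_assoc, hs,
      List.map_cons, List.prod_cons, smul_mul_assoc, smul_smul, mul_comm (List.prod _),
      mul_assoc (ψ _)]

end CrossSeas

/-! ### `B_a B_{-a}` on a single sea -/

section Norm

variable {K : Type*} [Field K] {n : ℕ} {q : K}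

/-- Creation operators of the same colour anticommute, although the defining relation of such a pair
has inner terms. -/
theorem creation_sameColorAnti (hn : 0 < n) (hq0 : q ≠ 0) (hq : 1 + q ^ 2 ≠ 0) :
    SameColorAnti n (creation n q) := by
  have hsq := (creation_wedgeRelated (q := q) hn).mul_self hq
  rintro l m ⟨c, hc⟩
  obtain rfl | hc0 := eq_or_ne c 0
  · obtain rfl : l = m := by simpa [sub_eq_zero] using hc
    rw [hsq, neg_zero]
  have e : m = l - c * n := by linear_combination -hc
  subst e
  -- the commutator of `B_c` with `ψ_l ψ_l = 0`
  have h := boson_mul_creation hn hq0 hq hc0 l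
  have h2 : boson n q c * (creation n q l * creation n q l) =
      (creation n q l * creation n q l) * boson n q c +
        (creation n q (l - c * n) * creation n q l +
          creation n q l * creation n q (l - c * n)) := by
    rw [← mul_assoc, h, add_mul, mul_assoc, h, mul_add]
    simp only [mul_assoc]
    abel
  rw [hsq, mul_zero, zero_mul, zero_add] at h2
  exact eq_neg_of_add_eq_zero_right h2.symm

/-- `B_{-a}` acts on a sea by raising one label after the other. -/
theorem boson_neg_mul_apWord (hn : 0 < n) (hq0 : q ≠ 0) (hq : 1 + q ^ 2 ≠ 0) {a : ℕ} (ha : 0 < a)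
    (x : ℤ) (H : ℕ) :
    boson n q (-a) * wordProd (creation n q) (apWord n x H) =
      wordProd (creation n q) (apWord n x H) * boson n q (-a) +
        ∑ h ∈ Finset.range H,
          wordProd (creation n q) (apWord n (x + (h + 1 : ℕ) * n) (H - (h + 1))) *
          creation n q (x + (h + a : ℕ) * n) * wordProd (creation n q) (apWord n x h) := by
  induction H with
  | zero => simp [apWord, wordProd_nil]
  | succ H ih =>
    have hb := boson_mul_creation (q := q) hn hq0 hq (a := -a) (by omega) (x + H * n)
    rw [Finset.sum_range_succ, apWord, wordProd_cons, ← mul_assoc, hb, add_mul, mul_assoc, ih,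
      mul_add, Nat.sub_self, apWord, wordProd_nil, one_mul,
      show x + H * n - -(a : ℤ) * n = x + (H + a : ℕ) * n by push_cast; ring, Finset.mul_sum,
      ← mul_assoc, add_assoc]
    congr 2
    refine Finset.sum_congr rfl fun h hh => ?_
    have hh' := Finset.mem_range.1 hh
    rw [show H + 1 - (h + 1) = H - (h + 1) + 1 by omega, apWord, wordProd_cons, mul_assoc,
      mul_assoc,
      mul_assoc,
      show x + (h + 1 : ℕ) * n + (H - (h + 1) : ℕ) * n = x + H * n by
        rw [Nat.cast_sub (by omega)]; push_cast; ring]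

/-- The part of `B_a B_{-a}` applied to a wedge with a sea in which both operators act on the sea:
the raised label is moved to the front, past `P`, lowered there and moved back. Only the upper `a`
labels of the sea can be raised; each contributes the ratio `c` of the factors at the two levels. -/
theorem boson_raised_sea (hn : 0 < n) (hq0 : q ≠ 0) (hq : 1 + q ^ 2 ≠ 0) {a : ℕ} (ha : 0 < a)
    {x : ℤ} {H : ℕ} (haH : a ≤ H) {P : Module.End K (TotalFock n q)} {z : TotalFock n q} {F : ℕ → K}
    {c : K}
    (hP : ∀ h, h < H + a →
      P * creation n q (x + h * n) = F h • (creation n q (x + h * n) * P))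
    (hF : ∀ h, h < H → F (h + a) = c * F h)
    (hkill : ∀ h, h < H → H ≤ h + a → boson n q a (P (wordProd (creation n q)
      (apWord n (x + (h + 1 : ℕ) * n) (H - (h + 1)) ++ apWord n x h) z)) = 0) :
    boson n q a (P ((∑ h ∈ Finset.range H,
      wordProd (creation n q) (apWord n (x + (h + 1 : ℕ) * n) (H - (h + 1))) *
          creation n q (x + (h + a : ℕ) * n) * wordProd (creation n q) (apWord n x h)) z)) =
      (a * c) • P (wordProd (creation n q) (apWord n x H) z) := by
  have hsq := (creation_wedgeRelated (q := q) hn).mul_self hq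
  have hanti := creation_sameColorAnti (q := q) hn hq0 hq
  have hdvd : ∀ (h i k : ℕ), ∀ y ∈ apWord n (x + (h : ℤ) * n) k,
      (n : ℤ) ∣ y - (x + (i : ℤ) * n) := by
    intro h i k y hy
    have h1 := dvd_add (dvd_of_mem_apWord hy) (Dvd.intro_left ((h : ℤ) - i) rfl)
    rwa [show y - (x + h * n) + (h - i) * n = y - (x + (i : ℤ) * n) by ring] at h1
  -- moving the label of level `i` within the sea
  have hmove : ∀ h i : ℕ, wordProd (creation n q) (apWord n (x + (h + 1 : ℕ) * n) (H - (h + 1))) *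
      creation n q (x + (i : ℕ) * n) = (-1) ^ (H - (h + 1)) * (creation n q (x + (i : ℕ) * n) *
        wordProd (creation n q) (apWord n (x + (h + 1 : ℕ) * n) (H - (h + 1)))) := by
    intro h i
    rw [hanti.wordProd_mul (hdvd _ _ _), length_apWord]
  -- the levels below `H - a` contribute `0`, the `a` levels from `H - a` on contribute equally
  rw [LinearMap.sum_apply, map_sum, map_sum, ← Finset.sum_range_add_sum_Ico _ (Nat.sub_le H a),
    Finset.sum_eq_zero, zero_add, Finset.sum_congr rfl
      (g := fun _ => c • P (wordProd (creation n q) (apWord n x H) z)), Finset.sum_const,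
    Nat.card_Ico, Nat.sub_sub_self haH, ← Nat.cast_smul_eq_nsmul K, smul_smul]
  · intro h hh
    rw [Finset.mem_Ico] at hh
    have hB := boson_mul_creation (q := q) hn hq0 hq (a := a) (by omega) (x + (h + a : ℕ) * n)
    rw [show x + (h + a : ℕ) * n - (a : ℤ) * n = x + (h : ℕ) * n by push_cast; ring] at hB
    -- `R` omits the label of level `h`
    set R := P * (wordProd (creation n q) (apWord n (x + (h + 1 : ℕ) * n) (H - (h + 1))) *
      wordProd (creation n q) (apWord n x h)) with hR
    have hback : ∀ i : ℕ, i < H + a →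
        P * (wordProd (creation n q) (apWord n (x + (h + 1 : ℕ) * n) (H - (h + 1))) *
          creation n q (x + (i : ℕ) * n) * wordProd (creation n q) (apWord n x h)) =
        ((-1) ^ (H - (h + 1)) * F i) • (creation n q (x + (i : ℕ) * n) * R) := by
      intro i hi
      have e1 : ((-1) ^ (H - (h + 1)) : Module.End K (TotalFock n q)) =
          ((-1) ^ (H - (h + 1)) : K) • 1 := by
        rw [← Algebra.algebraMap_eq_smul_one]
        simp
      rw [hmove, e1, smul_mul_assoc, one_mul, smul_mul_assoc, mul_smul_comm, mul_assoc, ← mul_assoc,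
        hP i hi, smul_mul_assoc, smul_smul, mul_assoc]
    have hkill' : boson n q a (R z) = 0 := by
      have := hkill h hh.2 (by omega)
      rw [wordProd_append] at this
      exact this
    clear_value R
    have e2 : boson n q a (creation n q (x + (h + a : ℕ) * n) (R z)) =
        creation n q (x + (h : ℕ) * n) (R z) := by
      have := congrArg (fun f => f (R z)) hB
      simp only [Module.End.mul_apply, LinearMap.add_apply] at this
      rw [this, hkill', map_zero, zero_add]
    have e3 : wordProd (creation n q) (apWord n x H) =
        wordProd (creation n q) (apWord n (x + (h + 1 : ℕ) * n) (H - (h + 1))) *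
          creation n q (x + (h : ℕ) * n) * wordProd (creation n q) (apWord n x h) := by
      have : H = (h + 1) + (H - (h + 1)) := by omega
      conv_lhs => rw [this, apWord_add, apWord, wordProd_append, wordProd_cons, ← mul_assoc]
    rw [← Module.End.mul_apply P, hback _ (by omega), ← Module.End.mul_apply P, e3,
      hback _ (by omega), LinearMap.smul_apply, LinearMap.smul_apply, map_smul,
      Module.End.mul_apply, Module.End.mul_apply, e2, hF h hh.2, smul_smul]
    congr 1
    ring
  · intro h hh
    rw [Finset.mem_range] at hh
    -- the raised label still occurs in the sea
    have h0 : creation n q (x + (h + a : ℕ) * n) *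
        wordProd (creation n q) (apWord n (x + (h + 1 : ℕ) * n) (H - (h + 1))) = 0 := by
      refine hanti.mul_wordProd_eq_zero hsq (mem_apWord.2 ⟨a - 1, by omega, ?_⟩) fun y hy => ?_
      · rw [Nat.cast_sub (by omega)]
        push_cast
        ring
      · rw [← dvd_neg, neg_sub]
        exact hdvd _ _ _ y hy
    rw [hmove, h0, mul_zero, zero_mul, LinearMap.zero_apply, map_zero, map_zero]

end Norm

/-! ### Filled seas as eigenvectors of `[B_a, B_{-a}]` -/

section Eigenvalue

variable {n : ℕ}

theorem range_eq_append_cons {j k : ℕ} (h : j + (k + 1) = n) :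
    List.range n = List.range j ++ j :: List.range' (j + 1) k := by
  rw [← h, List.range_eq_range', List.range_eq_range', ← List.range'_append_1, zero_add,
    List.range'_succ]

theorem seaWord_update (b : ℤ) (H : ℕ → ℕ) (c : ℕ) {j k : ℕ} (h : j + (k + 1) = n) :
    seaWord n b (Function.update H j c) (List.range n) = seaWord n b H (List.range j) ++
      (apWord n (n * b + j + 1) c ++ seaWord n b H (List.range' (j + 1) k)) := by
  rw [range_eq_append_cons h, seaWord_append, seaWord_cons, Function.update_self]
  congr 1
  · exact seaWord_congr b fun i hi =>
      Function.update_of_ne (List.mem_range.1 hi).ne _ _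
  · congr 1
    refine seaWord_congr b fun i hi => Function.update_of_ne ?_ _ _
    have := (List.mem_range'_1.1 hi).1
    omega

theorem seaWord_range (b : ℤ) (H : ℕ → ℕ) {j k : ℕ} (h : j + (k + 1) = n) :
    seaWord n b H (List.range n) = seaWord n b H (List.range j) ++
      (apWord n (n * b + j + 1) (H j) ++ seaWord n b H (List.range' (j + 1) k)) := by
  rw [← seaWord_update b H (H j) h, Function.update_eq_self]

variable {K : Type*} [Field K] {q : K}

/-- The seas annihilate `B_{-a}` of the vacuum: every label that `B_{-a}` can add is a label of one
of the seas. -/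
theorem seaWord_boson_neg_vacuum (hn : 0 < n) (hq0 : q ≠ 0) (hq : 1 + q ^ 2 ≠ 0) {a : ℕ}
    (ha : 0 < a) (b : ℤ) {H : ℕ → ℕ} (hH : ∀ k < n, a ≤ H k) :
    wordProd (creation n q) (seaWord n b H (List.range n))
      (boson n q (-a) (vacuum n q (n * b))) = 0 := by
  have hrel := creation_wedgeRelated (q := q) hn
  have hsq := hrel.mul_self hq
  have hanti := creation_sameColorAnti (q := q) hn hq0 hq
  have hn' : (0 : ℤ) < n := by exact_mod_cast hn
  have h1 := boson_vacuum_mem_energySpace (q := q) hn hq0 hq (a := -a) (by omega) (n * b)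
  have h2 := energySpace_le_span_creation (q := q) hn hq0 hq
    (show (0 : ℤ) < -(-(a : ℤ) * n) by
      have : (0 : ℤ) < a * n := by positivity
      linarith) h1
  refine Submodule.span_induction (p := fun z _ => wordProd (creation n q)
    (seaWord n b H (List.range n)) z = 0) ?_ (map_zero _) ?_ ?_ h2
  · rintro _ ⟨x, v', h3, h4, rfl⟩
    -- level `i` and colour `j` of the label `x`
    obtain ⟨i, hi⟩ := Int.eq_ofNat_of_zero_le
      (show 0 ≤ (x - n * b - 1) / n from Int.ediv_nonneg (by omega) hn'.le)
    obtain ⟨j, hj⟩ := Int.eq_ofNat_of_zero_le (Int.emod_nonneg (x - n * b - 1) hn'.ne')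
    have hjn : j < n := by
      have := Int.emod_lt_of_pos (x - n * b - 1) hn'
      omega
    have hx : x = n * b + j + 1 + i * n := by
      have := Int.emod_add_mul_ediv (x - n * b - 1) n
      rw [hi, hj] at this
      linarith
    have hia : i < a := by
      have h5 : (i : ℤ) * n < a * n := by linarith
      have h6 := lt_of_mul_lt_mul_right h5 hn'.le
      omega
    obtain ⟨k, hk⟩ := Nat.exists_eq_add_of_lt hjn
    have hcross := hrel.cross_seaWord hn hq0 hanti hsq b (H := H) (L := List.range' (j + 1) k)
      (j := j) (i := i) (fun l hl => by have := List.mem_range'_1.1 hl; omega) hjn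
      (fun hl => by have := List.mem_range'_1.1 hl; omega) fun l hl => by
        have := List.mem_range'_1.1 hl
        have := hH l (by omega)
        rw [if_neg (by omega)]
        omega
    have hz : wordProd (creation n q) (apWord n (n * b + j + 1) (H j)) *
        creation n q (n * b + j + 1 + i * n) = 0 := by
      have hd : ∀ y ∈ apWord n (n * b + j + 1) (H j), (n : ℤ) ∣ y - (n * b + j + 1 + i * n) := by
        intro y hy
        have := dvd_sub (dvd_of_mem_apWord hy) (Dvd.intro_left (i : ℤ) rfl)
        rwa [sub_sub] at this
      have := hH j hjn
      rw [hanti.wordProd_mul hd, hanti.mul_wordProd_eq_zero hsq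
        (mem_apWord.2 ⟨i, by omega, rfl⟩) fun y hy => by
          rw [← dvd_neg, neg_sub]
          exact hd y hy, mul_zero]
    have h0 : wordProd (creation n q) (seaWord n b H (List.range n)) * creation n q x = 0 := by
      rw [seaWord_range b H (show j + (k + 1) = n by omega), wordProd_append, wordProd_append, hx,
        mul_assoc, mul_assoc, hcross, mul_smul_comm, ← mul_assoc (wordProd _ (apWord _ _ _)), hz,
        zero_mul, smul_zero, mul_zero]
    exact congrArg (fun f => f v') h0
  · intro y z _ _ hy hz
    rw [map_add, hy, hz, add_zero]
  · intro c y _ hy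
    rw [map_smul, hy, smul_zero]

/-- The seas with heights that drop by at least `a` from colour to colour form an eigenvector of
`[B_a, B_{-a}]`. -/
theorem bosonComm_seas (hn : 0 < n) (hq0 : q ≠ 0) (hq : 1 + q ^ 2 ≠ 0) {a : ℕ} (ha : 0 < a) (b : ℤ)
    {H : ℕ → ℕ} (hHa : ∀ k < n, a ≤ H k) (hst : ∀ k j, k < j → j < n → H j + a ≤ H k) :
    bosonComm n q a (-a) (wordProd (creation n q) (seaWord n b H (List.range n))
      (vacuum n q (n * b))) = (∑ j ∈ Finset.range n, (a : K) * q ^ (2 * a * j)) •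
        wordProd (creation n q) (seaWord n b H (List.range n)) (vacuum n q (n * b)) := by
  have hrel := creation_wedgeRelated (q := q) hn
  have hsq := hrel.mul_self hq
  have hanti := creation_sameColorAnti (q := q) hn hq0 hq
  -- the seas have the least energy for their colours, so that only `B_a B_{-a}` contributes
  have hlow : boson n q a (wordProd (creation n q) (seaWord n b H (List.range n))
      (vacuum n q (n * b))) = 0 := by
    refine boson_wordProd_vacuum_eq_zero hn hq0 hq (by omega)
      (nodup_seaWord hn b H List.nodup_range fun k hk => List.mem_range.1 hk)
      (fun y => lt_of_mem_seaWord) (fun y => sub_mem_seaWord fun k hk => List.mem_range.1 hk)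
      (List.Perm.refl _) ?_
    have : (0 : ℤ) < a * n := by positivity
    linarith
  -- `B_{-a}` has passed the seas of the colours below `j`
  have key : ∀ k j, j + k = n →
      boson n q a (wordProd (creation n q) (seaWord n b H (List.range j)) (boson n q (-a)
        (wordProd (creation n q) (seaWord n b H (List.range' j k)) (vacuum n q (n * b))))) =
      (∑ i ∈ Finset.Ico j n, (a : K) * q ^ (2 * a * i)) •
        wordProd (creation n q) (seaWord n b H (List.range n)) (vacuum n q (n * b)) := by
    intro k
    induction k with
    | zero =>
      intro j hj
      obtain rfl : j = n := hj
      rw [List.range'_zero, seaWord_nil, wordProd_nil, Module.End.one_apply,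
        seaWord_boson_neg_vacuum hn hq0 hq ha b hHa, map_zero, Finset.Ico_self, Finset.sum_empty,
        zero_smul]
    | succ k ih =>
      intro j hj
      have ih' := ih (j + 1) (by omega)
      have e1 := congrArg (fun f => f (wordProd (creation n q)
        (seaWord n b H (List.range' (j + 1) k)) (vacuum n q (n * b))))
        (boson_neg_mul_apWord hn hq0 hq ha (n * b + j + 1) (H j))
      simp only [Module.End.mul_apply (boson n q (-a)), Module.End.mul_apply _ (boson n q (-a)),
        LinearMap.add_apply] at e1
      rw [List.range'_succ, seaWord_cons, wordProd_append, Module.End.mul_apply, e1, map_add,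
        map_add]
      rw [List.range_succ, seaWord_append, seaWord_cons, seaWord_nil, List.append_nil,
        wordProd_append, Module.End.mul_apply] at ih'
      rw [ih', boson_raised_sea hn hq0 hq ha (hHa j (by omega)) (c := q ^ (2 * a * j))
        (F := fun h => ((List.range j).map fun k =>
          crossFactor q (if k < j then h + 1 else h) (H k)).prod),
        seaWord_range b H hj, wordProd_append, wordProd_append, Module.End.mul_apply,
        Module.End.mul_apply, ← add_smul, add_comm,
        ← Finset.sum_eq_sum_Ico_succ_bot (show j < n by omega) fun i => (a : K) * q ^ (2 * a * i)]
      · intro h hh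
        refine hrel.cross_seaWord hn hq0 hanti hsq b (fun i hi => ?_) (by omega) (by simp)
          fun i hi => ?_
        · have := List.mem_range.1 hi
          omega
        · have hi := List.mem_range.1 hi
          have := hst i j hi (by omega)
          rw [if_pos hi]
          omega
      · intro h hh
        have e2 : (List.range j).map (fun k =>
            crossFactor q (if k < j then h + a + 1 else h + a) (H k)) =
            (List.range j).map fun k =>
              q ^ (2 * a) * crossFactor q (if k < j then h + 1 else h) (H k) := by
          refine List.map_congr_left fun i hi => ?_
          have hi := List.mem_range.1 hi
          have := hst i j hi (by omega)
          rw [if_pos hi, if_pos hi, ← crossFactor_add hq0 (by omega)]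
          congr 1
          omega
        rw [e2, List.prod_map_mul, List.map_const', List.prod_replicate,
          List.length_range, ← pow_mul]
      · intro h hh hha
        rw [show ∀ (W₁ W₂ W₃ : List ℤ) (v : TotalFock n q), wordProd (creation n q) W₁
            (wordProd (creation n q) W₂ (wordProd (creation n q) W₃ v)) =
              wordProd (creation n q) (W₁ ++ (W₂ ++ W₃)) v from fun W₁ W₂ W₃ v => by
          rw [wordProd_append, wordProd_append]; rfl]
        refine boson_wordProd_vacuum_eq_zero hn hq0 hq (by omega)
          (nodup_seaWord hn b (Function.update H j (H j - 1)) List.nodup_range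
            fun k hk => List.mem_range.1 hk)
          (fun y => lt_of_mem_seaWord) (fun y => sub_mem_seaWord fun k hk => List.mem_range.1 hk)
          ?_ ?_
        · rw [seaWord_update b H _ hj]
          simp only [List.map_append, map_cast_apWord]
          refine List.Perm.of_eq ?_
          push_cast
          simp only [CharP.cast_eq_zero, mul_zero, add_zero, ← List.replicate_add]
          rw [show H j - (h + 1) + h = H j - 1 by omega]
        -- compare with the seas in which that of colour `j` has lost its top label
        · have e3 : H j - 1 = h + (H j - (h + 1)) := by omega
          rw [seaWord_update b H _ hj, e3, apWord_add]
          have e4 := sum_apWord_add (n := n) (n * b + j + 1 + h * n) (H j - (h + 1))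
          rw [show (n * b + j + 1 + h * n + n : ℤ) = n * b + j + 1 + (h + 1 : ℕ) * n by
            push_cast; ring] at e4
          simp only [List.sum_append]
          rw [e4]
          have hlt : ((H j - (h + 1) : ℕ) : ℤ) < a := by omega
          have := mul_lt_mul_of_pos_right hlt (show (0 : ℤ) < n by omega)
          linarith
  have h0 := key n 0 (by omega)
  rw [List.range_zero, seaWord_nil, wordProd_nil, Module.End.one_apply, ← List.range_eq_range',
    ← Finset.range_eq_Ico] at h0
  rw [bosonComm, LinearMap.sub_apply, Module.End.mul_apply, Module.End.mul_apply, hlow, map_zero,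
    sub_zero, h0]

end Eigenvalue

/-! ### From seas to ground states -/

section Transport

variable {K : Type*} [Field K] {n : ℕ} {q : K}

/-- Raising the sea of a colour `j` by one label, if the seas of the smaller colours are higher,
amounts to adding this label in front, up to an invertible scalar. -/
theorem seaWord_update_succ (hn : 0 < n) (hq0 : q ≠ 0) (hq : 1 + q ^ 2 ≠ 0) (b : ℤ) {H : ℕ → ℕ}
    {j : ℕ} (hj : j < n) (hH : ∀ k < j, H j < H k) : ∃ u : K, u ≠ 0 ∧
      wordProd (creation n q) (seaWord n b (Function.update H j (H j + 1)) (List.range n)) =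
        u • (creation n q (n * b + j + 1 + H j * n) *
          wordProd (creation n q) (seaWord n b H (List.range n))) := by
  have hrel := creation_wedgeRelated (q := q) hn
  obtain ⟨k, hk⟩ := Nat.exists_eq_add_of_lt hj
  have hjk : j + (k + 1) = n := by omega
  have hcross := hrel.cross_seaWord hn hq0 (creation_sameColorAnti hn hq0 hq) (hrel.mul_self hq) b
    (H := H) (L := List.range j) (j := j) (i := H j)
    (fun l hl => by have := List.mem_range.1 hl; omega) hj (by simp) fun l hl => by
      have hl := List.mem_range.1 hl
      have := hH l hl
      rw [if_pos hl]
      omega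
  refine ⟨((List.range j).map fun k =>
    crossFactor q (if k < j then H j + 1 else H j) (H k)).prod, ?_, ?_⟩
  rotate_left
  · rw [seaWord_update b H _ hjk, seaWord_range b H hjk, apWord, List.cons_append, wordProd_append,
      wordProd_cons, ← mul_assoc, hcross, smul_mul_assoc, mul_assoc, ← wordProd_append]
  · refine List.prod_ne_zero ?_
    rw [List.mem_map]
    rintro ⟨l, -, h⟩
    exact crossFactor_ne_zero hq0 _ _ h

/-- The seas of constant height `N` are a ground state, up to an invertible scalar. -/
theorem exists_seaWord_const (hn : 0 < n) (hq0 : q ≠ 0) (hq : 1 + q ^ 2 ≠ 0) (b : ℤ) (N : ℕ) :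
    ∃ u : K, u ≠ 0 ∧ wordProd (creation n q) (seaWord n b (fun _ => N) (List.range n))
      (vacuum n q (n * b)) = u • vacuum n q (n * (b + N)) := by
  induction N with
  | zero =>
    refine ⟨1, one_ne_zero, ?_⟩
    have : seaWord n b (fun _ => 0) (List.range n) = [] := by
      simp [seaWord, apWord]
    rw [this, wordProd_nil, Module.End.one_apply, one_smul, Nat.cast_zero, add_zero]
  | succ N ih =>
    -- the seas are raised in the order of their colours
    have key : ∀ j ≤ n, ∃ u : K, u ≠ 0 ∧ wordProd (creation n q)
        (seaWord n b (fun k => if k < j then N + 1 else N) (List.range n))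
        (vacuum n q (n * b)) = u • vacuum n q (n * (b + N) + j) := by
      intro j
      induction j with
      | zero => simpa using ih
      | succ j ihj =>
        intro hj
        obtain ⟨u, hu, e⟩ := ihj (by omega)
        obtain ⟨u', hu', e'⟩ := seaWord_update_succ hn hq0 hq b
          (H := fun k => if k < j then N + 1 else N) (show j < n by omega)
          fun k hk => by simp [hk]
        refine ⟨u' * u, mul_ne_zero hu' hu, ?_⟩
        have e1 : Function.update (fun k => if k < j then N + 1 else N) j
            ((if j < j then N + 1 else N) + 1) = fun k => if k < j + 1 then N + 1 else N := by
          funext k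
          rcases lt_trichotomy k j with h | rfl | h
          · rw [Function.update_of_ne h.ne, if_pos h, if_pos (by omega)]
          · simp
          · rw [Function.update_of_ne h.ne', if_neg (by omega), if_neg (by omega)]
        rw [e1, if_neg (lt_irrefl j)] at e'
        rw [e', LinearMap.smul_apply, Module.End.mul_apply, e, map_smul, smul_smul,
          show (n * b + j + 1 + N * n : ℤ) = n * (b + N) + j + 1 by ring, creation_vacuum]
        congr 2
        push_cast
        ring
    obtain ⟨u, hu, e⟩ := key n le_rfl
    refine ⟨u, hu, ?_⟩
    rw [← show seaWord n b (fun k => if k < n then N + 1 else N) (List.range n) =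
      seaWord n b (fun _ => N + 1) (List.range n) from
        seaWord_congr b fun k hk => if_pos (List.mem_range.1 hk), e]
    congr 2
    push_cast
    ring

/-- An eigenvector of the seas of heights `≤ N` with respect to an operator which commutes with the
creation operators leads to such an eigenvector for the constant height `N`. -/
theorem eigenvector_seaWord_const (hn : 0 < n) (hq0 : q ≠ 0) (hq : 1 + q ^ 2 ≠ 0)
    {C : Module.End K (TotalFock n q)} {γ : K} (hC : ∀ l, Commute C (creation n q l)) (b : ℤ)
    (N : ℕ) (v : TotalFock n q) (d : ℕ) (H : ℕ → ℕ) (hH : ∀ k < n, H k ≤ N)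
    (hd : ∑ k ∈ Finset.range n, (N - H k) = d)
    (h : C (wordProd (creation n q) (seaWord n b H (List.range n)) v) =
      γ • wordProd (creation n q) (seaWord n b H (List.range n)) v) :
    C (wordProd (creation n q) (seaWord n b (fun _ => N) (List.range n)) v) =
      γ • wordProd (creation n q) (seaWord n b (fun _ => N) (List.range n)) v := by
  classical
  induction d using Nat.strong_induction_on generalizing H with
  | _ d ih =>
  by_cases hall : ∀ k < n, H k = N
  · rwa [seaWord_congr b (H := H) (H' := fun _ => N) fun k hk => hall k (List.mem_range.1 hk)] at h
  · have hex : ∃ k, k < n ∧ H k ≠ N := by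
      push Not at hall
      exact hall
    -- the smallest colour whose sea is not yet full
    obtain ⟨hj, hjN⟩ := Nat.find_spec hex
    set j := Nat.find hex
    have hlt : H j < N := lt_of_le_of_ne (hH j hj) hjN
    obtain ⟨u, hu, e⟩ := seaWord_update_succ (q := q) hn hq0 hq b (H := H) hj fun k hk => by
      have := Nat.find_min hex hk
      have : H k = N := by
        by_contra hne
        exact this ⟨hk.trans hj, hne⟩
      omega
    refine ih (∑ k ∈ Finset.range n, (N - Function.update H j (H j + 1) k)) ?_
      (Function.update H j (H j + 1)) ?_ rfl ?_
    · rw [← hd]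
      refine Finset.sum_lt_sum (fun k _ => ?_) ⟨j, Finset.mem_range.2 hj, ?_⟩
      · by_cases hk : k = j
        · subst hk
          rw [Function.update_self]
          omega
        · rw [Function.update_of_ne hk]
      · rw [Function.update_self]
        omega
    · intro k hk
      by_cases hkj : k = j
      · rw [hkj, Function.update_self]
        omega
      · rw [Function.update_of_ne hkj]
        exact hH k hk
    · have hc := congrArg (fun f => f (wordProd (creation n q) (seaWord n b H (List.range n)) v))
        (hC (n * b + j + 1 + H j * n)).eq
      simp only [Module.End.mul_apply] at hc
      rw [e, LinearMap.smul_apply, map_smul, Module.End.mul_apply, hc, h, map_smul, smul_comm]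

/-- The value of `[B_a, B_{-a}]` for `a > 0`. It is read off from seas of heights
`n a, (n - 1) a, …, a`, which are raised to the height `n a` to get a ground state, and `b` is taken
small enough to reach ground states of arbitrarily low charge. -/
theorem bosonComm_neg_nat (hn : 0 < n) (hq0 : q ≠ 0) (hq : 1 + q ^ 2 ≠ 0) {a : ℕ} (ha : 0 < a) :
    bosonComm n q a (-a) = (∑ j ∈ Finset.range n, (a : K) * q ^ (2 * a * j)) • 1 := by
  have hC := bosonComm_commute (q := q) hn hq0 hq (a := a) (b := -a) (by omega) (by omega)
  have hn' : (0 : ℤ) < n := by exact_mod_cast hn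
  refine eq_smul_one_of_vacuum hC fun m₀ => ?_
  have hb : ∃ b : ℤ, n * (b + (n * a : ℕ)) ≤ m₀ := by
    refine ⟨-|m₀| - (n * a : ℕ), ?_⟩
    have h1 : (1 : ℤ) * |m₀| ≤ n * |m₀| := mul_le_mul_of_nonneg_right hn' (abs_nonneg _)
    have h2 := neg_abs_le m₀
    rw [sub_add_cancel]
    linarith
  obtain ⟨b, hb⟩ := hb
  refine ⟨_, hb, ?_⟩
  have hsub : ∀ k j, k < j → j < n → (n - j) * a + a ≤ (n - k) * a := fun k j h1 h2 => by
    rw [← Nat.succ_mul]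
    exact Nat.mul_le_mul_right a (by omega)
  have h1 := bosonComm_seas (q := q) hn hq0 hq ha b (H := fun k => (n - k) * a)
    (fun k hk => Nat.le_mul_of_pos_left a (by omega)) hsub
  have h2 := eigenvector_seaWord_const hn hq0 hq hC b (n * a) _ _ (fun k => (n - k) * a)
    (fun k hk => Nat.mul_le_mul_right a (Nat.sub_le n k)) rfl h1
  obtain ⟨u, hu, e⟩ := exists_seaWord_const (q := q) hn hq0 hq b (n * a)
  rw [e, map_smul, smul_comm] at h2
  exact smul_right_injective _ hu h2

/-- Nonvanishing of the constant, as `q ^ (2 a) - 1` times the geometric sum is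
`q ^ (2 a n) - 1`. -/
theorem sum_pow_ne_zero [CharZero K] (hn : 0 < n) (hq : ∀ k : ℕ, 0 < k → q ^ k ≠ 1) {a : ℕ}
    (ha : 0 < a) : ∑ j ∈ Finset.range n, (a : K) * q ^ (2 * a * j) ≠ 0 := by
  intro h
  rw [← Finset.mul_sum] at h
  have h1 := (mul_eq_zero.1 h).resolve_left (Nat.cast_ne_zero.2 ha.ne')
  simp only [pow_mul q (2 * a)] at h1
  have h2 := mul_geom_sum (q ^ (2 * a)) n
  rw [h1, mul_zero, ← pow_mul] at h2
  exact hq (2 * a * n) (by positivity) (sub_eq_zero.1 h2.symm)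

theorem exists_bosonComm_eq_smul [CharZero K] (hn : 0 < n) (hq0 : q ≠ 0)
    (hq2 : 1 + q ^ 2 ≠ 0) (hq : ∀ k : ℕ, 0 < k → q ^ k ≠ 1) {a : ℤ} (ha : a ≠ 0) :
    ∃ γ : K, γ ≠ 0 ∧ bosonComm n q a (-a) = γ • 1 := by
  rcases Int.lt_or_gt_of_ne ha with h | h
  · obtain ⟨c, hc⟩ := Int.eq_ofNat_of_zero_le (show 0 ≤ -a by omega)
    obtain rfl : a = -c := by omega
    have hc0 : 0 < c := by omega
    refine ⟨_, neg_ne_zero.2 (sum_pow_ne_zero hn hq hc0), ?_⟩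
    rw [neg_smul, ← bosonComm_neg_nat hn hq0 hq2 hc0, bosonComm, bosonComm, neg_neg, neg_sub]
  · obtain ⟨c, rfl⟩ := Int.eq_ofNat_of_zero_le h.le
    have hc0 : 0 < c := by omega
    exact ⟨_, sum_pow_ne_zero hn hq hc0, bosonComm_neg_nat hn hq0 hq2 hc0⟩

/-- The commutator of the operators `B_a` and `B_b` on a summand of the total Fock space. -/
theorem bosonComm_incl (m a b : ℤ) (x : FockSpace n q m) :
    bosonComm n q a b (totalIncl n q m x) = totalIncl n q m (⁅bOp n q m a, bOp n q m b⁆ x) := by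
  rw [bosonComm, LinearMap.sub_apply, Module.End.mul_apply, Module.End.mul_apply, boson_incl,
    boson_incl, boson_incl, boson_incl, Ring.lie_def, LinearMap.sub_apply, map_sub]
  rfl

end Transport

end QFock

end

theorem proposition2p2 {K : Type*} [Field K] [CharZero K] (n : ℕ) (hn : 2 ≤ n)
    (q : K) (hq0 : q ≠ 0) (hq : ∀ k : ℕ, 0 < k → q ^ k ≠ 1) :
    ∃ B : (m : ℤ) → ℤ → Module.End K (QFock.FockSpace n q m),
      (∀ m a : ℤ, a ≠ 0 → QFock.IsBOperator n q m a (B m a)) ∧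
      (∀ a₁ a₂ : ℤ, a₁ ≠ 0 → a₂ ≠ 0 → a₁ + a₂ ≠ 0 → ∀ m : ℤ, ⁅B m a₁, B m a₂⁆ = 0) ∧
      (∀ a : ℤ, a ≠ 0 → ∃ γ : K, γ ≠ 0 ∧
        ∀ m : ℤ, ⁅B m a, B m (-a)⁆ = γ • (1 : Module.End K (QFock.FockSpace n q m)) ∧
          ⁅B m a, B m (-a)⁆ ≠ 0) := by
  have hn0 : 0 < n := by omega
  -- otherwise `q ^ 4 = 1`
  have hq2 : 1 + q ^ 2 ≠ 0 := fun h => hq 4 (by norm_num) (by linear_combination (q ^ 2 - 1) * h)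
  refine ⟨fun m a => QFock.bOp n q m a, fun m a ha => QFock.bOp_spec hn0 hq0 hq2 ha m, ?_, ?_⟩
  · intro a₁ a₂ h₁ h₂ h m
    refine LinearMap.ext fun x => QFock.totalIncl_injective n q m ?_
    rw [← QFock.bosonComm_incl, QFock.bosonComm_eq_zero hn0 hq0 hq2 h₁ h₂ h]
    simp
  · intro a ha
    obtain ⟨γ, hγ, e⟩ := QFock.exists_bosonComm_eq_smul hn0 hq0 hq2 hq ha
    refine ⟨γ, hγ, fun m => ?_⟩
    have key : ⁅QFock.bOp n q m a, QFock.bOp n q m (-a)⁆ =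
        γ • (1 : Module.End K (QFock.FockSpace n q m)) := by
      refine LinearMap.ext fun x => QFock.totalIncl_injective n q m ?_
      rw [← QFock.bosonComm_incl, e]
      simp
    refine ⟨key, fun h0 => ?_⟩
    rw [key] at h0
    -- apply the commutator to the ground state
    have h1 := congrArg (fun f => f ((QFock.wedgeRelations n q m).mkQ
      (Finsupp.single (QFock.ground m) 1))) h0
    simp only [LinearMap.smul_apply, Module.End.one_apply, LinearMap.zero_apply, smul_eq_zero, hγ,
      false_or] at h1
    exact QFock.ground_not_mem hn0 hq0 hq2 ((Submodule.Quotient.mk_eq_zero _).1 h1)
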